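/- All operads are in the category of sets, have no units, and no stability condition is imposed. **Definitions.** A *cyclic operad* $P$ is a functor $S\mapsto P(S)$ from finite sets (including $\emptyset$) and bijections to sets, with compositions ${}_a\circ_b\colon P(S')\times P(S'')\to P(S'\sqcup S''\setminus\{a,b\})$ for $a\in S'$, $b\in S''$, that are equivariant, symmetric ($x\,{}_a\circ_b\,y=y\,{}_b\circ_a\,x$) and associative ($x\,{}_a\circ_b(y\,{}_c\circ_d\,z)=(x\,{}_a\circ_b\,y)\,{}_c\circ_d\,z$ for $b\neq c$ in the middle set). A *modular operad* has components $P(S;g)$, $g\in\mathbb N$, compositions as above that add the genera, and equivariant contractions $\xi_{ab}=\xi_{ba}\colon P(S;g)\to P(S\setminus\{a,b\};g+1)$, $a\ne b$, with $\xi_{ab}\xi_{cd}=\xi_{cd}\xi_{ab}$, $\xi_{ab}(x\,{}_c\circ_d\,y)=\xi_{cd}(x\,{}_a\circ_b\,y)$ (for $a,c$ in the first and $b,d$ in the second set) and $(\xi_{cd}x)\,{}_a\circ_b\,y=\xi_{cd}(x\,{}_a\circ_b\,y)$. A *multicyclically ordered set* ${\sf S}=C_1\cup\dots\cup C_b$ is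 a finite set with a decomposition into $b>0$ possibly empty totally cyclically ordered sets; an isomorphism is an order-preserving bijection together with a compatible bijection of the index sets. It is *cyclically ordered* if $b=1$. For $u\in C_i$, $v\in C_j$, $u\ne v$, the cut ${\sf S}\setminus\{u,v\}$ replaces $C_i=[A\,u]$ and $C_j=[v\,B]$ by the single cyclically ordered set $[A\,B]$ if $i\neq j$, and replaces $C_i=[u\,A\,v\,B]$ by the two cyclically ordered sets $[A]$, $[B]$ if $i=j$. The merging of ${\sf S}'$ and ${\sf S}''$ at $u\in{\sf S}'$, $v\in{\sf S}''$ is the cut of ${\sf S}'\sqcup{\sf S}''$ at $u,v$. A pair $({\sf S},g)$ is *geometric* if $\frac12(g-b+1)\in\mathbb N$. A *non-$\Sigma$ cyclic operad* is defined as a cyclic operad, with cyclically ordered finite sets as arities and merging as the arity of a composition. A *(geometric) non-$\Sigma$ modular operad* is defined as a modular operad, with multicyclically ordered finite sets as arities, mergings and cuts as the arities of compositions and contractions, and $P({\sf S};g)=\emptyset$ unless $({\sf S},g)$ is geometric. Let $\Box$ (resp. $\underline\Box$) be the forgetful functor from modular operads to cyclic operads, $P\mapsto\{P(S;0)\}$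 (resp. from non-$\Sigma$ modular operads to non-$\Sigma$ cyclic operads, $P\mapsto\{P(C;0)\}$, $C$ cyclically ordered). The modular envelope $\mathrm{Mod}$ (resp. $\underline{\mathrm{Mod}}$) is the left adjoint of $\Box$ (resp. $\underline\Box$). Let $*_C$, $*_M$, $\underline*_C$ be the cyclic, modular and non-$\Sigma$ cyclic operads with a one-point set in each arity, and $\underline*_M$ the non-$\Sigma$ modular operad with a one-point set at each geometric $({\sf S},g)$. **Theorem.** The operads $*_C$, $*_M$, $\underline*_C$, $\underline*_M$ are terminal in their categories, and $$\mathrm{Mod}(*_C)\cong *_M,\qquad \underline{\mathrm{Mod}}(\underline*_C)\cong\underline*_M .$$ That is, there is a universal morphism $*_C\to\Box(*_M)$ from $*_C$ to $\Box$ (each morphism $*_C\to\Box P$ factors through it via a unique morphism $*_M\to P$), so that every left adjoint of $\Box$ takes $*_C$ to an operad isomorphic to $*_M$; and likewise in the non-$\Sigma$ case. Equivalently, let $P$ be a modular operad and let $\varsigma(S)\in P(S;0)$, $S$ a finite set, be a family preserved by all bijections and satisfying $\varsigma(S')\,{}_u\circ_v\,\varsigma(S'')=\varsigma(S'\sqcup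 S''\setminus\{u,v\})$. Then there is exactly one family $\varpi(S;g)\in P(S;g)$, preserved by all bijections, with $\varpi(S;0)=\varsigma(S)$, $\varpi(S';g')\,{}_u\circ_v\,\varpi(S'';g'')=\varpi(S'\sqcup S''\setminus\{u,v\};g'+g'')$ and $\xi_{uv}\varpi(S;g)=\varpi(S\setminus\{u,v\};g+1)$. Similarly, in a non-$\Sigma$ modular operad each such family $\varsigma(C)\in P(C;0)$, $C$ cyclically ordered, extends to exactly one such family $\varpi({\sf S};g)\in P({\sf S};g)$ indexed by the geometric pairs $({\sf S},g)$. -/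

import Mathlib

open CategoryTheory

/-! ### Gluing circles, in terms of permutations -/

namespace GluePerm

open scoped Classical in
/-- The permutation `σ` followed by the transposition of `u` and `v`.  If `σ` describes the passage from
a point on a union of oriented circles to the next one, this is the passage after the circles have
been glued at `u` and `v`: on reaching `u` one continues from `v`, and vice versa. -/
noncomputable def glue {α : Type*} (σ : Equiv.Perm α) (u v : α) : Equiv.Perm α :=
  Equiv.swap u v * σ

open scoped Classical in
/-- Removal of the point `w` from its cycle: the predecessor of `w` is sent to the successor of `w`, and
`w` becomes a fixed point. -/
noncomputable def skip {α : Type*} (φ : Equiv.Perm α) (w : α) : Equiv.Perm α :=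
  Equiv.swap w (φ w) * φ

variable {α : Type*}

theorem skip_self (φ : Equiv.Perm α) (w : α) : skip φ w w = w := by
  simp [skip]

theorem skip_of_eq (φ : Equiv.Perm α) {w x : α} (h : φ x = w) : skip φ w x = φ w := by
  simp [skip, h]

theorem skip_of_ne (φ : Equiv.Perm α) {w x : α} (h : φ x ≠ w) (hx : x ≠ w) :
    skip φ w x = φ x := by
  classical
  simp only [skip, Equiv.Perm.mul_apply]
  exact Equiv.swap_apply_of_ne_of_ne h (fun e => hx (φ.injective e))

theorem sameCycle_of_step {f φ : Equiv.Perm α} (h : ∀ x, φ.SameCycle x (f x)) {x y : α}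
    (hxy : f.SameCycle x y) : φ.SameCycle x y := by
  have key : ∀ (n : ℕ) (x : α), φ.SameCycle x ((f ^ n) x) := by
    intro n
    induction n with
    | zero => intro x; exact Equiv.Perm.SameCycle.refl _ _
    | succ n ih =>
      intro x
      rw [pow_succ', Equiv.Perm.mul_apply]
      exact (ih x).trans (h _)
  obtain ⟨i, hi⟩ := hxy
  rcases Int.eq_nat_or_neg i with ⟨n, rfl | rfl⟩
  · rw [zpow_natCast] at hi
    rw [← hi]; exact key n x
  · have : (f ^ n) y = x := by
      rw [← hi, ← zpow_natCast, ← Equiv.Perm.mul_apply, ← zpow_add]; simp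
    rw [← this]; exact (key n y).symm

theorem sameCycle_skip [Finite α] (φ : Equiv.Perm α) (w : α) {x y : α} (hx : x ≠ w) (hy : y ≠ w) :
    (skip φ w).SameCycle x y ↔ φ.SameCycle x y := by
  constructor
  · refine sameCycle_of_step (fun z => ?_)
    by_cases hz : z = w
    · subst hz; rw [skip_self]
    by_cases h : φ z = w
    · rw [skip_of_eq φ h, ← h]
      simp only [Equiv.Perm.sameCycle_apply_right]
      exact Equiv.Perm.SameCycle.refl _ _
    · rw [skip_of_ne φ h hz]
      simp only [Equiv.Perm.sameCycle_apply_right]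
      exact Equiv.Perm.SameCycle.refl _ _
  · intro h
    obtain ⟨n, hn⟩ := h.exists_nat_pow_eq
    subst hn
    induction n using Nat.strong_induction_on with
    | _ n ih =>
      match n with
      | 0 => exact Equiv.Perm.SameCycle.refl _ _
      | 1 =>
        have hy' : φ x ≠ w := by simpa using hy
        have := skip_of_ne φ hy' hx
        simp only [pow_one]
        rw [← this]; simp only [Equiv.Perm.sameCycle_apply_right]
        exact Equiv.Perm.SameCycle.refl _ _
      | m + 2 =>
        have e1 : (φ ^ (m + 2)) x = φ ((φ ^ (m + 1)) x) := by
          rw [pow_succ', Equiv.Perm.mul_apply]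
        have e2 : (φ ^ (m + 1)) x = φ ((φ ^ m) x) := by
          rw [pow_succ', Equiv.Perm.mul_apply]
        rw [e1] at hy ⊢
        by_cases hz : (φ ^ (m + 1)) x = w
        · have hz' : (φ ^ m) x ≠ w := by
            intro h'
            rw [e2, h'] at hz
            exact hy (by rw [e2, h', hz, hz])
          have hm := ih m (by omega) hz' ⟨m, by simp⟩
          have : skip φ w ((φ ^ m) x) = φ w := skip_of_eq φ (by rw [← e2, hz])
          rw [hz, ← this]
          simpa only [Equiv.Perm.sameCycle_apply_right] using hm
        · have hm := ih (m + 1) (by omega) hz ⟨((m + 1 : ℕ) : ℤ), by rw [zpow_natCast]⟩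
          rw [← skip_of_ne φ hy hz]
          simpa only [Equiv.Perm.sameCycle_apply_right] using hm

theorem skip_skip_mem (φ : Equiv.Perm α) (u v x : α) :
    (skip (skip φ u) v x ≠ u ∧ skip (skip φ u) v x ≠ v) ↔ (x ≠ u ∧ x ≠ v) := by
  have hv : skip (skip φ u) v v = v := skip_self _ _
  have hu : skip (skip φ u) v u = u := by
    by_cases h : u = v
    · subst h; exact hv
    · have h1 : skip φ u u = u := skip_self _ _
      rw [skip_of_ne _ (by rw [h1]; exact h) h, h1]
  have key : ∀ w, skip (skip φ u) v w = w → (skip (skip φ u) v x ≠ w ↔ x ≠ w) := by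
    intro w hw
    conv_lhs => rw [← hw]
    simp only [ne_eq, EmbeddingLike.apply_eq_iff_eq]
  rw [key u hu, key v hv]

/-- The permutation of the complement of `{u, v}` obtained from `φ` by removing `u` and `v` from their
cycles. -/
noncomputable def firstReturn (φ : Equiv.Perm α) (u v : α) :
    Equiv.Perm {x : α // x ≠ u ∧ x ≠ v} :=
  (skip (skip φ u) v).subtypePerm (skip_skip_mem φ u v)

theorem sameCycle_firstReturn [Finite α] (φ : Equiv.Perm α) (u v : α)
    (x y : {x : α // x ≠ u ∧ x ≠ v}) :
    (firstReturn φ u v).SameCycle x y ↔ φ.SameCycle x.1 y.1 := by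
  rw [firstReturn, Equiv.Perm.sameCycle_subtypePerm, sameCycle_skip _ _ x.2.2 y.2.2,
    sameCycle_skip _ _ x.2.1 y.2.1]

theorem glue_apply_of_ne (σ : Equiv.Perm α) {u v x : α} (hu : σ x ≠ u) (hv : σ x ≠ v) :
    glue σ u v x = σ x := by
  classical
  simp only [glue, Equiv.Perm.mul_apply]
  exact Equiv.swap_apply_of_ne_of_ne hu hv

theorem glue_apply_left (σ : Equiv.Perm α) {u v x : α} (h : σ x = u) : glue σ u v x = v := by
  simp [glue, h]

theorem glue_apply_right (σ : Equiv.Perm α) {u v x : α} (h : σ x = v) : glue σ u v x = u := by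
  simp [glue, h]

theorem glue_glue (σ : Equiv.Perm α) (u v : α) : glue (glue σ u v) u v = σ := by
  ext x; simp [glue]

theorem glue_comm (σ : Equiv.Perm α) (u v : α) : glue σ u v = glue σ v u := by
  simp [glue, Equiv.swap_comm]

theorem sameCycle_glue_of_left [Finite α] {σ : Equiv.Perm α} {u v : α} (h : ¬ σ.SameCycle u v)
    {x : α} (hx : σ.SameCycle u x) : (glue σ u v).SameCycle u x := by
  obtain ⟨n, rfl⟩ := hx.exists_nat_pow_eq
  clear hx
  induction n with
  | zero => exact Equiv.Perm.SameCycle.refl _ _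
  | succ n ih =>
    have e : (σ ^ (n + 1)) u = σ ((σ ^ n) u) := by rw [pow_succ', Equiv.Perm.mul_apply]
    rw [e]
    have hv : σ ((σ ^ n) u) ≠ v := by
      rw [← e]; intro h'; exact h ⟨((n + 1 : ℕ) : ℤ), by rw [zpow_natCast, h']⟩
    by_cases hu : σ ((σ ^ n) u) = u
    · rw [hu]
    · rw [← glue_apply_of_ne σ hu hv]
      simpa only [Equiv.Perm.sameCycle_apply_right] using ih

theorem sameCycle_glue [Finite α] {σ : Equiv.Perm α} {u v : α} (h : ¬ σ.SameCycle u v) :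
    (glue σ u v).SameCycle u v := by
  have h1 : (glue σ u v).SameCycle u (σ.symm u) :=
    sameCycle_glue_of_left h (by simp [Equiv.Perm.SameCycle.refl])
  have h2 : glue σ u v (σ.symm u) = v := glue_apply_left σ (by simp)
  have h3 := (Equiv.Perm.sameCycle_apply_right (f := glue σ u v)).2 h1
  rwa [h2] at h3

theorem sameCycle_glue_of_right [Finite α] {σ : Equiv.Perm α} {u v : α} (h : ¬ σ.SameCycle u v)
    {x : α} (hx : σ.SameCycle v x) : (glue σ u v).SameCycle v x := by
  rw [glue_comm]
  exact sameCycle_glue_of_left (fun h' => h h'.symm) hx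

theorem sameCycle_glue_of_sameCycle [Finite α] {σ : Equiv.Perm α} {u v : α}
    (h : ¬ σ.SameCycle u v) {x y : α} (hxy : σ.SameCycle x y) : (glue σ u v).SameCycle x y := by
  refine sameCycle_of_step (fun z => ?_) hxy
  by_cases hu : σ.SameCycle u z
  · exact (sameCycle_glue_of_left h hu).symm.trans (sameCycle_glue_of_left h (by simpa using hu))
  by_cases hv : σ.SameCycle v z
  · exact (sameCycle_glue_of_right h hv).symm.trans (sameCycle_glue_of_right h (by simpa using hv))
  have h1 : σ z ≠ u := fun e => hu (by rw [← e]; simp [Equiv.Perm.SameCycle.refl])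
  have h2 : σ z ≠ v := fun e => hv (by rw [← e]; simp [Equiv.Perm.SameCycle.refl])
  rw [← glue_apply_of_ne σ h1 h2]
  simp [Equiv.Perm.SameCycle.refl]

theorem sameCycle_glue_cases [Finite α] {σ : Equiv.Perm α} {u v : α} {x y : α}
    (hxy : (glue σ u v).SameCycle x y) :
    σ.SameCycle x y ∨ ((σ.SameCycle u x ∨ σ.SameCycle v x) ∧
      (σ.SameCycle u y ∨ σ.SameCycle v y)) := by
  obtain ⟨n, rfl⟩ := hxy.exists_nat_pow_eq
  clear hxy
  induction n with
  | zero => exact Or.inl (Equiv.Perm.SameCycle.refl _ _)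
  | succ n ih =>
    rw [pow_succ', Equiv.Perm.mul_apply]
    set z := ((glue σ u v) ^ n) x
    have rr : ∀ w, σ.SameCycle w w := fun w => Equiv.Perm.SameCycle.refl _ _
    by_cases hu : σ z = u
    · have hz : σ.SameCycle u z := by rw [← hu]; simp [Equiv.Perm.SameCycle.refl]
      rw [glue_apply_left σ hu]
      rcases ih with h | ⟨h, -⟩
      · exact Or.inr ⟨Or.inl (hz.trans h.symm), Or.inr (rr _)⟩
      · exact Or.inr ⟨h, Or.inr (rr _)⟩
    by_cases hv : σ z = v
    · have hz : σ.SameCycle v z := by rw [← hv]; simp [Equiv.Perm.SameCycle.refl]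
      rw [glue_apply_right σ hv]
      rcases ih with h | ⟨h, -⟩
      · exact Or.inr ⟨Or.inr (hz.trans h.symm), Or.inl (rr _)⟩
      · exact Or.inr ⟨h, Or.inl (rr _)⟩
    rw [glue_apply_of_ne σ hu hv]
    simpa only [Equiv.Perm.sameCycle_apply_right] using ih

theorem not_sameCycle_glue [Finite α] {σ : Equiv.Perm α} {u v : α} (huv : u ≠ v)
    (h : σ.SameCycle u v) : ¬ (glue σ u v).SameCycle u v := by
  classical
  have hex : ∃ n : ℕ, (σ ^ n) u = v := h.exists_nat_pow_eq
  have hm := Nat.find_spec hex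
  have hlt : ∀ i, i < Nat.find hex → (σ ^ i) u ≠ v := fun i hi => Nat.find_min hex hi
  set m := Nat.find hex with hm_def
  have hm0 : m ≠ 0 := by intro h0; rw [h0] at hm; exact huv (by simpa using hm)
  have hne : ∀ i, 0 < i → i < m → (σ ^ i) u ≠ u := by
    intro i hi him he
    have : (σ ^ (m - i)) u = v := by
      have e : m = (m - i) + i := by omega
      rw [← hm]
      conv_rhs => rw [e, pow_add, Equiv.Perm.mul_apply, he]
    exact hlt (m - i) (by omega) this
  have key : ∀ n : ℕ, ∃ i, i < m ∧ ((glue σ u v) ^ n) u = (σ ^ i) u := by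
    intro n
    induction n with
    | zero => exact ⟨0, by omega, rfl⟩
    | succ n ih =>
      obtain ⟨i, hi, he⟩ := ih
      rw [pow_succ', Equiv.Perm.mul_apply, he]
      have e : (σ ^ (i + 1)) u = σ ((σ ^ i) u) := by rw [pow_succ', Equiv.Perm.mul_apply]
      by_cases hi' : i + 1 = m
      · refine ⟨0, by omega, ?_⟩
        rw [glue_apply_right σ (by rw [← e, hi', hm])]
        simp
      · refine ⟨i + 1, by omega, ?_⟩
        rw [glue_apply_of_ne σ (by rw [← e]; exact hne _ (by omega) (by omega))
          (by rw [← e]; exact hlt _ (by omega)), e]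
  intro hs
  obtain ⟨n, hn⟩ := hs.exists_nat_pow_eq
  obtain ⟨i, hi, he⟩ := key n
  exact hlt i hi (by rw [← he, hn])

/-- The set of cycles of a permutation, fixed points included. -/
abbrev Cycles (σ : Equiv.Perm α) : Type _ := Quotient (Equiv.Perm.SameCycle.setoid σ)

theorem mk_eq_iff (σ : Equiv.Perm α) (x y : α) :
    (Quotient.mk (Equiv.Perm.SameCycle.setoid σ) x = Quotient.mk _ y) ↔ σ.SameCycle x y :=
  Quotient.eq (r := Equiv.Perm.SameCycle.setoid σ)

theorem card_cycles_glue_of_not [Finite α] {σ : Equiv.Perm α} {u v : α}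
    (h : ¬ σ.SameCycle u v) : Nat.card (Cycles (glue σ u v)) + 1 = Nat.card (Cycles σ) := by
  classical
  have : Fintype (Cycles σ) := Fintype.ofFinite _
  have hcard : Nat.card {q : Cycles σ // q ≠ Quotient.mk _ v} + 1 = Nat.card (Cycles σ) := by
    rw [Nat.card_eq_fintype_card, Nat.card_eq_fintype_card, Fintype.card_subtype_compl,
      Fintype.card_subtype_eq]
    have : 0 < Fintype.card (Cycles σ) := Fintype.card_pos_iff.2 ⟨Quotient.mk _ v⟩
    omega
  rw [← hcard]
  congr 1
  let f : Cycles σ → Cycles (glue σ u v) :=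
    Quotient.map' id (fun x y hxy => sameCycle_glue_of_sameCycle h hxy)
  have hf : ∀ x, f (Quotient.mk _ x) = Quotient.mk _ x := fun x => rfl
  symm
  refine Nat.card_congr (Equiv.ofBijective (fun q => f q.1) ⟨?_, ?_⟩)
  · rintro ⟨p, hp⟩ ⟨q, hq⟩ hpq
    induction p using Quotient.inductionOn with | _ x => ?_
    induction q using Quotient.inductionOn with | _ y => ?_
    simp only [hf, mk_eq_iff] at hpq
    rw [ne_eq, mk_eq_iff] at hp hq
    rw [Subtype.mk.injEq, mk_eq_iff]
    rcases sameCycle_glue_cases hpq with h1 | ⟨h1 | h1, h2 | h2⟩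
    · exact h1
    · exact h1.symm.trans h2
    · exact absurd h2.symm hq
    · exact absurd h1.symm hp
    · exact absurd h1.symm hp
  · intro q
    induction q using Quotient.inductionOn with | _ x => ?_
    by_cases hx : σ.SameCycle x v
    · refine ⟨⟨Quotient.mk _ u, by rw [ne_eq, mk_eq_iff]; exact h⟩, ?_⟩
      simp only [hf, mk_eq_iff]
      exact (sameCycle_glue h).trans (sameCycle_glue_of_right h hx.symm)
    · exact ⟨⟨Quotient.mk _ x, by rw [ne_eq, mk_eq_iff]; exact hx⟩, rfl⟩

theorem card_cycles_glue_of_sameCycle [Finite α] {σ : Equiv.Perm α} {u v : α} (huv : u ≠ v)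
    (h : σ.SameCycle u v) : Nat.card (Cycles (glue σ u v)) = Nat.card (Cycles σ) + 1 := by
  have := card_cycles_glue_of_not (not_sameCycle_glue huv h)
  rw [glue_glue] at this
  omega

end GluePerm

/-! ### Removing two elements and grafting, for plain finite sets -/

/-- The set `S \ {a, b}`. -/
abbrev Without {S : Type*} (a b : S) : Type _ := {x : S // x ≠ a ∧ x ≠ b}

/-- The set `(S ⊔ T) \ {a, b}` for `a ∈ S` and `b ∈ T`. -/
abbrev Graft {S T : Type*} (a : S) (b : T) : Type _ :=
  Without (Sum.inl a : S ⊕ T) (Sum.inr b)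

/-- An element `x ≠ a` of `S`, regarded as an element of `(S ⊔ T) \ {a, b}`. -/
def Graft.left {S T : Type*} {a : S} {b : T} (x : S) (h : x ≠ a) : Graft a b :=
  ⟨Sum.inl x, by simpa using h, by simp⟩

/-- An element `y ≠ b` of `T`, regarded as an element of `(S ⊔ T) \ {a, b}`. -/
def Graft.right {S T : Type*} {a : S} {b : T} (y : T) (h : y ≠ b) : Graft a b :=
  ⟨Sum.inr y, by simp, by simpa using h⟩

/-! ### Cyclic operads in sets -/

universe u v

/-- A cyclic operad in the category of sets, with arities arbitrary finite sets (including the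
empty one), without units.  In each axiom, `θ` is the canonical bijection between the two finite
sets in question, i.e. the one that is the identity on underlying elements (or, in `map_comp`,
the restriction of the given bijections). -/
structure CyclicOperad where
  obj (S : Type u) [Finite S] : Type v
  map {S T : Type u} [Finite S] [Finite T] (ρ : S ≃ T) : obj S → obj T
  map_refl {S : Type u} [Finite S] (x : obj S) : map (Equiv.refl S) x = x
  map_trans {S T R : Type u} [Finite S] [Finite T] [Finite R] (ρ : S ≃ T) (τ : T ≃ R) (x : obj S) :
    map (ρ.trans τ) x = map τ (map ρ x)
  comp {S T : Type u} [Finite S] [Finite T] (a : S) (b : T) : obj S → obj T → obj (Graft a b)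
  comp_symm {S T : Type u} [Finite S] [Finite T] (a : S) (b : T) (x : obj S) (y : obj T)
    (θ : Graft b a ≃ Graft a b) (_ : ∀ z, (θ z).1 = z.1.swap) :
    map θ (comp b a y x) = comp a b x y
  comp_assoc {S₁ S₂ S₃ : Type u} [Finite S₁] [Finite S₂] [Finite S₃]
    (a : S₁) (b c : S₂) (d : S₃) (hbc : b ≠ c) (x : obj S₁) (y : obj S₂) (z : obj S₃)
    (θ : Graft a (Graft.left (a := c) (b := d) b hbc) ≃
      Graft (Graft.right (a := a) (b := b) c hbc.symm) d)
    (_ : ∀ w, Equiv.sumAssoc S₁ S₂ S₃ (Sum.map Subtype.val id (θ w).1) =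
      Sum.map id Subtype.val w.1) :
    map θ (comp a (Graft.left b hbc) x (comp c d y z)) =
      comp (Graft.right c hbc.symm) d (comp a b x y) z
  map_comp {S T S' T' : Type u} [Finite S] [Finite T] [Finite S'] [Finite T']
    (ρ : S ≃ S') (τ : T ≃ T') (a : S) (b : T) (x : obj S) (y : obj T)
    (θ : Graft a b ≃ Graft (ρ a) (τ b)) (_ : ∀ z, (θ z).1 = Sum.map ρ τ z.1) :
    map θ (comp a b x y) = comp (ρ a) (τ b) (map ρ x) (map τ y)

namespace CyclicOperad

/-- A morphism of cyclic operads. -/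
@[ext]
structure Hom (P Q : CyclicOperad.{u, v}) where
  app (S : Type u) [Finite S] : P.obj S → Q.obj S
  app_map {S T : Type u} [Finite S] [Finite T] (ρ : S ≃ T) (x : P.obj S) :
    app T (P.map ρ x) = Q.map ρ (app S x)
  app_comp {S T : Type u} [Finite S] [Finite T] (a : S) (b : T) (x : P.obj S) (y : P.obj T) :
    app _ (P.comp a b x y) = Q.comp a b (app S x) (app T y)

instance : Category CyclicOperad.{u, v} where
  Hom := Hom
  id P :=
    { app := fun _ _ x => x
      app_map := fun _ _ => rfl
      app_comp := fun _ _ _ _ => rfl }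
  comp F G :=
    { app := fun S _ x => G.app S (F.app S x)
      app_map := fun ρ x => by rw [F.app_map, G.app_map]
      app_comp := fun a b x y => by rw [F.app_comp, G.app_comp] }

/-- The cyclic operad `*_C` with a one-point set in each arity. -/
def point : CyclicOperad.{u, v} where
  obj _ _ := PUnit
  map _ x := x
  map_refl _ := rfl
  map_trans _ _ _ := rfl
  comp _ _ _ _ := PUnit.unit
  comp_symm _ _ _ _ _ _ := rfl
  comp_assoc _ _ _ _ _ _ _ _ _ _ := rfl
  map_comp _ _ _ _ _ _ _ _ := rfl

/-- An internal operad in the cyclic operad `P`. -/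
structure IsInternal (P : CyclicOperad.{u, v}) (ς : ∀ (S : Type u) [Finite S], P.obj S) :
    Prop where
  map {S T : Type u} [Finite S] [Finite T] (ρ : S ≃ T) : P.map ρ (ς S) = ς T
  comp {S T : Type u} [Finite S] [Finite T] (a : S) (b : T) :
    P.comp a b (ς S) (ς T) = ς (Graft a b)

end CyclicOperad

/-! ### Modular operads in sets -/

/-- A modular operad in the category of sets, with arities arbitrary finite sets, graded by the
genus, without units and without a stability condition.  The genus of a composition is written as
a number `k` with `g + h = k`.  In each axiom, `θ` is the canonical bijection between the two
finite sets in question, i.e. the one that is the identity on underlying elements (or, in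
`map_comp` and `map_contr`, the restriction of the given bijections). -/
structure ModularOperad where
  obj (S : Type u) [Finite S] (g : ℕ) : Type v
  map {S T : Type u} [Finite S] [Finite T] {g : ℕ} (ρ : S ≃ T) : obj S g → obj T g
  map_refl {S : Type u} [Finite S] {g : ℕ} (x : obj S g) : map (Equiv.refl S) x = x
  map_trans {S T R : Type u} [Finite S] [Finite T] [Finite R] {g : ℕ} (ρ : S ≃ T) (τ : T ≃ R)
    (x : obj S g) : map (ρ.trans τ) x = map τ (map ρ x)
  comp {S T : Type u} [Finite S] [Finite T] {g h k : ℕ} (a : S) (b : T) (_ : g + h = k) :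
    obj S g → obj T h → obj (Graft a b) k
  contr {S : Type u} [Finite S] {g : ℕ} (a b : S) (_ : a ≠ b) : obj S g → obj (Without a b) (g + 1)
  contr_symm {S : Type u} [Finite S] {g : ℕ} (a b : S) (hab : a ≠ b) (x : obj S g)
    (θ : Without b a ≃ Without a b) (_ : ∀ z, (θ z).1 = z.1) :
    map θ (contr b a hab.symm x) = contr a b hab x
  comp_symm {S T : Type u} [Finite S] [Finite T] {g h k : ℕ} (a : S) (b : T)
    (hk : g + h = k) (hk' : h + g = k) (x : obj S g) (y : obj T h)
    (θ : Graft b a ≃ Graft a b) (_ : ∀ z, (θ z).1 = z.1.swap) :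
    map θ (comp b a hk' y x) = comp a b hk x y
  comp_assoc {S₁ S₂ S₃ : Type u} [Finite S₁] [Finite S₂] [Finite S₃] {g₁ g₂ g₃ g₁₂ g₂₃ g : ℕ}
    (h₁₂ : g₁ + g₂ = g₁₂) (h₂₃ : g₂ + g₃ = g₂₃) (hl : g₁ + g₂₃ = g) (hr : g₁₂ + g₃ = g)
    (a : S₁) (b c : S₂) (d : S₃) (hbc : b ≠ c) (x : obj S₁ g₁) (y : obj S₂ g₂) (z : obj S₃ g₃)
    (θ : Graft a (Graft.left (a := c) (b := d) b hbc) ≃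
      Graft (Graft.right (a := a) (b := b) c hbc.symm) d)
    (_ : ∀ w, Equiv.sumAssoc S₁ S₂ S₃ (Sum.map Subtype.val id (θ w).1) =
      Sum.map id Subtype.val w.1) :
    map θ (comp a (Graft.left b hbc) hl x (comp c d h₂₃ y z)) =
      comp (Graft.right c hbc.symm) d hr (comp a b h₁₂ x y) z
  contr_contr {S : Type u} [Finite S] {g : ℕ} (a b c d : S) (hab : a ≠ b) (hac : a ≠ c)
    (had : a ≠ d) (hbc : b ≠ c) (hbd : b ≠ d) (hcd : c ≠ d) (x : obj S g)
    (θ : Without (⟨a, hac, had⟩ : Without c d) ⟨b, hbc, hbd⟩ ≃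
      Without (⟨c, hac.symm, hbc.symm⟩ : Without a b) ⟨d, had.symm, hbd.symm⟩)
    (_ : ∀ z, (θ z).1.1 = z.1.1) :
    map θ (contr ⟨a, hac, had⟩ ⟨b, hbc, hbd⟩ (by simpa using hab) (contr c d hcd x)) =
      contr ⟨c, hac.symm, hbc.symm⟩ ⟨d, had.symm, hbd.symm⟩ (by simpa using hcd)
        (contr a b hab x)
  contr_comp {S T : Type u} [Finite S] [Finite T] {g h k : ℕ} (hk : g + h = k)
    (a c : S) (b d : T) (hac : a ≠ c) (hbd : b ≠ d) (x : obj S g) (y : obj T h)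
    (θ : Without (Graft.left a hac : Graft c d) (Graft.right b hbd) ≃
      Without (Graft.left c hac.symm : Graft a b) (Graft.right d hbd.symm))
    (_ : ∀ z, (θ z).1.1 = z.1.1) :
    map θ (contr (Graft.left a hac) (Graft.right b hbd) (by simp [Graft.left, Graft.right])
        (comp c d hk x y)) =
      contr (Graft.left c hac.symm) (Graft.right d hbd.symm) (by simp [Graft.left, Graft.right])
        (comp a b hk x y)
  comp_contr {S T : Type u} [Finite S] [Finite T] {g h k : ℕ} (hk : g + h = k)
    (hk' : g + 1 + h = k + 1) (a c d : S) (b : T) (hac : a ≠ c) (had : a ≠ d) (hcd : c ≠ d)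
    (x : obj S g) (y : obj T h)
    (θ : Graft (⟨a, hac, had⟩ : Without c d) b ≃
      Without (Graft.left c hac.symm : Graft a b) (Graft.left d had.symm))
    (_ : ∀ z, (θ z).1.1 = Sum.map Subtype.val id z.1) :
    map θ (comp ⟨a, hac, had⟩ b hk' (contr c d hcd x) y) =
      contr (Graft.left c hac.symm) (Graft.left d had.symm) (by simpa [Graft.left] using hcd)
        (comp a b hk x y)
  map_comp {S T S' T' : Type u} [Finite S] [Finite T] [Finite S'] [Finite T'] {g h k : ℕ}
    (hk : g + h = k) (ρ : S ≃ S') (τ : T ≃ T') (a : S) (b : T) (x : obj S g) (y : obj T h)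
    (θ : Graft a b ≃ Graft (ρ a) (τ b)) (_ : ∀ z, (θ z).1 = Sum.map ρ τ z.1) :
    map θ (comp a b hk x y) = comp (ρ a) (τ b) hk (map ρ x) (map τ y)
  map_contr {S S' : Type u} [Finite S] [Finite S'] {g : ℕ} (ρ : S ≃ S') (a b : S) (hab : a ≠ b)
    (x : obj S g) (θ : Without a b ≃ Without (ρ a) (ρ b)) (_ : ∀ z, (θ z).1 = ρ z.1) :
    map θ (contr a b hab x) = contr (ρ a) (ρ b) (ρ.injective.ne hab) (map ρ x)

namespace ModularOperad

/-- A morphism of modular operads. -/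
@[ext]
structure Hom (P Q : ModularOperad.{u, v}) where
  app (S : Type u) [Finite S] (g : ℕ) : P.obj S g → Q.obj S g
  app_map {S T : Type u} [Finite S] [Finite T] {g : ℕ} (ρ : S ≃ T) (x : P.obj S g) :
    app T g (P.map ρ x) = Q.map ρ (app S g x)
  app_comp {S T : Type u} [Finite S] [Finite T] {g h k : ℕ} (a : S) (b : T) (hk : g + h = k)
    (x : P.obj S g) (y : P.obj T h) :
    app _ k (P.comp a b hk x y) = Q.comp a b hk (app S g x) (app T h y)
  app_contr {S : Type u} [Finite S] {g : ℕ} (a b : S) (hab : a ≠ b) (x : P.obj S g) :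
    app _ _ (P.contr a b hab x) = Q.contr a b hab (app S g x)

instance : Category ModularOperad.{u, v} where
  Hom := Hom
  id P :=
    { app := fun _ _ _ x => x
      app_map := fun _ _ => rfl
      app_comp := fun _ _ _ _ _ => rfl
      app_contr := fun _ _ _ _ => rfl }
  comp F G :=
    { app := fun S _ g x => G.app S g (F.app S g x)
      app_map := fun ρ x => by rw [F.app_map, G.app_map]
      app_comp := fun a b hk x y => by rw [F.app_comp, G.app_comp]
      app_contr := fun a b hab x => by rw [F.app_contr, G.app_contr] }

/-- The modular operad `*_M` with a one-point set in each arity and genus. -/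
def point : ModularOperad.{u, v} where
  obj _ _ _ := PUnit
  map _ x := x
  map_refl _ := rfl
  map_trans _ _ _ := rfl
  comp _ _ _ _ _ := PUnit.unit
  contr _ _ _ _ := PUnit.unit
  contr_symm _ _ _ _ _ _ := rfl
  comp_symm _ _ _ _ _ _ _ _ := rfl
  comp_assoc _ _ _ _ _ _ _ _ _ _ _ _ _ _ := rfl
  contr_contr _ _ _ _ _ _ _ _ _ _ _ _ _ := rfl
  contr_comp _ _ _ _ _ _ _ _ _ _ _ := rfl
  comp_contr _ _ _ _ _ _ _ _ _ _ _ _ _ := rfl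
  map_comp _ _ _ _ _ _ _ _ _ := rfl
  map_contr _ _ _ _ _ _ _ := rfl

/-- The genus zero part of a modular operad, a cyclic operad. -/
def genusZero (P : ModularOperad.{u, v}) : CyclicOperad.{u, v} where
  obj S _ := P.obj S 0
  map ρ := P.map ρ
  map_refl := P.map_refl
  map_trans := P.map_trans
  comp a b := P.comp a b (zero_add 0)
  comp_symm a b := P.comp_symm a b _ _
  comp_assoc := P.comp_assoc _ _ _ _
  map_comp := P.map_comp _

/-- The forgetful functor `□` from modular operads to cyclic operads. -/
def forget : ModularOperad.{u, v} ⥤ CyclicOperad.{u, v} where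
  obj := genusZero
  map F :=
    { app := fun S _ => F.app S 0
      app_map := F.app_map
      app_comp := fun a b => F.app_comp a b _ }

/-- An internal operad in the modular operad `P`. -/
structure IsInternal (P : ModularOperad.{u, v})
    (ϖ : ∀ (S : Type u) [Finite S] (g : ℕ), P.obj S g) : Prop where
  map {S T : Type u} [Finite S] [Finite T] {g : ℕ} (ρ : S ≃ T) : P.map ρ (ϖ S g) = ϖ T g
  comp {S T : Type u} [Finite S] [Finite T] {g h k : ℕ} (a : S) (b : T) (hk : g + h = k) :
    P.comp a b hk (ϖ S g) (ϖ T h) = ϖ (Graft a b) k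
  contr {S : Type u} [Finite S] {g : ℕ} (a b : S) (hab : a ≠ b) :
    P.contr a b hab (ϖ S g) = ϖ (Without a b) (g + 1)

end ModularOperad

/-! ### Multicyclically ordered sets -/

/-- A finite multicyclically ordered set: a finite set `carrier` with a decomposition into
finitely many, but at least one, possibly empty, totally cyclically ordered parts.  The parts are
indexed by the finite non-empty set `index`, and `part x` is the part that contains `x`.
The total cyclic orders of all (finite) parts are encoded by the permutation `next`, which sends
an element to its immediate successor in its part (a one-element part being its own successor):
a total cyclic order on a finite set is the same as a permutation with at most one orbit. -/
structure MultCyc where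
  carrier : Type u
  index : Type u
  part : carrier → index
  next : Equiv.Perm carrier
  finite_carrier : Finite carrier
  finite_index : Finite index
  nonempty_index : Nonempty index
  part_eq_iff : ∀ x y, part x = part y ↔ next.SameCycle x y

namespace MultCyc

instance (S : MultCyc.{u}) : Finite S.carrier := S.finite_carrier
instance (S : MultCyc.{u}) : Finite S.index := S.finite_index
instance (S : MultCyc.{u}) : Nonempty S.index := S.nonempty_index

/-- Isomorphisms of multicyclically ordered sets: a bijection of the underlying sets that preserves
the cyclic orders, together with a compatible bijection between the indexing sets. -/
@[ext]
structure Iso (S T : MultCyc.{u}) where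
  toEquiv : S.carrier ≃ T.carrier
  indexEquiv : S.index ≃ T.index
  part_apply : ∀ x, T.part (toEquiv x) = indexEquiv (S.part x)
  next_apply : ∀ x, T.next (toEquiv x) = toEquiv (S.next x)

/-- The identity. -/
def Iso.refl (S : MultCyc.{u}) : Iso S S where
  toEquiv := Equiv.refl _
  indexEquiv := Equiv.refl _
  part_apply _ := rfl
  next_apply _ := rfl

/-- Composition of isomorphisms. -/
def Iso.trans {S T R : MultCyc.{u}} (ρ : Iso S T) (τ : Iso T R) : Iso S R where
  toEquiv := ρ.toEquiv.trans τ.toEquiv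
  indexEquiv := ρ.indexEquiv.trans τ.indexEquiv
  part_apply x := by simp [τ.part_apply, ρ.part_apply]
  next_apply x := by simp [τ.next_apply, ρ.next_apply]

/-- The indices of the empty parts. -/
abbrev EmptyPart (S : MultCyc.{u}) : Type u := {i : S.index // ∀ x, S.part x ≠ i}

/-- The set of arcs.  If one draws the elements of each part on an oriented circle, they cut the
circle into arcs: `Sum.inl x` is the arc from `x` to its successor, and `Sum.inr i` is the whole
circle of the empty part `i`. -/
abbrev Arc (S : MultCyc.{u}) : Type u := S.carrier ⊕ S.EmptyPart

/-- The bijection between the arcs induced by an isomorphism. -/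
def Iso.onArc {S T : MultCyc.{u}} (ρ : Iso S T) : S.Arc → T.Arc
  | Sum.inl x => Sum.inl (ρ.toEquiv x)
  | Sum.inr i => Sum.inr ⟨ρ.indexEquiv i.1, fun y hy => i.2 (ρ.toEquiv.symm y) (by
      apply ρ.indexEquiv.injective
      rw [← ρ.part_apply, Equiv.apply_symm_apply, hy])⟩

/-- The disjoint union of multicyclically ordered sets. -/
def disjointUnion (S T : MultCyc.{u}) : MultCyc.{u} where
  carrier := S.carrier ⊕ T.carrier
  index := S.index ⊕ T.index
  part := Sum.map S.part T.part
  next := Equiv.sumCongr S.next T.next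
  finite_carrier := inferInstance
  finite_index := inferInstance
  nonempty_index := inferInstance
  part_eq_iff := by
    have hl : ∀ (n : ℕ) (x : S.carrier), ((Equiv.sumCongr S.next T.next :
        Equiv.Perm (S.carrier ⊕ T.carrier)) ^ n) (Sum.inl x) = Sum.inl ((S.next ^ n) x) := by
      intro n x
      induction n with
      | zero => rfl
      | succ n ih => rw [pow_succ', Equiv.Perm.mul_apply, ih, pow_succ', Equiv.Perm.mul_apply]; rfl
    have hr : ∀ (n : ℕ) (x : T.carrier), ((Equiv.sumCongr S.next T.next :
        Equiv.Perm (S.carrier ⊕ T.carrier)) ^ n) (Sum.inr x) = Sum.inr ((T.next ^ n) x) := by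
      intro n x
      induction n with
      | zero => rfl
      | succ n ih => rw [pow_succ', Equiv.Perm.mul_apply, ih, pow_succ', Equiv.Perm.mul_apply]; rfl
    rintro (x | x) (y | y)
    · simp only [Sum.map_inl, Sum.inl.injEq]
      rw [S.part_eq_iff]
      constructor
      · intro h
        obtain ⟨n, rfl⟩ := h.exists_nat_pow_eq
        exact ⟨(n : ℤ), by rw [zpow_natCast, hl]⟩
      · intro h
        obtain ⟨n, hn⟩ := h.exists_nat_pow_eq
        rw [hl] at hn
        exact ⟨(n : ℤ), by rw [zpow_natCast]; exact Sum.inl_injective hn⟩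
    · simp only [Sum.map_inl, Sum.map_inr, reduceCtorEq, false_iff]
      intro h
      obtain ⟨n, hn⟩ := h.exists_nat_pow_eq
      rw [hl] at hn
      cases hn
    · simp only [Sum.map_inl, Sum.map_inr, reduceCtorEq, false_iff]
      intro h
      obtain ⟨n, hn⟩ := h.exists_nat_pow_eq
      rw [hr] at hn
      cases hn
    · simp only [Sum.map_inr, Sum.inr.injEq]
      rw [T.part_eq_iff]
      constructor
      · intro h
        obtain ⟨n, rfl⟩ := h.exists_nat_pow_eq
        exact ⟨(n : ℤ), by rw [zpow_natCast, hr]⟩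
      · intro h
        obtain ⟨n, hn⟩ := h.exists_nat_pow_eq
        rw [hr] at hn
        exact ⟨(n : ℤ), by rw [zpow_natCast]; exact Sum.inr_injective hn⟩

/-- The cut `S \ {u, v}` at two (distinct) elements, obtained by gluing the circles at `u` and `v`:
after the elements before `u` one continues with the elements after `v`, and after the elements
before `v` one continues with the elements after `u`.  If `u` and `v` lie in different parts
`[A u]` and `[v B]`, these are replaced by the single part `[A B]`; if they lie in the same part
`[u A v B]`, it is replaced by the two parts `[A]` and `[B]`.  All other parts are left alone.
The indexing set consists of the empty parts of `S` and of the cycles of the permutation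
`GluePerm.glue S.next u v` of the underlying set of `S`; this has the same cycles as `S.next`,
apart from one or two cycles containing `u` and `v`, which are replaced by `(A v B u)` in the first
case and by `(u A)` and `(v B)` in the second case. -/
noncomputable def cut (S : MultCyc.{u}) (u v : S.carrier) : MultCyc.{u} where
  carrier := Without u v
  index := S.EmptyPart ⊕ GluePerm.Cycles (GluePerm.glue S.next u v)
  part x := Sum.inr (Quotient.mk _ x.1)
  next := GluePerm.firstReturn (GluePerm.glue S.next u v) u v
  finite_carrier := inferInstance
  finite_index := inferInstance
  nonempty_index := ⟨Sum.inr (Quotient.mk _ u)⟩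
  part_eq_iff x y := by
    rw [GluePerm.sameCycle_firstReturn, Sum.inr.injEq, GluePerm.mk_eq_iff]

open scoped Classical in
/-- The map from the arcs of `S` to the arcs of `S \ {u, v}`.  An arc beginning at an element that
survives is sent to the arc beginning at this element.  The arcs beginning at `u` and `v` are
prolonged backwards through the points where the circles have been glued, until one meets a
surviving element; if there is none, they become the circle of an empty part. -/
noncomputable def cutArc (S : MultCyc.{u}) (u v : S.carrier) : S.Arc → (S.cut u v).Arc
  | Sum.inl x =>
    if h : ∃ n : ℕ, (((GluePerm.glue S.next u v)⁻¹ ^ n) x ≠ u ∧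
        ((GluePerm.glue S.next u v)⁻¹ ^ n) x ≠ v) then
      Sum.inl ⟨((GluePerm.glue S.next u v)⁻¹ ^ Nat.find h) x, Nat.find_spec h⟩
    else
      Sum.inr ⟨Sum.inr (Quotient.mk _ x), fun y hy => h (by
        have h1 := (GluePerm.mk_eq_iff _ _ _).1 (Sum.inr_injective hy)
        obtain ⟨n, hn⟩ := (Equiv.Perm.sameCycle_inv.2 h1.symm).exists_nat_pow_eq
        exact ⟨n, by rw [hn]; exact y.2⟩)⟩
  | Sum.inr i => Sum.inr ⟨Sum.inl i, fun y hy => by cases hy⟩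

/-- The merging `(S ⊔ T) \ {u, v}` of two multicyclically ordered sets at `u ∈ S` and `v ∈ T`. -/
noncomputable def merge (S T : MultCyc.{u}) (u : S.carrier) (v : T.carrier) : MultCyc.{u} :=
  (S.disjointUnion T).cut (Sum.inl u) (Sum.inr v)

/-- The map from the arcs of `S` to the arcs of `(S ⊔ T) \ {u, v}`. -/
noncomputable def mergeArcLeft (S T : MultCyc.{u}) (u : S.carrier) (v : T.carrier) :
    S.Arc → (S.merge T u v).Arc := fun α =>
  (S.disjointUnion T).cutArc (Sum.inl u) (Sum.inr v)
    (α.map Sum.inl fun i => ⟨Sum.inl i.1, by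
      rintro (x | x) hx
      · exact i.2 x (Sum.inl_injective hx)
      · cases hx⟩)

/-- The map from the arcs of `T` to the arcs of `(S ⊔ T) \ {u, v}`. -/
noncomputable def mergeArcRight (S T : MultCyc.{u}) (u : S.carrier) (v : T.carrier) :
    T.Arc → (S.merge T u v).Arc := fun α =>
  (S.disjointUnion T).cutArc (Sum.inl u) (Sum.inr v)
    (α.map Sum.inr fun i => ⟨Sum.inr i.1, by
      rintro (x | x) hx
      · cases hx
      · exact i.2 x (Sum.inr_injective hx)⟩)

/-- The pair `(S, g)` is geometric: `(g - b + 1) / 2` is a natural number, where `b` is the number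
of parts of `S`. -/
def Geometric (S : MultCyc.{u}) (g : ℕ) : Prop := ∃ G : ℕ, g + 1 = Nat.card S.index + 2 * G

/-- Cyclically ordered sets are the multicyclically ordered sets with exactly one part. -/
def IsCyc (S : MultCyc.{u}) : Prop := Subsingleton S.index

theorem IsCyc.sameCycle {S : MultCyc.{u}} (hS : S.IsCyc) (x y : S.carrier) :
    S.next.SameCycle x y :=
  (S.part_eq_iff x y).1 (@Subsingleton.elim _ hS _ _)

theorem not_sameCycle_disjointUnion (S T : MultCyc.{u}) (x : S.carrier) (y : T.carrier) :
    ¬ (S.disjointUnion T).next.SameCycle (Sum.inl x) (Sum.inr y) := by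
  intro h
  have := ((S.disjointUnion T).part_eq_iff (Sum.inl x) (Sum.inr y)).2 h
  cases this

theorem IsCyc.merge {S T : MultCyc.{u}} (hS : S.IsCyc) (hT : T.IsCyc) (u : S.carrier)
    (v : T.carrier) : (S.merge T u v).IsCyc := by
  have huv := not_sameCycle_disjointUnion S T u v
  have he : ∀ i : (S.disjointUnion T).EmptyPart, False := by
    rintro ⟨i | i, hi⟩
    · exact hi (Sum.inl u) (congrArg Sum.inl (@Subsingleton.elim _ hS _ _))
    · exact hi (Sum.inr v) (congrArg Sum.inr (@Subsingleton.elim _ hT _ _))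
  have hu : ∀ x, (GluePerm.glue (S.disjointUnion T).next (Sum.inl u) (Sum.inr v)).SameCycle
      (Sum.inl u) x := by
    rintro (x | x)
    · exact GluePerm.sameCycle_glue_of_left huv (((S.disjointUnion T).part_eq_iff _ _).1
        (congrArg Sum.inl (@Subsingleton.elim _ hS _ _)))
    · exact (GluePerm.sameCycle_glue huv).trans (GluePerm.sameCycle_glue_of_right huv
        (((S.disjointUnion T).part_eq_iff _ _).1
          (congrArg Sum.inr (@Subsingleton.elim _ hT _ _))))
  refine ⟨?_⟩
  rintro (i | p) (j | q)
  · exact (he i).elim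
  · exact (he i).elim
  · exact (he j).elim
  · induction p using Quotient.inductionOn with | _ x => ?_
    induction q using Quotient.inductionOn with | _ y => ?_
    exact congrArg Sum.inr ((GluePerm.mk_eq_iff _ x y).2 ((hu x).symm.trans (hu y)))

theorem IsCyc.geometric_zero {S : MultCyc.{u}} (hS : S.IsCyc) : S.Geometric 0 := by
  have : Subsingleton S.index := hS
  exact ⟨0, by simp⟩

theorem card_index (S : MultCyc.{u}) :
    Nat.card S.index = Nat.card S.EmptyPart + Nat.card (GluePerm.Cycles S.next) := by
  classical
  rw [← Nat.card_sum]
  symm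
  let f : GluePerm.Cycles S.next → S.index :=
    Quotient.lift S.part fun x y hxy => (S.part_eq_iff x y).2 hxy
  have hf : ∀ x, f (Quotient.mk _ x) = S.part x := fun x => rfl
  refine Nat.card_congr (Equiv.ofBijective (Sum.elim Subtype.val f) ⟨?_, ?_⟩)
  · rintro (i | p) (j | q) h
    · exact congrArg Sum.inl (Subtype.ext h)
    · induction q using Quotient.inductionOn with | _ y => ?_
      exact (i.2 y h.symm).elim
    · induction p using Quotient.inductionOn with | _ y => ?_
      exact (j.2 y h).elim
    · induction p using Quotient.inductionOn with | _ x => ?_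
      induction q using Quotient.inductionOn with | _ y => ?_
      exact congrArg Sum.inr ((GluePerm.mk_eq_iff _ x y).2 ((S.part_eq_iff x y).1 h))
  · intro i
    by_cases hi : ∀ x, S.part x ≠ i
    · exact ⟨Sum.inl ⟨i, hi⟩, rfl⟩
    · push Not at hi
      obtain ⟨x, rfl⟩ := hi
      exact ⟨Sum.inr (Quotient.mk _ x), rfl⟩

theorem card_index_cut_of_ne (S : MultCyc.{u}) {u v : S.carrier} (h : S.part u ≠ S.part v) :
    Nat.card (S.cut u v).index + 1 = Nat.card S.index := by
  rw [card_index S, show Nat.card (S.cut u v).index = _ from Nat.card_sum, add_assoc,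
    GluePerm.card_cycles_glue_of_not (fun hs => h ((S.part_eq_iff _ _).2 hs))]

theorem card_index_cut_of_eq (S : MultCyc.{u}) {u v : S.carrier} (huv : u ≠ v)
    (h : S.part u = S.part v) : Nat.card (S.cut u v).index = Nat.card S.index + 1 := by
  rw [card_index S, show Nat.card (S.cut u v).index = _ from Nat.card_sum, add_assoc,
    GluePerm.card_cycles_glue_of_sameCycle huv ((S.part_eq_iff _ _).1 h)]

theorem Geometric.cut {S : MultCyc.{u}} {g : ℕ} (hS : S.Geometric g) {u v : S.carrier}
    (huv : u ≠ v) : (S.cut u v).Geometric (g + 1) := by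
  obtain ⟨G, hG⟩ := hS
  by_cases h : S.part u = S.part v
  · exact ⟨G, by rw [card_index_cut_of_eq S huv h]; omega⟩
  · have := card_index_cut_of_ne S h
    exact ⟨G + 1, by omega⟩

theorem Geometric.merge {S T : MultCyc.{u}} {g h k : ℕ} (hS : S.Geometric g) (hT : T.Geometric h)
    (hk : g + h = k) (u : S.carrier) (v : T.carrier) : (S.merge T u v).Geometric k := by
  obtain ⟨G, hG⟩ := hS
  obtain ⟨H, hH⟩ := hT
  have h1 : Nat.card (S.merge T u v).index + 1 = Nat.card (S.disjointUnion T).index :=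
    card_index_cut_of_ne _ (by intro h; cases h)
  have h2 : Nat.card (S.disjointUnion T).index = Nat.card S.index + Nat.card T.index :=
    Nat.card_sum
  exact ⟨G + H, by omega⟩

theorem Geometric.iso {S T : MultCyc.{u}} {g : ℕ} (hS : S.Geometric g) (ρ : Iso S T) :
    T.Geometric g := by
  obtain ⟨G, hG⟩ := hS
  exact ⟨G, by rw [hG, Nat.card_congr ρ.indexEquiv]⟩

end MultCyc

/-! ### Non-symmetric cyclic operads in sets -/

/-- Finite cyclically ordered sets. -/
abbrev CycSet : Type (u + 1) := {C : MultCyc.{u} // C.IsCyc}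

/-- The merging of cyclically ordered sets. -/
noncomputable def CycSet.merge (C D : CycSet.{u}) (a : C.1.carrier) (b : D.1.carrier) :
    CycSet.{u} :=
  ⟨C.1.merge D.1 a b, C.2.merge D.2 a b⟩

/-- A non-symmetric cyclic operad in the category of sets, with arities arbitrary finite cyclically
ordered sets (including the empty one), without units.  In each axiom, `θ` is the canonical
isomorphism between the two sets in question, i.e. the one that is compatible with the maps from
the arcs of the original sets. -/
structure NsCyclicOperad where
  obj (C : CycSet.{u}) : Type v
  map {C D : CycSet.{u}} (ρ : MultCyc.Iso C.1 D.1) : obj C → obj D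
  map_refl {C : CycSet.{u}} (x : obj C) : map (MultCyc.Iso.refl C.1) x = x
  map_trans {C D E : CycSet.{u}} (ρ : MultCyc.Iso C.1 D.1) (τ : MultCyc.Iso D.1 E.1) (x : obj C) :
    map (ρ.trans τ) x = map τ (map ρ x)
  comp {C D : CycSet.{u}} (a : C.1.carrier) (b : D.1.carrier) : obj C → obj D → obj (C.merge D a b)
  comp_symm {C D : CycSet.{u}} (a : C.1.carrier) (b : D.1.carrier) (x : obj C) (y : obj D)
    (θ : MultCyc.Iso (D.merge C b a).1 (C.merge D a b).1)
    (_ : ∀ α, θ.onArc (D.1.mergeArcRight C.1 b a α) = C.1.mergeArcLeft D.1 a b α)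
    (_ : ∀ α, θ.onArc (D.1.mergeArcLeft C.1 b a α) = C.1.mergeArcRight D.1 a b α) :
    map θ (comp b a y x) = comp a b x y
  comp_assoc {C₁ C₂ C₃ : CycSet.{u}} (a : C₁.1.carrier) (b c : C₂.1.carrier) (d : C₃.1.carrier)
    (hbc : b ≠ c) (x : obj C₁) (y : obj C₂) (z : obj C₃)
    (θ : MultCyc.Iso (C₁.merge (C₂.merge C₃ c d) a (Graft.left b hbc)).1
      ((C₁.merge C₂ a b).merge C₃ (Graft.right c hbc.symm) d).1)
    (_ : ∀ α, θ.onArc (C₁.1.mergeArcLeft (C₂.merge C₃ c d).1 a (Graft.left b hbc) α) =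
      (C₁.merge C₂ a b).1.mergeArcLeft C₃.1 (Graft.right c hbc.symm) d
        (C₁.1.mergeArcLeft C₂.1 a b α))
    (_ : ∀ α, θ.onArc (C₁.1.mergeArcRight (C₂.merge C₃ c d).1 a (Graft.left b hbc)
        (C₂.1.mergeArcLeft C₃.1 c d α)) =
      (C₁.merge C₂ a b).1.mergeArcLeft C₃.1 (Graft.right c hbc.symm) d
        (C₁.1.mergeArcRight C₂.1 a b α))
    (_ : ∀ α, θ.onArc (C₁.1.mergeArcRight (C₂.merge C₃ c d).1 a (Graft.left b hbc)
        (C₂.1.mergeArcRight C₃.1 c d α)) =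
      (C₁.merge C₂ a b).1.mergeArcRight C₃.1 (Graft.right c hbc.symm) d α) :
    map θ (comp a (Graft.left b hbc) x (comp c d y z)) =
      comp (Graft.right c hbc.symm) d (comp a b x y) z
  map_comp {C D C' D' : CycSet.{u}} (ρ : MultCyc.Iso C.1 C'.1) (τ : MultCyc.Iso D.1 D'.1)
    (a : C.1.carrier) (b : D.1.carrier) (x : obj C) (y : obj D)
    (θ : MultCyc.Iso (C.merge D a b).1 (C'.merge D' (ρ.toEquiv a) (τ.toEquiv b)).1)
    (_ : ∀ α, θ.onArc (C.1.mergeArcLeft D.1 a b α) =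
      C'.1.mergeArcLeft D'.1 (ρ.toEquiv a) (τ.toEquiv b) (ρ.onArc α))
    (_ : ∀ α, θ.onArc (C.1.mergeArcRight D.1 a b α) =
      C'.1.mergeArcRight D'.1 (ρ.toEquiv a) (τ.toEquiv b) (τ.onArc α)) :
    map θ (comp a b x y) = comp (ρ.toEquiv a) (τ.toEquiv b) (map ρ x) (map τ y)

namespace NsCyclicOperad

/-- A morphism of non-symmetric cyclic operads. -/
@[ext]
structure Hom (P Q : NsCyclicOperad.{u, v}) where
  app (C : CycSet.{u}) : P.obj C → Q.obj C
  app_map {C D : CycSet.{u}} (ρ : MultCyc.Iso C.1 D.1) (x : P.obj C) :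
    app D (P.map ρ x) = Q.map ρ (app C x)
  app_comp {C D : CycSet.{u}} (a : C.1.carrier) (b : D.1.carrier) (x : P.obj C) (y : P.obj D) :
    app _ (P.comp a b x y) = Q.comp a b (app C x) (app D y)

instance : Category NsCyclicOperad.{u, v} where
  Hom := Hom
  id P :=
    { app := fun _ x => x
      app_map := fun _ _ => rfl
      app_comp := fun _ _ _ _ => rfl }
  comp F G :=
    { app := fun C x => G.app C (F.app C x)
      app_map := fun ρ x => by rw [F.app_map, G.app_map]
      app_comp := fun a b x y => by rw [F.app_comp, G.app_comp] }

/-- The non-symmetric cyclic operad with a one-point set in each arity. -/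
def point : NsCyclicOperad.{u, v} where
  obj _ := PUnit
  map _ x := x
  map_refl _ := rfl
  map_trans _ _ _ := rfl
  comp _ _ _ _ := PUnit.unit
  comp_symm _ _ _ _ _ _ _ := rfl
  comp_assoc _ _ _ _ _ _ _ _ _ _ _ _ := rfl
  map_comp _ _ _ _ _ _ _ _ _ := rfl

/-- An internal operad in the non-symmetric cyclic operad `P`. -/
structure IsInternal (P : NsCyclicOperad.{u, v}) (ς : ∀ C : CycSet.{u}, P.obj C) : Prop where
  map {C D : CycSet.{u}} (ρ : MultCyc.Iso C.1 D.1) : P.map ρ (ς C) = ς D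
  comp {C D : CycSet.{u}} (a : C.1.carrier) (b : D.1.carrier) :
    P.comp a b (ς C) (ς D) = ς (C.merge D a b)

end NsCyclicOperad

/-! ### Non-symmetric modular operads in sets -/

/-- A (geometric) non-symmetric modular operad in the category of sets, with arities arbitrary
finite multicyclically ordered sets, graded by the genus, without units and without a stability
condition.  The genus of a composition is written as a number `k` with `g + h = k`.  In each axiom,
`θ` is the canonical isomorphism between the two multicyclically ordered sets in question, i.e. the
one that is compatible with the maps from the arcs of the original sets. -/
structure NsModularOperad where
  obj (S : MultCyc.{u}) (g : ℕ) : Type v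
  geometric {S : MultCyc.{u}} {g : ℕ} : obj S g → S.Geometric g
  map {S T : MultCyc.{u}} {g : ℕ} (ρ : MultCyc.Iso S T) : obj S g → obj T g
  map_refl {S : MultCyc.{u}} {g : ℕ} (x : obj S g) : map (MultCyc.Iso.refl S) x = x
  map_trans {S T R : MultCyc.{u}} {g : ℕ} (ρ : MultCyc.Iso S T) (τ : MultCyc.Iso T R)
    (x : obj S g) : map (ρ.trans τ) x = map τ (map ρ x)
  comp {S T : MultCyc.{u}} {g h k : ℕ} (a : S.carrier) (b : T.carrier) (_ : g + h = k) :
    obj S g → obj T h → obj (S.merge T a b) k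
  contr {S : MultCyc.{u}} {g : ℕ} (a b : S.carrier) (_ : a ≠ b) :
    obj S g → obj (S.cut a b) (g + 1)
  contr_symm {S : MultCyc.{u}} {g : ℕ} (a b : S.carrier) (hab : a ≠ b) (x : obj S g)
    (θ : MultCyc.Iso (S.cut b a) (S.cut a b))
    (_ : ∀ α, θ.onArc (S.cutArc b a α) = S.cutArc a b α) :
    map θ (contr b a hab.symm x) = contr a b hab x
  comp_symm {S T : MultCyc.{u}} {g h k : ℕ} (a : S.carrier) (b : T.carrier) (hk : g + h = k)
    (hk' : h + g = k) (x : obj S g) (y : obj T h)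
    (θ : MultCyc.Iso (T.merge S b a) (S.merge T a b))
    (_ : ∀ α, θ.onArc (T.mergeArcRight S b a α) = S.mergeArcLeft T a b α)
    (_ : ∀ α, θ.onArc (T.mergeArcLeft S b a α) = S.mergeArcRight T a b α) :
    map θ (comp b a hk' y x) = comp a b hk x y
  comp_assoc {S₁ S₂ S₃ : MultCyc.{u}} {g₁ g₂ g₃ g₁₂ g₂₃ g : ℕ}
    (h₁₂ : g₁ + g₂ = g₁₂) (h₂₃ : g₂ + g₃ = g₂₃) (hl : g₁ + g₂₃ = g) (hr : g₁₂ + g₃ = g)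
    (a : S₁.carrier) (b c : S₂.carrier) (d : S₃.carrier)
    (hbc : b ≠ c) (x : obj S₁ g₁) (y : obj S₂ g₂) (z : obj S₃ g₃)
    (θ : MultCyc.Iso (S₁.merge (S₂.merge S₃ c d) a (Graft.left b hbc))
      ((S₁.merge S₂ a b).merge S₃ (Graft.right c hbc.symm) d))
    (_ : ∀ α, θ.onArc (S₁.mergeArcLeft (S₂.merge S₃ c d) a (Graft.left b hbc) α) =
      (S₁.merge S₂ a b).mergeArcLeft S₃ (Graft.right c hbc.symm) d (S₁.mergeArcLeft S₂ a b α))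
    (_ : ∀ α, θ.onArc (S₁.mergeArcRight (S₂.merge S₃ c d) a (Graft.left b hbc)
        (S₂.mergeArcLeft S₃ c d α)) =
      (S₁.merge S₂ a b).mergeArcLeft S₃ (Graft.right c hbc.symm) d (S₁.mergeArcRight S₂ a b α))
    (_ : ∀ α, θ.onArc (S₁.mergeArcRight (S₂.merge S₃ c d) a (Graft.left b hbc)
        (S₂.mergeArcRight S₃ c d α)) =
      (S₁.merge S₂ a b).mergeArcRight S₃ (Graft.right c hbc.symm) d α) :
    map θ (comp a (Graft.left b hbc) hl x (comp c d h₂₃ y z)) =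
      comp (Graft.right c hbc.symm) d hr (comp a b h₁₂ x y) z
  contr_contr {S : MultCyc.{u}} {g : ℕ} (a b c d : S.carrier) (hab : a ≠ b) (hac : a ≠ c)
    (had : a ≠ d) (hbc : b ≠ c) (hbd : b ≠ d) (hcd : c ≠ d) (x : obj S g)
    (θ : MultCyc.Iso ((S.cut c d).cut ⟨a, hac, had⟩ ⟨b, hbc, hbd⟩)
      ((S.cut a b).cut ⟨c, hac.symm, hbc.symm⟩ ⟨d, had.symm, hbd.symm⟩))
    (_ : ∀ α, θ.onArc ((S.cut c d).cutArc ⟨a, hac, had⟩ ⟨b, hbc, hbd⟩ (S.cutArc c d α)) =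
      (S.cut a b).cutArc ⟨c, hac.symm, hbc.symm⟩ ⟨d, had.symm, hbd.symm⟩ (S.cutArc a b α)) :
    map θ (contr (⟨a, hac, had⟩ : Without c d) (⟨b, hbc, hbd⟩ : Without c d)
        (fun h => hab (congrArg Subtype.val h))
        (contr c d hcd x)) =
      contr (⟨c, hac.symm, hbc.symm⟩ : Without a b) (⟨d, had.symm, hbd.symm⟩ : Without a b)
        (fun h => hcd (congrArg Subtype.val h)) (contr a b hab x)
  contr_comp {S T : MultCyc.{u}} {g h k : ℕ} (hk : g + h = k) (a c : S.carrier) (b d : T.carrier)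
    (hac : a ≠ c) (hbd : b ≠ d) (x : obj S g) (y : obj T h)
    (θ : MultCyc.Iso ((S.merge T c d).cut (Graft.left a hac) (Graft.right b hbd))
      ((S.merge T a b).cut (Graft.left c hac.symm) (Graft.right d hbd.symm)))
    (_ : ∀ α, θ.onArc ((S.merge T c d).cutArc (Graft.left a hac) (Graft.right b hbd)
        (S.mergeArcLeft T c d α)) =
      (S.merge T a b).cutArc (Graft.left c hac.symm) (Graft.right d hbd.symm)
        (S.mergeArcLeft T a b α))
    (_ : ∀ α, θ.onArc ((S.merge T c d).cutArc (Graft.left a hac) (Graft.right b hbd)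
        (S.mergeArcRight T c d α)) =
      (S.merge T a b).cutArc (Graft.left c hac.symm) (Graft.right d hbd.symm)
        (S.mergeArcRight T a b α)) :
    map θ (contr (Graft.left a hac) (Graft.right b hbd)
        (fun h => Sum.inl_ne_inr (congrArg Subtype.val h)) (comp c d hk x y)) =
      contr (Graft.left c hac.symm) (Graft.right d hbd.symm)
        (fun h => Sum.inl_ne_inr (congrArg Subtype.val h)) (comp a b hk x y)
  comp_contr {S T : MultCyc.{u}} {g h k : ℕ} (hk : g + h = k) (hk' : g + 1 + h = k + 1)
    (a c d : S.carrier) (b : T.carrier) (hac : a ≠ c) (had : a ≠ d) (hcd : c ≠ d)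
    (x : obj S g) (y : obj T h)
    (θ : MultCyc.Iso ((S.cut c d).merge T ⟨a, hac, had⟩ b)
      ((S.merge T a b).cut (Graft.left c hac.symm) (Graft.left d had.symm)))
    (_ : ∀ α, θ.onArc ((S.cut c d).mergeArcLeft T ⟨a, hac, had⟩ b (S.cutArc c d α)) =
      (S.merge T a b).cutArc (Graft.left c hac.symm) (Graft.left d had.symm)
        (S.mergeArcLeft T a b α))
    (_ : ∀ α, θ.onArc ((S.cut c d).mergeArcRight T ⟨a, hac, had⟩ b α) =
      (S.merge T a b).cutArc (Graft.left c hac.symm) (Graft.left d had.symm)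
        (S.mergeArcRight T a b α)) :
    map θ (comp (⟨a, hac, had⟩ : Without c d) b hk' (contr c d hcd x) y) =
      contr (Graft.left c hac.symm) (Graft.left d had.symm)
        (fun h => hcd (Sum.inl_injective (congrArg Subtype.val h))) (comp a b hk x y)
  map_comp {S T S' T' : MultCyc.{u}} {g h k : ℕ} (hk : g + h = k)
    (ρ : MultCyc.Iso S S') (τ : MultCyc.Iso T T') (a : S.carrier) (b : T.carrier)
    (x : obj S g) (y : obj T h)
    (θ : MultCyc.Iso (S.merge T a b) (S'.merge T' (ρ.toEquiv a) (τ.toEquiv b)))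
    (_ : ∀ α, θ.onArc (S.mergeArcLeft T a b α) =
      S'.mergeArcLeft T' (ρ.toEquiv a) (τ.toEquiv b) (ρ.onArc α))
    (_ : ∀ α, θ.onArc (S.mergeArcRight T a b α) =
      S'.mergeArcRight T' (ρ.toEquiv a) (τ.toEquiv b) (τ.onArc α)) :
    map θ (comp a b hk x y) = comp (ρ.toEquiv a) (τ.toEquiv b) hk (map ρ x) (map τ y)
  map_contr {S S' : MultCyc.{u}} {g : ℕ} (ρ : MultCyc.Iso S S') (a b : S.carrier) (hab : a ≠ b)
    (x : obj S g) (θ : MultCyc.Iso (S.cut a b) (S'.cut (ρ.toEquiv a) (ρ.toEquiv b)))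
    (_ : ∀ α, θ.onArc (S.cutArc a b α) = S'.cutArc (ρ.toEquiv a) (ρ.toEquiv b) (ρ.onArc α)) :
    map θ (contr a b hab x) =
      contr (ρ.toEquiv a) (ρ.toEquiv b) (ρ.toEquiv.injective.ne hab) (map ρ x)

namespace NsModularOperad

/-- A morphism of non-symmetric modular operads. -/
@[ext]
structure Hom (P Q : NsModularOperad.{u, v}) where
  app (S : MultCyc.{u}) (g : ℕ) : P.obj S g → Q.obj S g
  app_map {S T : MultCyc.{u}} {g : ℕ} (ρ : MultCyc.Iso S T) (x : P.obj S g) :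
    app T g (P.map ρ x) = Q.map ρ (app S g x)
  app_comp {S T : MultCyc.{u}} {g h k : ℕ} (a : S.carrier) (b : T.carrier) (hk : g + h = k)
    (x : P.obj S g) (y : P.obj T h) :
    app _ k (P.comp a b hk x y) = Q.comp a b hk (app S g x) (app T h y)
  app_contr {S : MultCyc.{u}} {g : ℕ} (a b : S.carrier) (hab : a ≠ b) (x : P.obj S g) :
    app _ _ (P.contr a b hab x) = Q.contr a b hab (app S g x)

instance : Category NsModularOperad.{u, v} where
  Hom := Hom
  id P :=
    { app := fun _ _ x => x
      app_map := fun _ _ => rfl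
      app_comp := fun _ _ _ _ _ => rfl
      app_contr := fun _ _ _ _ => rfl }
  comp F G :=
    { app := fun S g x => G.app S g (F.app S g x)
      app_map := fun ρ x => by rw [F.app_map, G.app_map]
      app_comp := fun a b hk x y => by rw [F.app_comp, G.app_comp]
      app_contr := fun a b hab x => by rw [F.app_contr, G.app_contr] }

/-- The non-symmetric modular operad whose component at `(S, g)` is a one-point set if `(S, g)` is
geometric, and empty otherwise. -/
def point : NsModularOperad.{u, v} where
  obj S g := {_x : PUnit.{v + 1} // S.Geometric g}
  geometric x := x.2
  map ρ x := ⟨x.1, x.2.iso ρ⟩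
  map_refl _ := rfl
  map_trans _ _ _ := rfl
  comp a b hk x y := ⟨PUnit.unit, x.2.merge y.2 hk a b⟩
  contr _ _ hab x := ⟨PUnit.unit, x.2.cut hab⟩
  contr_symm _ _ _ _ _ _ := rfl
  comp_symm _ _ _ _ _ _ _ _ _ := rfl
  comp_assoc _ _ _ _ _ _ _ _ _ _ _ _ _ _ _ _ := rfl
  contr_contr _ _ _ _ _ _ _ _ _ _ _ _ _ := rfl
  contr_comp _ _ _ _ _ _ _ _ _ _ _ _ := rfl
  comp_contr _ _ _ _ _ _ _ _ _ _ _ _ _ _ := rfl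
  map_comp _ _ _ _ _ _ _ _ _ _ := rfl
  map_contr _ _ _ _ _ _ _ := rfl

/-- The components of a non-symmetric modular operad of genus zero at cyclically ordered sets, a
non-symmetric cyclic operad. -/
def genusZero (P : NsModularOperad.{u, v}) : NsCyclicOperad.{u, v} where
  obj C := P.obj C.1 0
  map ρ := P.map ρ
  map_refl := P.map_refl
  map_trans := P.map_trans
  comp a b := P.comp a b (zero_add 0)
  comp_symm a b := P.comp_symm a b _ _
  comp_assoc := P.comp_assoc _ _ _ _
  map_comp := P.map_comp _

/-- The forgetful functor from non-symmetric modular operads to non-symmetric cyclic operads. -/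
def forget : NsModularOperad.{u, v} ⥤ NsCyclicOperad.{u, v} where
  obj := genusZero
  map F :=
    { app := fun C => F.app C.1 0
      app_map := F.app_map
      app_comp := fun a b => F.app_comp a b _ }

/-- An internal operad in the (geometric) non-symmetric modular operad `P`, consisting of elements
of the components at all geometric pairs. -/
structure IsInternal (P : NsModularOperad.{u, v})
    (ϖ : ∀ (S : MultCyc.{u}) (g : ℕ), S.Geometric g → P.obj S g) : Prop where
  map {S T : MultCyc.{u}} {g : ℕ} (ρ : MultCyc.Iso S T) (hS : S.Geometric g)
    (hT : T.Geometric g) : P.map ρ (ϖ S g hS) = ϖ T g hT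
  comp {S T : MultCyc.{u}} {g h k : ℕ} (a : S.carrier) (b : T.carrier) (hk : g + h = k)
    (hS : S.Geometric g) (hT : T.Geometric h) (hST : (S.merge T a b).Geometric k) :
    P.comp a b hk (ϖ S g hS) (ϖ T h hT) = ϖ (S.merge T a b) k hST
  contr {S : MultCyc.{u}} {g : ℕ} (a b : S.carrier) (hab : a ≠ b) (hS : S.Geometric g)
    (hS' : (S.cut a b).Geometric (g + 1)) :
    P.contr a b hab (ϖ S g hS) = ϖ (S.cut a b) (g + 1) hS'

end NsModularOperad

/-! ### Envelopes -/

/-- `E` is the value at `X` of the left adjoint of `U`: there is a universal morphism from `X` to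
`U`, with target `U.obj E`. -/
def IsEnvelope {D : Type*} [Category D] {C : Type*} [Category C] (U : D ⥤ C) (X : C) (E : D) :
    Prop :=
  ∃ η : X ⟶ U.obj E, ∀ (P : D) (f : X ⟶ U.obj P), ∃! F : E ⟶ P, η ≫ U.map F = f

/-! A morphism from a one-point operad is the same as a family preserved by the structure, so both
envelope statements amount to the unique extension of such a family from genus zero. Uniqueness is
easy, because every component of positive genus is the target of a contraction from the previous
genus. The content is that different chains of contractions give the same element.

In the symmetric case this is immediate. Any bijection between two complements extends to the whole
sets, matching the removed pairs (`exists_equiv_extending`), so by equivariance a contraction of the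
family depends only on the resulting arity (`ModularOperad.map_contr_eq_map_contr`). Compositions
are handled by induction on the two genera, pulling contractions out of a composition.

In the non-symmetric case a geometric pair with `g + 1 = b + 2G` behaves like a surface with `b`
boundary circles and `G` handles, and a contraction glues two boundary points. The bookkeeping is
done with arcs: the arcs of a cut at `u`, `v` are the arcs of `S` modulo two relations, identifying
the arc leaving `u` with the arc arriving at `v`, and conversely (`MultCyc.cutArc_surjective`,
`MultCyc.cutArc_lift`). Since isomorphisms are determined by their action on arcs, and can be built
from it (`MultCyc.exists_iso_of_arc`), all canonical isomorphisms result from comparing relations.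
Conversely, a cut is undone by inserting a point into each of two given arcs
(`MultCyc.exists_uncut`). For two distinct arcs the set so obtained, with its two points, is unique
up to isomorphism; on a single arc it is unique once it is known which point is alone in its part
(`MultCyc.exists_iso_of_cut_iso`).

It remains to show that elements reached from the family by contractions are determined by arity and
genus (`NsModularOperad.Reach.unique`), by induction on the genus. Two final contractions at the
same pair of distinct arcs agree by induction. Otherwise the pairs of arcs are moved to a common
one: the element before the last contraction is, by induction, also a contraction at other arcs, and
contractions commute (`Reach.reachAt_of_succ`). In the lowest case it is instead a composition of
two cyclic pieces, and contraction is exchanged with composition (`Reach.reachAt_of_zero`). A common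
pair exists by a count: with a handle, one arc of each pair serves, except when all four arcs
coincide, which is settled directly; without a handle and with at least three parts, one can choose
two parts that form neither of the given pairs; with two parts the arcs can be moved freely within
them. -/

/-! ### Bijections between complements and grafts -/

/-- The restriction of a bijection to complements of two elements. -/
def withoutCongr {S T : Type*} (ρ : S ≃ T) (a b : S) : Without a b ≃ Without (ρ a) (ρ b) :=
  ρ.subtypeEquiv fun x => by simp

/-- The bijection of grafts induced by bijections of the two sets. -/
def graftCongr {S T S' T' : Type*} (ρ : S ≃ S') (τ : T ≃ T') (a : S) (b : T) :
    Graft a b ≃ Graft (ρ a) (τ b) :=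
  withoutCongr (Equiv.sumCongr ρ τ) (Sum.inl a) (Sum.inr b)

theorem graftCongr_val {S T S' T' : Type*} (ρ : S ≃ S') (τ : T ≃ T') (a : S) (b : T)
    (x : Graft a b) : (graftCongr ρ τ a b x).1 = Sum.map ρ τ x.1 := by
  rcases x with ⟨x | x, h⟩ <;> rfl

/-- Interchanging the two sets that are grafted. -/
def graftSwap {S T : Type*} (a : S) (b : T) : Graft b a ≃ Graft a b :=
  (Equiv.sumComm T S).subtypeEquiv fun x => by
    rcases x with x | x <;> simp [and_comm]

theorem graftSwap_val {S T : Type*} (a : S) (b : T) (x : Graft b a) :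
    (graftSwap a b x).1 = x.1.swap := rfl

/-- Removal of `c` and `d` before the grafting at `a`, or after it. -/
def graftWithout {S T : Type*} (a c d : S) (b : T) (hac : a ≠ c) (had : a ≠ d) :
    Graft (⟨a, hac, had⟩ : Without c d) b ≃
      Without (Graft.left c hac.symm : Graft a b) (Graft.left d had.symm) where
  toFun z := ⟨⟨Sum.map Subtype.val id z.1, by
      rcases z with ⟨⟨x, hx⟩ | y, hz⟩
      · simpa [Subtype.ext_iff] using hz
      · simpa using hz⟩, by
      rcases z with ⟨⟨x, hx⟩ | y, hz⟩
      · simpa [Graft.left, Subtype.ext_iff] using hx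
      · simp [Graft.left, Subtype.ext_iff]⟩
  invFun z := match z with
    | ⟨⟨Sum.inl x, h⟩, h'⟩ => ⟨Sum.inl ⟨x, by
        simpa [Graft.left, Subtype.ext_iff] using h'⟩, by
        simpa [Subtype.ext_iff] using h⟩
    | ⟨⟨Sum.inr y, h⟩, _⟩ => ⟨Sum.inr y, by simpa using h⟩
  left_inv z := by rcases z with ⟨⟨x, hx⟩ | y, hz⟩ <;> rfl
  right_inv z := by rcases z with ⟨⟨x | y, h⟩, h'⟩ <;> rfl

theorem graftWithout_val {S T : Type*} (a c d : S) (b : T) (hac : a ≠ c) (had : a ≠ d)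
    (z : Graft (⟨a, hac, had⟩ : Without c d) b) :
    (graftWithout a c d b hac had z).1.1 = Sum.map Subtype.val id z.1 := rfl

/-- Removal of two elements that have been added to a set. -/
def withoutOption (S : Type*) : Without (none : Option (Option S)) (some none) ≃ S where
  toFun x := match x with
    | ⟨none, h⟩ => (h.1 rfl).elim
    | ⟨some none, h⟩ => (h.2 rfl).elim
    | ⟨some (some x), _⟩ => x
  invFun x := ⟨some (some x), by simp, by simp⟩
  left_inv := by
    rintro ⟨_ | _ | x, h⟩
    · exact (h.1 rfl).elim
    · exact (h.2 rfl).elim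
    · rfl
  right_inv x := rfl

/-- A bijection between complements of two elements extends to the whole sets. -/
theorem exists_equiv_extending {S T : Type*} {a b : S} {a' b' : T} (hab : a ≠ b) (hab' : a' ≠ b')
    (e : Without a b ≃ Without a' b') :
    ∃ ρ : S ≃ T, ρ a = a' ∧ ρ b = b' ∧ ∀ x : Without a b, ρ x.1 = (e x).1 := by
  classical
  let f : S → T := fun x =>
    if hx : x ≠ a ∧ x ≠ b then (e ⟨x, hx⟩).1 else if x = a then a' else b'
  have fa : f a = a' := by simp [f]
  have fb : f b = b' := by simp [f, hab.symm]
  have fx : ∀ x : Without a b, f x.1 = (e x).1 := fun x => by simp only [f, dif_pos x.2]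
  have cases : ∀ x, x = a ∨ x = b ∨ ∃ z : Without a b, x = z.1 := fun x => by
    by_cases h1 : x = a
    · exact Or.inl h1
    by_cases h2 : x = b
    · exact Or.inr (Or.inl h2)
    exact Or.inr (Or.inr ⟨⟨x, h1, h2⟩, rfl⟩)
  have hf : Function.Bijective f := by
    constructor
    · intro x y h
      rcases cases x with hx | hx | ⟨x, hx⟩ <;> rcases cases y with hy | hy | ⟨y, hy⟩ <;>
        simp only [hx, hy, fa, fb, fx] at h ⊢
      · exact absurd h hab'
      · exact absurd h.symm (e y).2.1
      · exact absurd h.symm hab'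
      · exact absurd h.symm (e y).2.2
      · exact absurd h (e x).2.1
      · exact absurd h (e x).2.2
      · rw [e.injective (Subtype.ext h)]
    · intro y
      by_cases h1 : y = a'
      · exact ⟨a, fa.trans h1.symm⟩
      by_cases h2 : y = b'
      · exact ⟨b, fb.trans h2.symm⟩
      exact ⟨(e.symm ⟨y, h1, h2⟩).1, by rw [fx]; simp⟩
  exact ⟨Equiv.ofBijective f hf, fa, fb, fx⟩

/-! ### Envelopes and left adjoints -/

/-- Every left adjoint takes `X` to an object isomorphic to an envelope of `X`. -/
theorem IsEnvelope.nonempty_iso {D : Type*} [Category D] {C : Type*} [Category C] {U : D ⥤ C}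
    {X : C} {E : D} (hE : IsEnvelope U X E) (F : C ⥤ D) (adj : F ⊣ U) :
    Nonempty (F.obj X ≅ E) := by
  obtain ⟨η, hη⟩ := hE
  obtain ⟨f, hf, -⟩ := hη (F.obj X) (adj.unit.app X)
  let g : F.obj X ⟶ E := (adj.homEquiv X E).symm η
  have hg : adj.unit.app X ≫ U.map g = η := by
    rw [← adj.homEquiv_unit X E g, Equiv.apply_symm_apply]
  refine ⟨⟨g, f, ?_, ?_⟩⟩
  · apply (adj.homEquiv X _).injective
    rw [adj.homEquiv_unit, adj.homEquiv_unit, U.map_comp, ← Category.assoc, hg, hf]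
    simp
  · refine (hη E η).unique ?_ ?_
    · simp only [Functor.map_comp]
      rw [← Category.assoc, hf, hg]
    · simp

/-! ### The symmetric case -/

namespace ModularOperad

variable (P : ModularOperad.{u, v})

/-- The extension of a family of elements of genus zero to all genera by contractions. -/
def extend (ς : ∀ (S : Type u) [Finite S], P.obj S 0) : ∀ (g : ℕ) (S : Type u) [Finite S], P.obj S g
  | 0, S, _ => ς S
  | g + 1, S, _ => P.map (withoutOption S)
      (P.contr none (some none) (by simp) (extend ς g (Option (Option S))))

/-- The identification of the two complements through `R` extends to a bijection of `S` and `S'`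
matching the removed pairs. Equivariance of the contraction, and of the family in genus `g`, does
the rest. -/
theorem map_contr_eq_map_contr {ς : ∀ (S : Type u) [Finite S], P.obj S 0} {g : ℕ}
    (hg : ∀ {S T : Type u} [Finite S] [Finite T] (ρ : S ≃ T),
      P.map ρ (P.extend ς g S) = P.extend ς g T)
    {S S' R : Type u} [Finite S] [Finite S'] [Finite R] {a b : S} {a' b' : S'} (hab : a ≠ b)
    (hab' : a' ≠ b') (e : Without a b ≃ R) (e' : Without a' b' ≃ R) :
    P.map e (P.contr a b hab (P.extend ς g S)) = P.map e' (P.contr a' b' hab' (P.extend ς g S')) := by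
  obtain ⟨ρ, rfl, rfl, hρ⟩ := exists_equiv_extending hab hab' (e.trans e'.symm)
  rw [← hg ρ, ← P.map_contr ρ a b hab _ (e.trans e'.symm) fun z => (hρ z).symm, ← P.map_trans]
  congr 1
  ext x
  simp

theorem extend_map {ς : ∀ (S : Type u) [Finite S], P.obj S 0}
    (hς : (forget.obj P).IsInternal ς) (g : ℕ) {S T : Type u} [Finite S] [Finite T] (ρ : S ≃ T) :
    P.map ρ (P.extend ς g S) = P.extend ς g T := by
  induction g generalizing S T with
  | zero => exact hς.map ρ
  | succ g ih =>
    rw [extend, extend, ← P.map_trans]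
    exact P.map_contr_eq_map_contr ih _ _ _ _

theorem extend_contr {ς : ∀ (S : Type u) [Finite S], P.obj S 0}
    (hς : (forget.obj P).IsInternal ς) (g : ℕ) {S : Type u} [Finite S] {a b : S} (hab : a ≠ b) :
    P.contr a b hab (P.extend ς g S) = P.extend ς (g + 1) (Without a b) := by
  rw [extend, ← P.map_refl (P.contr a b hab _)]
  exact P.map_contr_eq_map_contr (P.extend_map hς g) _ _ _ _

/-- Induction on the genus of the first factor, whose contraction is pulled out of the composition
by `comp_contr`. The second genus is arbitrary, so that the lemma can be used once for each factor.
-/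
theorem extend_comp_of_zero {ς : ∀ (S : Type u) [Finite S], P.obj S 0}
    (hς : (forget.obj P).IsInternal ς) {h : ℕ}
    (h0 : ∀ {S T : Type u} [Finite S] [Finite T] {k : ℕ} (a : S) (b : T) (hk : 0 + h = k),
      P.comp a b hk (P.extend ς 0 S) (P.extend ς h T) = P.extend ς k (Graft a b))
    {g k : ℕ} {S T : Type u} [Finite S] [Finite T] (a : S) (b : T) (hk : g + h = k) :
    P.comp a b hk (P.extend ς g S) (P.extend ς h T) = P.extend ς k (Graft a b) := by
  induction g generalizing S T k with
  | zero => exact h0 a b hk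
  | succ g ih =>
    -- On a complement of two points the extended element is literally a contraction. A general
    -- arity is identified with such a complement by `withoutOption`.
    have key : ∀ {S' : Type u} [Finite S'] (c d : S') (hcd : c ≠ d) (a : Without c d),
        P.comp a b hk (P.extend ς (g + 1) (Without c d)) (P.extend ς h T) =
          P.extend ς k (Graft a b) := by
      intro S' _ c d hcd a
      obtain ⟨a, hac, had⟩ := a
      obtain rfl : k = (g + h) + 1 := by omega
      rw [← P.extend_contr hς g hcd,
        ← P.extend_map hς _ (graftWithout a c d b hac had).symm, ← P.extend_contr hς (g + h)
          (show Graft.left (a := a) (b := b) c hac.symm ≠ Graft.left d had.symm by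
            simpa [Graft.left] using hcd), ← ih a b rfl,
        ← P.comp_contr rfl hk a c d b hac had hcd _ _ (graftWithout a c d b hac had)
          (graftWithout_val a c d b hac had), ← P.map_trans, Equiv.self_trans_symm, P.map_refl]
    let e := withoutOption S
    obtain ⟨a, rfl⟩ := e.surjective a
    have h1 := P.map_comp hk e (Equiv.refl T) a b (P.extend ς (g + 1) _) (P.extend ς h T)
      (graftCongr e (Equiv.refl T) a b) (graftCongr_val _ _ _ _)
    rw [key _ _ (by simp) a, P.extend_map hς, P.extend_map hς, P.map_refl] at h1
    exact h1.symm

/-- The previous lemma lowers the first genus to zero; after exchanging the factors by `comp_symm`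
it lowers the other one, leaving the hypothesis on `ς`. -/
theorem extend_comp {ς : ∀ (S : Type u) [Finite S], P.obj S 0}
    (hς : (forget.obj P).IsInternal ς) {g h k : ℕ} {S T : Type u} [Finite S] [Finite T]
    (a : S) (b : T) (hk : g + h = k) :
    P.comp a b hk (P.extend ς g S) (P.extend ς h T) = P.extend ς k (Graft a b) := by
  refine P.extend_comp_of_zero hς (fun a b hk => ?_) a b hk
  have hk' := (add_comm _ _).trans hk
  rw [← P.comp_symm a b hk hk' _ _ (graftSwap a b) (graftSwap_val a b),
    P.extend_comp_of_zero hς (fun a b hk => ?_) b a hk', P.extend_map hς]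
  obtain rfl := hk
  exact hς.comp a b

theorem extend_isInternal {ς : ∀ (S : Type u) [Finite S], P.obj S 0}
    (hς : (forget.obj P).IsInternal ς) : P.IsInternal fun S _ g => P.extend ς g S where
  map := P.extend_map hς _
  comp := P.extend_comp hς
  contr _ _ := P.extend_contr hς _

/-- Uniqueness: every finite set is, up to bijection, a complement of two points in a larger one, so
compatibility with contractions forces the value in genus `g + 1`. -/
theorem IsInternal.eq_extend {P : ModularOperad.{u, v}}
    {ϖ : ∀ (S : Type u) [Finite S] (g : ℕ), P.obj S g} (h : P.IsInternal ϖ)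
    (S : Type u) [Finite S] (g : ℕ) : ϖ S g = P.extend (fun S _ => ϖ S 0) g S := by
  induction g generalizing S with
  | zero => rfl
  | succ g ih => rw [extend, ← ih, h.contr, h.map]

theorem existsUnique_isInternal (ς : ∀ (S : Type u) [Finite S], P.obj S 0)
    (hς : (forget.obj P).IsInternal ς) :
    ∃! ϖ : ∀ (S : Type u) [Finite S] (g : ℕ), P.obj S g,
      P.IsInternal ϖ ∧ ∀ (S : Type u) [Finite S], ϖ S 0 = ς S := by
  refine ⟨fun S _ g => P.extend ς g S, ⟨P.extend_isInternal hς, fun _ _ => rfl⟩, ?_⟩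
  rintro ϖ ⟨hϖ, h0⟩
  funext S _ g
  rw [hϖ.eq_extend S g]
  congr 1
  funext S _
  exact h0 S

/-- The morphisms from the point are the internal operads. -/
theorem isEnvelope_point : IsEnvelope forget.{u, v} CyclicOperad.point point := by
  refine ⟨CyclicOperad.Hom.mk (fun _ _ x => x) (fun _ _ => rfl) (fun _ _ _ _ => rfl),
    fun P f => ?_⟩
  let f' : CyclicOperad.Hom CyclicOperad.point P.genusZero := f
  obtain ⟨ϖ, ⟨hϖ, h0⟩, huniq⟩ := P.existsUnique_isInternal (fun S _ => f'.app S PUnit.unit)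
    ⟨fun ρ => (f'.app_map ρ PUnit.unit).symm,
      fun a b => (f'.app_comp a b PUnit.unit PUnit.unit).symm⟩
  refine ⟨Hom.mk (fun S _ g _ => ϖ S g) (fun ρ _ => (hϖ.map ρ).symm)
    (fun a b hk _ _ => (hϖ.comp a b hk).symm) (fun a b hab _ => (hϖ.contr a b hab).symm), ?_, ?_⟩
  · refine CyclicOperad.Hom.ext ?_
    funext S _ x
    exact h0 S
  · intro F hF
    let F' : Hom point P := F
    have := huniq (fun S _ g => F'.app S g PUnit.unit)
      ⟨⟨fun ρ => (F'.app_map ρ PUnit.unit).symm,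
        fun a b hk => (F'.app_comp a b hk PUnit.unit PUnit.unit).symm,
        fun a b hab => (F'.app_contr a b hab PUnit.unit).symm⟩, fun S _ => by
          subst hF; rfl⟩
    refine Hom.ext ?_
    funext S _ g x
    exact congrFun (congrFun (congrFun this S) _) g

end ModularOperad

/-! ### Predecessors under a glued permutation, and first returns -/

namespace GluePerm

variable {α : Type*}

theorem glue_apply (σ : Equiv.Perm α) (u v x : α) :
    σ x = u ∧ glue σ u v x = v ∨ σ x = v ∧ glue σ u v x = u ∨
      (σ x ≠ u ∧ σ x ≠ v ∧ glue σ u v x = σ x) := by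
  by_cases hu : σ x = u
  · exact Or.inl ⟨hu, glue_apply_left σ hu⟩
  by_cases hv : σ x = v
  · exact Or.inr (Or.inl ⟨hv, glue_apply_right σ hv⟩)
  exact Or.inr (Or.inr ⟨hu, hv, glue_apply_of_ne σ hu hv⟩)

theorem glue_inv_left (σ : Equiv.Perm α) (u v : α) : (glue σ u v)⁻¹ u = σ⁻¹ v := by
  classical
  rw [Equiv.Perm.inv_eq_iff_eq, glue_apply_right σ (by simp)]

theorem glue_inv_right (σ : Equiv.Perm α) (u v : α) : (glue σ u v)⁻¹ v = σ⁻¹ u := by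
  rw [Equiv.Perm.inv_eq_iff_eq, glue_apply_left σ (by simp)]

theorem glue_inv_of_ne (σ : Equiv.Perm α) {u v x : α} (hu : x ≠ u) (hv : x ≠ v) :
    (glue σ u v)⁻¹ x = σ⁻¹ x := by
  rw [Equiv.Perm.inv_eq_iff_eq, glue_apply_of_ne σ (by simpa) (by simpa)]
  simp

/-- The first return to the complement of `{u, v}`, in terms of `φ`. -/
theorem firstReturn_apply (φ : Equiv.Perm α) (u v : α) (x : {x : α // x ≠ u ∧ x ≠ v}) :
    (φ x.1 ≠ u ∧ φ x.1 ≠ v ∧ (firstReturn φ u v x).1 = φ x.1) ∨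
    (φ x.1 = u ∧ φ u ≠ u ∧ φ u ≠ v ∧ (firstReturn φ u v x).1 = φ u) ∨
    (φ x.1 = v ∧ φ v ≠ u ∧ φ v ≠ v ∧ (firstReturn φ u v x).1 = φ v) ∨
    (φ x.1 = u ∧ φ u = v ∧ φ v ≠ u ∧ φ v ≠ v ∧ (firstReturn φ u v x).1 = φ v) ∨
    (φ x.1 = v ∧ φ v = u ∧ φ u ≠ u ∧ φ u ≠ v ∧ (firstReturn φ u v x).1 = φ u) := by
  obtain ⟨x, hxu, hxv⟩ := x
  have hval : (firstReturn φ u v ⟨x, hxu, hxv⟩).1 = skip (skip φ u) v x := rfl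
  rw [hval]
  simp only
  have inj := φ.injective
  by_cases h1 : φ x = u
  · have hs : skip φ u x = φ u := skip_of_eq φ h1
    have huu : φ u ≠ u := fun h => hxu (inj (h1.trans h.symm))
    by_cases h2 : φ u = v
    · have huv : u ≠ v := fun h => huu (by rw [h2, h])
      have hvv : φ v ≠ v := fun h => huv (inj (h2.trans h.symm))
      have hvu : φ v ≠ u := fun h => hxv (inj (h1.trans h.symm))
      rw [skip_of_eq _ (hs.trans h2), skip_of_ne φ hvu huv.symm]
      exact Or.inr (Or.inr (Or.inr (Or.inl ⟨h1, h2, hvu, hvv, rfl⟩)))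
    · rw [skip_of_ne _ (by rw [hs]; exact h2) hxv, hs]
      exact Or.inr (Or.inl ⟨h1, huu, h2, rfl⟩)
  · have hs : skip φ u x = φ x := skip_of_ne φ h1 hxu
    by_cases h2 : φ x = v
    · have hvv : φ v ≠ v := fun h => hxv (inj (h2.trans h.symm))
      have huv : u ≠ v := fun h => h1 (by rw [h2, h])
      by_cases h3 : φ v = u
      · have huu : φ u ≠ u := fun h => huv (inj (h.trans h3.symm))
        have huv' : φ u ≠ v := fun h => hxu (inj (h2.trans h.symm))
        rw [skip_of_eq _ (hs.trans h2), skip_of_eq _ h3]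
        exact Or.inr (Or.inr (Or.inr (Or.inr ⟨h2, h3, huu, huv', rfl⟩)))
      · rw [skip_of_eq _ (hs.trans h2), skip_of_ne φ h3 huv.symm]
        exact Or.inr (Or.inr (Or.inl ⟨h2, h3, hvv, rfl⟩))
    · rw [skip_of_ne _ (by rw [hs]; exact h2) hxv, hs]
      exact Or.inl ⟨h1, h2, rfl⟩

end GluePerm

/-- Two surjections with the same kernel differ by a bijection. -/
theorem exists_equiv_of_kernel {A B C : Type*} {f : A → B} {g : A → C}
    (hf : Function.Surjective f) (hg : Function.Surjective g)
    (h : ∀ a b, f a = f b ↔ g a = g b) : ∃ e : B ≃ C, ∀ a, e (f a) = g a := by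
  let F : B → C := fun b => g (hf b).choose
  have hF : ∀ a, F (f a) = g a := fun a => (h _ _).1 (hf (f a)).choose_spec
  refine ⟨Equiv.ofBijective F ⟨fun b c hbc => ?_, fun c => ?_⟩, hF⟩
  · obtain ⟨a, rfl⟩ := hf b
    obtain ⟨a', rfl⟩ := hf c
    rw [hF, hF] at hbc
    exact (h _ _).2 hbc
  · obtain ⟨a, rfl⟩ := hg c
    exact ⟨f a, hF a⟩

namespace MultCyc

variable {S T : MultCyc.{u}}

/-! ### Arcs -/

/-- The arc that ends at `x`. -/
def endArc (S : MultCyc.{u}) (x : S.carrier) : S.Arc := Sum.inl (S.next⁻¹ x)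

/-- The part to which an arc belongs. -/
def arcPart (S : MultCyc.{u}) : S.Arc → S.index := Sum.elim S.part Subtype.val

theorem arcPart_inl (x : S.carrier) : S.arcPart (Sum.inl x) = S.part x := rfl

theorem arcPart_inr (i : S.EmptyPart) : S.arcPart (Sum.inr i) = i.1 := rfl

theorem part_next (x : S.carrier) : S.part (S.next x) = S.part x :=
  (S.part_eq_iff _ _).2 (by simp [Equiv.Perm.SameCycle.refl])

theorem arcPart_endArc (x : S.carrier) : S.arcPart (S.endArc x) = S.part x := by
  rw [endArc, arcPart_inl, ← S.part_next]; simp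

theorem arcPart_surjective (S : MultCyc.{u}) : Function.Surjective S.arcPart := by
  intro i
  by_cases h : ∀ x, S.part x ≠ i
  · exact ⟨Sum.inr ⟨i, h⟩, rfl⟩
  · push Not at h
    obtain ⟨x, hx⟩ := h
    exact ⟨Sum.inl x, hx⟩

theorem Iso.onArc_inl (ρ : Iso S T) (x : S.carrier) :
    ρ.onArc (Sum.inl x) = Sum.inl (ρ.toEquiv x) := rfl

theorem Iso.arcPart_onArc (ρ : Iso S T) (α : S.Arc) :
    T.arcPart (ρ.onArc α) = ρ.indexEquiv (S.arcPart α) := by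
  rcases α with x | i
  · exact ρ.part_apply x
  · rfl

theorem Iso.onArc_endArc (ρ : Iso S T) (x : S.carrier) :
    ρ.onArc (S.endArc x) = T.endArc (ρ.toEquiv x) := by
  rw [endArc, endArc, ρ.onArc_inl]
  congr 1
  rw [Equiv.Perm.eq_inv_iff_eq, ρ.next_apply]
  simp

theorem Iso.onArc_refl (α : S.Arc) : (Iso.refl S).onArc α = α := by
  rcases α with x | i <;> rfl

theorem Iso.onArc_trans {R : MultCyc.{u}} (ρ : Iso S T) (τ : Iso T R) (α : S.Arc) :
    (ρ.trans τ).onArc α = τ.onArc (ρ.onArc α) := by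
  rcases α with x | i <;> rfl

/-- The inverse isomorphism. -/
def Iso.symm (ρ : Iso S T) : Iso T S where
  toEquiv := ρ.toEquiv.symm
  indexEquiv := ρ.indexEquiv.symm
  part_apply x := by rw [Equiv.eq_symm_apply, ← ρ.part_apply, Equiv.apply_symm_apply]
  next_apply x := by rw [Equiv.eq_symm_apply, ← ρ.next_apply, Equiv.apply_symm_apply]

theorem Iso.symm_onArc_onArc (ρ : Iso S T) (α : S.Arc) : ρ.symm.onArc (ρ.onArc α) = α := by
  rcases α with x | i
  · exact congrArg Sum.inl (ρ.toEquiv.symm_apply_apply x)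
  · exact congrArg Sum.inr (Subtype.ext (ρ.indexEquiv.symm_apply_apply i.1))

theorem Iso.onArc_symm_onArc (ρ : Iso S T) (α : T.Arc) : ρ.onArc (ρ.symm.onArc α) = α := by
  rcases α with x | i
  · exact congrArg Sum.inl (ρ.toEquiv.apply_symm_apply x)
  · exact congrArg Sum.inr (Subtype.ext (ρ.indexEquiv.apply_symm_apply i.1))

theorem Iso.onArc_injective (ρ : Iso S T) : Function.Injective ρ.onArc :=
  Function.LeftInverse.injective ρ.symm_onArc_onArc

theorem Iso.onArc_surjective (ρ : Iso S T) : Function.Surjective ρ.onArc :=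
  Function.RightInverse.surjective ρ.onArc_symm_onArc

/-- The arcs beginning at elements determine the bijection of the underlying sets. They also
determine the bijection of indices, because an empty part contributes its whole circle, so that
every part contains an arc. -/
theorem Iso.ext_onArc {ρ τ : Iso S T} (h : ∀ α, ρ.onArc α = τ.onArc α) : ρ = τ := by
  refine Iso.ext ?_ ?_
  · ext x
    exact Sum.inl_injective (h (Sum.inl x))
  · ext i
    obtain ⟨α, rfl⟩ := S.arcPart_surjective i
    rw [← Iso.arcPart_onArc, ← Iso.arcPart_onArc, h]

/-- Two surjective parametrizations of the arcs of `S` and of `T` that factor through each other and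
that are compatible with the beginnings and ends of arcs come from an isomorphism. -/
theorem exists_iso_of_arc {A : Type*} {p : A → S.Arc} {q : A → T.Arc}
    (e : S.carrier ≃ T.carrier) (hp : Function.Surjective p) (hq : Function.Surjective q)
    (hf : ∃ f : S.Arc → T.Arc, ∀ a, f (p a) = q a) (hg : ∃ g : T.Arc → S.Arc, ∀ a, g (q a) = p a)
    (hs : ∀ x, ∃ a, p a = Sum.inl x ∧ q a = Sum.inl (e x))
    (he : ∀ x, ∃ a, p a = S.endArc x ∧ q a = T.endArc (e x)) :
    ∃ θ : Iso S T, θ.toEquiv = e ∧ ∀ a, θ.onArc (p a) = q a := by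
  -- Since `p` and `q` factor through each other they have the same kernel: both sets of arcs are
  -- the same quotient of `A`.
  have hk : ∀ a b, p a = p b ↔ q a = q b := by
    obtain ⟨f, hf⟩ := hf
    obtain ⟨g, hg⟩ := hg
    exact fun a b => ⟨fun h => by rw [← hf, h, hf], fun h => by rw [← hg, h, hg]⟩
  -- The arc beginning at `x` is the arc ending at its successor; hence arcs know the cyclic order.
  have hnext : ∀ x, T.next (e x) = e (S.next x) := by
    intro x
    obtain ⟨a, ha, ha'⟩ := hs x
    obtain ⟨b, hb, hb'⟩ := he (S.next x)
    have h1 : p a = p b := by rw [ha, hb, endArc]; simp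
    have h2 := (hk a b).1 h1
    rw [ha', hb', endArc] at h2
    have h3 := Sum.inl_injective h2
    rw [h3]; simp
  have hpow : ∀ (n : ℕ) x, (T.next ^ n) (e x) = e ((S.next ^ n) x) := by
    intro n x
    induction n with
    | zero => rfl
    | succ n ih => rw [pow_succ', Equiv.Perm.mul_apply, ih, hnext, pow_succ', Equiv.Perm.mul_apply]
  have hcyc : ∀ x y, T.part (e x) = T.part (e y) ↔ S.part x = S.part y := by
    intro x y
    rw [S.part_eq_iff, T.part_eq_iff]
    constructor
    · intro h
      obtain ⟨n, hn⟩ := h.exists_nat_pow_eq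
      rw [hpow] at hn
      exact ⟨n, by rw [zpow_natCast]; exact e.injective hn⟩
    · intro h
      obtain ⟨n, hn⟩ := h.exists_nat_pow_eq
      exact ⟨n, by rw [zpow_natCast, hpow, hn]⟩
  have hinl : ∀ a x, p a = Sum.inl x ↔ q a = Sum.inl (e x) := by
    intro a x
    obtain ⟨b, hb, hb'⟩ := hs x
    rw [← hb, ← hb', hk]
  have hcase : ∀ a, (∃ x, p a = Sum.inl x ∧ q a = Sum.inl (e x)) ∨
      ∃ i j, p a = Sum.inr i ∧ q a = Sum.inr j := by
    intro a
    rcases hpa : p a with x | i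
    · exact Or.inl ⟨x, rfl, (hinl a x).1 hpa⟩
    rcases hqa : q a with y | j
    · have := (hinl a (e.symm y)).2 (by simpa using hqa)
      rw [hpa] at this
      cases this
    · exact Or.inr ⟨i, j, rfl, rfl⟩
  -- Arcs at elements share a part when the elements share a cycle, while the circle of an empty
  -- part is the only arc of its part. The bijection of indices then comes from equality of kernels.
  have hpart : ∀ a b, S.arcPart (p a) = S.arcPart (p b) ↔ T.arcPart (q a) = T.arcPart (q b) := by
    intro a b
    rcases hcase a with ⟨x, h1, h2⟩ | ⟨i, j, h1, h2⟩ <;>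
      rcases hcase b with ⟨y, h3, h4⟩ | ⟨i', j', h3, h4⟩
    · rw [h1, h2, h3, h4]; exact (hcyc x y).symm
    · rw [h1, h2, h3, h4]; exact iff_of_false (i'.2 x) (j'.2 (e x))
    · rw [h1, h2, h3, h4]
      exact iff_of_false (fun h => i.2 y h.symm) (fun h => j.2 (e y) h.symm)
    · have h5 : S.arcPart (p a) = S.arcPart (p b) ↔ p a = p b := by
        rw [h1, h3, arcPart_inr, arcPart_inr, Sum.inr.injEq, Subtype.ext_iff]
      have h6 : T.arcPart (q a) = T.arcPart (q b) ↔ q a = q b := by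
        rw [h2, h4, arcPart_inr, arcPart_inr, Sum.inr.injEq, Subtype.ext_iff]
      rw [h5, h6, hk]
  obtain ⟨ι, hι⟩ := exists_equiv_of_kernel (S.arcPart_surjective.comp hp)
    (T.arcPart_surjective.comp hq) hpart
  refine ⟨⟨e, ι, fun x => ?_, hnext⟩, rfl, fun a => ?_⟩
  · obtain ⟨a, ha, ha'⟩ := hs x
    rw [← S.arcPart_inl x, ← ha, ← T.arcPart_inl, ← ha']
    exact (hι a).symm
  · rcases hcase a with ⟨x, h1, h2⟩ | ⟨i, j, h1, h2⟩
    · rw [h1, h2]; rfl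
    · rw [h1, h2]
      have := hι a
      simp only [Function.comp, h1, h2, arcPart_inr] at this
      exact congrArg Sum.inr (Subtype.ext this)

/-! ### The arcs of a cut -/

section cut

variable (S) (u v : S.carrier)

theorem cutArc_of_ne (x : Without u v) : S.cutArc u v (Sum.inl x.1) = Sum.inl x := by
  classical
  have h : ∃ n : ℕ, (((GluePerm.glue S.next u v)⁻¹ ^ n) x.1 ≠ u ∧
      ((GluePerm.glue S.next u v)⁻¹ ^ n) x.1 ≠ v) := ⟨0, x.2⟩
  have h0 : Nat.find h = 0 := (Nat.find_eq_zero h).2 x.2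
  simp only [cutArc, dif_pos h]
  congr 1
  apply Subtype.ext
  simp only [h0, pow_zero, Equiv.Perm.one_apply]

/-- The backward search defining `cutArc` does not stop at a removed point, so starting it one step
further back gives the same arc. If it never stops, both points name the same cycle of the glued
permutation. -/
theorem cutArc_glue_inv {x : S.carrier} (hx : x = u ∨ x = v) :
    S.cutArc u v (Sum.inl x) = S.cutArc u v (Sum.inl ((GluePerm.glue S.next u v)⁻¹ x)) := by
  classical
  set φ := GluePerm.glue S.next u v with hφ
  have hpow : ∀ n, (φ⁻¹ ^ n) (φ⁻¹ x) = (φ⁻¹ ^ (n + 1)) x := fun n => by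
    rw [pow_succ, Equiv.Perm.mul_apply]
  by_cases h : ∃ n : ℕ, ((φ⁻¹ ^ n) (φ⁻¹ x) ≠ u ∧ (φ⁻¹ ^ n) (φ⁻¹ x) ≠ v)
  · have h' : ∃ n : ℕ, ((φ⁻¹ ^ n) x ≠ u ∧ (φ⁻¹ ^ n) x ≠ v) := by
      obtain ⟨n, hn⟩ := h
      exact ⟨n + 1, by rwa [← hpow]⟩
    have e : Nat.find h' = Nat.find h + 1 := by
      refine Nat.find_eq_iff _ |>.2 ⟨?_, ?_⟩
      · rw [← hpow]; exact Nat.find_spec h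
      · intro n hn
        rcases n with _ | n
        · simp only [pow_zero, Equiv.Perm.one_apply]; tauto
        · rw [← hpow]; exact Nat.find_min h (by omega)
    have e1 : S.cutArc u v (Sum.inl x) = Sum.inl ⟨(φ⁻¹ ^ Nat.find h') x, Nat.find_spec h'⟩ := by
      simp only [cutArc]; exact dif_pos h'
    have e2 : S.cutArc u v (Sum.inl (φ⁻¹ x)) =
        Sum.inl ⟨(φ⁻¹ ^ Nat.find h) (φ⁻¹ x), Nat.find_spec h⟩ := by
      simp only [cutArc]; exact dif_pos h
    rw [e1, e2]
    congr 1
    apply Subtype.ext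
    simp only [e, hpow]
  · have h' : ¬ ∃ n : ℕ, ((φ⁻¹ ^ n) x ≠ u ∧ (φ⁻¹ ^ n) x ≠ v) := by
      rintro ⟨n, hn⟩
      rcases n with _ | n
      · simp only [pow_zero, Equiv.Perm.one_apply] at hn; tauto
      · exact h ⟨n, by rwa [hpow]⟩
    have e1 : ∃ H, S.cutArc u v (Sum.inl x) = Sum.inr ⟨Sum.inr (Quotient.mk _ x), H⟩ := by
      simp only [cutArc]; exact ⟨_, dif_neg h'⟩
    have e2 : ∃ H, S.cutArc u v (Sum.inl (φ⁻¹ x)) =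
        Sum.inr ⟨Sum.inr (Quotient.mk _ (φ⁻¹ x)), H⟩ := by
      simp only [cutArc]; exact ⟨_, dif_neg h⟩
    obtain ⟨H1, e1⟩ := e1
    obtain ⟨H2, e2⟩ := e2
    rw [e1, e2]
    congr 2
    congr 1
    exact (GluePerm.mk_eq_iff _ _ _).2 ⟨-1, by simp [hφ]⟩

/-- One of the two defining relations of a cut: before `u` on the glued circle stands the former
predecessor of `v`. -/
theorem cutArc_start_left : S.cutArc u v (Sum.inl u) = S.cutArc u v (S.endArc v) := by
  rw [cutArc_glue_inv S u v (Or.inl rfl), GluePerm.glue_inv_left]; rfl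

theorem cutArc_start_right : S.cutArc u v (Sum.inl v) = S.cutArc u v (S.endArc u) := by
  rw [cutArc_glue_inv S u v (Or.inr rfl), GluePerm.glue_inv_right]; rfl

theorem arcPart_cutArc_inl (x : S.carrier) :
    (S.cut u v).arcPart (S.cutArc u v (Sum.inl x)) = Sum.inr (Quotient.mk _ x) := by
  classical
  simp only [cutArc]
  split_ifs with h
  · refine congrArg Sum.inr ((GluePerm.mk_eq_iff _ _ _).2 ?_)
    exact (Equiv.Perm.sameCycle_inv.1 ⟨(Nat.find h : ℤ), by rw [zpow_natCast]⟩ :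
      (GluePerm.glue S.next u v).SameCycle x _).symm
  · rfl

theorem arcPart_cutArc_inr (i : S.EmptyPart) :
    (S.cut u v).arcPart (S.cutArc u v (Sum.inr i)) = Sum.inl i := rfl

theorem cutArc_surjective : Function.Surjective (S.cutArc u v) := by
  classical
  rintro (x | ⟨i | q, hi⟩)
  · exact ⟨Sum.inl x.1, S.cutArc_of_ne u v x⟩
  · exact ⟨Sum.inr i, rfl⟩
  · induction q using Quotient.inductionOn with | _ x => ?_
    refine ⟨Sum.inl x, ?_⟩
    have h := S.arcPart_cutArc_inl u v x
    rcases hx : S.cutArc u v (Sum.inl x) with y | j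
    · rw [hx] at h
      exact (hi y h).elim
    · rw [hx] at h
      exact congrArg Sum.inr (Subtype.ext h)

/-- The path of the glued permutation from `z` to its first return passes only through removed
points, and `cutArc` is constant along it up to the last step. -/
theorem endArc_cut (x : Without u v) :
    (S.cut u v).endArc x = S.cutArc u v (S.endArc x.1) := by
  set φ := GluePerm.glue S.next u v with hφ
  obtain ⟨z, rfl⟩ : ∃ z : Without u v, GluePerm.firstReturn φ u v z = x :=
    (GluePerm.firstReturn φ u v).surjective x
  have e1 : (S.cut u v).endArc (GluePerm.firstReturn φ u v z) = S.cutArc u v (Sum.inl z.1) :=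
    (congrArg Sum.inl ((GluePerm.firstReturn φ u v).symm_apply_apply z)).trans
      (S.cutArc_of_ne u v z).symm
  have e2 : ∀ w : Without u v, S.endArc w.1 = Sum.inl (φ⁻¹ w.1) := fun w => by
    rw [hφ, GluePerm.glue_inv_of_ne _ w.2.1 w.2.2]; rfl
  rw [e1, e2]
  have back : ∀ {a b : S.carrier}, φ a = b → (b = u ∨ b = v) →
      S.cutArc u v (Sum.inl a) = S.cutArc u v (Sum.inl b) := by
    rintro a b rfl hb
    rw [cutArc_glue_inv S u v hb]
    simp [hφ]
  -- The five possible paths: direct, through one removed point, or through both in either order.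
  rcases GluePerm.firstReturn_apply φ u v z with ⟨_, _, h⟩ | ⟨h1, _, _, h⟩ | ⟨h1, _, _, h⟩ |
    ⟨h1, h2, _, _, h⟩ | ⟨h1, h2, _, _, h⟩
  · rw [h]; simp
  · rw [h, back h1 (Or.inl rfl)]; simp
  · rw [h, back h1 (Or.inr rfl)]; simp
  · rw [h, back h1 (Or.inl rfl), back h2 (Or.inr rfl)]; simp
  · rw [h, back h1 (Or.inr rfl), back h2 (Or.inl rfl)]; simp

theorem arcPart_cutArc_inl_eq_iff (x y : S.carrier) :
    (S.cut u v).arcPart (S.cutArc u v (Sum.inl x)) =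
      (S.cut u v).arcPart (S.cutArc u v (Sum.inl y)) ↔
      (GluePerm.glue S.next u v).SameCycle x y := by
  rw [arcPart_cutArc_inl, arcPart_cutArc_inl, ← GluePerm.mk_eq_iff]
  exact Sum.inr_injective.eq_iff

theorem arcPart_cutArc_inl_ne_inr (x : S.carrier) (i : S.EmptyPart) :
    (S.cut u v).arcPart (S.cutArc u v (Sum.inl x)) ≠
      (S.cut u v).arcPart (S.cutArc u v (Sum.inr i)) := by
  rw [arcPart_cutArc_inl, arcPart_cutArc_inr]
  exact fun h => by cases h

theorem arcPart_cutArc_inr_injective {i j : S.EmptyPart}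
    (h : (S.cut u v).arcPart (S.cutArc u v (Sum.inr i)) =
      (S.cut u v).arcPart (S.cutArc u v (Sum.inr j))) : i = j :=
  Sum.inl_injective h

/-- With `cutArc_surjective` this exhibits the arcs of the cut as the quotient of the arcs of `S` by
two relations. The reason is that `h` is constant along every backward search through removed
points. -/
theorem cutArc_lift {Z : Type*} (h : S.Arc → Z) (h1 : h (Sum.inl u) = h (S.endArc v))
    (h2 : h (Sum.inl v) = h (S.endArc u)) :
    ∃ f : (S.cut u v).Arc → Z, ∀ α, f (S.cutArc u v α) = h α := by
  classical
  set φ := GluePerm.glue S.next u v with hφ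
  have step : ∀ x, (x = u ∨ x = v) → h (Sum.inl x) = h (Sum.inl (φ⁻¹ x)) := by
    rintro x (rfl | rfl)
    · rw [hφ, GluePerm.glue_inv_left]; exact h1
    · rw [hφ, GluePerm.glue_inv_right]; exact h2
  have steps : ∀ (n : ℕ) x, (∀ m < n, (φ⁻¹ ^ m) x = u ∨ (φ⁻¹ ^ m) x = v) →
      h (Sum.inl x) = h (Sum.inl ((φ⁻¹ ^ n) x)) := by
    intro n x
    induction n with
    | zero => intro _; rfl
    | succ n ih =>
      intro hn
      rw [ih fun m hm => hn m (by omega), step _ (hn n (by omega)), pow_succ', Equiv.Perm.mul_apply]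
  have hs := S.cutArc_surjective u v
  have key : ∀ α β, S.cutArc u v α = S.cutArc u v β → h α = h β := by
    -- Either the backward search from `x` stops at a surviving `y`, and `h` agrees at `x` and `y`,
    -- or it never stops, and `h` is constant on the whole backward orbit.
    have main : ∀ x, (∃ y : Without u v, S.cutArc u v (Sum.inl x) = Sum.inl y ∧
        h (Sum.inl x) = h (Sum.inl y.1)) ∨ ((∃ j, S.cutArc u v (Sum.inl x) = Sum.inr j) ∧
        ∀ n : ℕ, h (Sum.inl x) = h (Sum.inl ((φ⁻¹ ^ n) x))) := by
      intro x
      by_cases hx : ∃ n : ℕ, ((φ⁻¹ ^ n) x ≠ u ∧ (φ⁻¹ ^ n) x ≠ v)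
      · refine Or.inl ⟨⟨(φ⁻¹ ^ Nat.find hx) x, Nat.find_spec hx⟩, ?_, ?_⟩
        · simp only [cutArc]; exact dif_pos hx
        · refine steps _ _ fun m hm => ?_
          have := Nat.find_min hx hm
          tauto
      · refine Or.inr ⟨?_, fun n => steps n x fun m _ => ?_⟩
        · simp only [cutArc]; exact ⟨_, dif_neg hx⟩
        · by_contra hm
          exact hx ⟨m, by tauto⟩
    rintro (x | i) (y | j) hxy
    · have hp := (arcPart_cutArc_inl_eq_iff S u v x y).1 (congrArg (S.cut u v).arcPart hxy)
      rcases main x with ⟨x', hx, hx'⟩ | ⟨⟨x', hx⟩, hx'⟩ <;>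
        rcases main y with ⟨y', hy, hy'⟩ | ⟨⟨y', hy⟩, hy'⟩
      · rw [hx, hy] at hxy
        rw [hx', hy', Sum.inl_injective hxy]
      · rw [hx, hy] at hxy; cases hxy
      · rw [hx, hy] at hxy; cases hxy
      · obtain ⟨n, hn⟩ := (Equiv.Perm.sameCycle_inv.2 hp).exists_nat_pow_eq
        rw [hx' n, hn]
    · exact (arcPart_cutArc_inl_ne_inr S u v x j (congrArg _ hxy)).elim
    · exact (arcPart_cutArc_inl_ne_inr S u v y i (congrArg _ hxy).symm).elim
    · rw [arcPart_cutArc_inr_injective S u v (congrArg _ hxy)]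
  exact ⟨fun γ => h (hs γ).choose, fun α => key _ _ (hs _).choose_spec⟩

end cut

end MultCyc

namespace MultCyc

variable {S T : MultCyc.{u}}

/-! ### The arcs of a disjoint union and of a merging -/

/-- The inclusion of the arcs of the first summand. -/
def unionArcLeft (S T : MultCyc.{u}) (α : S.Arc) : (S.disjointUnion T).Arc :=
  α.map Sum.inl fun i => ⟨Sum.inl i.1, by
    rintro (x | x) hx
    · exact i.2 x (Sum.inl_injective hx)
    · cases hx⟩

/-- The inclusion of the arcs of the second summand. -/
def unionArcRight (S T : MultCyc.{u}) (α : T.Arc) : (S.disjointUnion T).Arc :=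
  α.map Sum.inr fun i => ⟨Sum.inr i.1, by
    rintro (x | x) hx
    · cases hx
    · exact i.2 x (Sum.inr_injective hx)⟩

theorem unionArc_cases (α : (S.disjointUnion T).Arc) :
    (∃ β, unionArcLeft S T β = α) ∨ ∃ β, unionArcRight S T β = α := by
  rcases α with (x | x) | ⟨i | i, hi⟩
  · exact Or.inl ⟨Sum.inl x, rfl⟩
  · exact Or.inr ⟨Sum.inl x, rfl⟩
  · exact Or.inl ⟨Sum.inr ⟨i, fun x hx => hi (Sum.inl x) (congrArg Sum.inl hx)⟩, rfl⟩
  · exact Or.inr ⟨Sum.inr ⟨i, fun x hx => hi (Sum.inr x) (congrArg Sum.inr hx)⟩, rfl⟩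

theorem unionArc_lift {Z : Type*} (h₁ : S.Arc → Z) (h₂ : T.Arc → Z) :
    ∃ f : (S.disjointUnion T).Arc → Z, (∀ α, f (unionArcLeft S T α) = h₁ α) ∧
      ∀ α, f (unionArcRight S T α) = h₂ α := by
  refine ⟨fun α => match α with
    | Sum.inl (Sum.inl x) => h₁ (Sum.inl x)
    | Sum.inl (Sum.inr x) => h₂ (Sum.inl x)
    | Sum.inr ⟨Sum.inl i, hi⟩ => h₁ (Sum.inr ⟨i, fun x hx => hi (Sum.inl x) (congrArg Sum.inl hx)⟩)
    | Sum.inr ⟨Sum.inr i, hi⟩ => h₂ (Sum.inr ⟨i, fun x hx => hi (Sum.inr x) (congrArg Sum.inr hx)⟩),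
    ?_, ?_⟩
  · rintro (x | i) <;> rfl
  · rintro (x | i) <;> rfl

section merge

variable (S T) (u : S.carrier) (v : T.carrier)

theorem mergeArcLeft_of_ne (x : S.carrier) (h : x ≠ u) :
    S.mergeArcLeft T u v (Sum.inl x) = Sum.inl (Graft.left x h) :=
  cutArc_of_ne (S.disjointUnion T) (Sum.inl u) (Sum.inr v) (Graft.left x h)

theorem mergeArcRight_of_ne (x : T.carrier) (h : x ≠ v) :
    S.mergeArcRight T u v (Sum.inl x) = Sum.inl (Graft.right x h) :=
  cutArc_of_ne (S.disjointUnion T) (Sum.inl u) (Sum.inr v) (Graft.right x h)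

theorem endArc_merge_left (x : S.carrier) (h : x ≠ u) :
    (S.merge T u v).endArc (Graft.left x h : Graft u v) = S.mergeArcLeft T u v (S.endArc x) :=
  endArc_cut (S.disjointUnion T) (Sum.inl u) (Sum.inr v) (Graft.left x h)

theorem endArc_merge_right (x : T.carrier) (h : x ≠ v) :
    (S.merge T u v).endArc (Graft.right x h : Graft u v) = S.mergeArcRight T u v (T.endArc x) :=
  endArc_cut (S.disjointUnion T) (Sum.inl u) (Sum.inr v) (Graft.right x h)

theorem mergeArcLeft_start : S.mergeArcLeft T u v (Sum.inl u) = S.mergeArcRight T u v (T.endArc v) :=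
  (S.disjointUnion T).cutArc_start_left (Sum.inl u) (Sum.inr v)

theorem mergeArcRight_start : S.mergeArcRight T u v (Sum.inl v) = S.mergeArcLeft T u v (S.endArc u) :=
  (S.disjointUnion T).cutArc_start_right (Sum.inl u) (Sum.inr v)

theorem mergeArc_surjective :
    Function.Surjective (Sum.elim (S.mergeArcLeft T u v) (S.mergeArcRight T u v)) := by
  intro α
  obtain ⟨β, rfl⟩ := (S.disjointUnion T).cutArc_surjective _ _ α
  rcases unionArc_cases β with ⟨γ, rfl⟩ | ⟨γ, rfl⟩
  · exact ⟨Sum.inl γ, rfl⟩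
  · exact ⟨Sum.inr γ, rfl⟩

/-- The arcs of a merging are the disjoint union of the two sets of arcs modulo the two gluing
relations at `u` and `v`. -/
theorem mergeArc_lift {Z : Type*} (h₁ : S.Arc → Z) (h₂ : T.Arc → Z)
    (h : h₁ (Sum.inl u) = h₂ (T.endArc v)) (h' : h₂ (Sum.inl v) = h₁ (S.endArc u)) :
    ∃ f : (S.merge T u v).Arc → Z, (∀ α, f (S.mergeArcLeft T u v α) = h₁ α) ∧
      ∀ α, f (S.mergeArcRight T u v α) = h₂ α := by
  obtain ⟨k, hl, hr⟩ := unionArc_lift h₁ h₂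
  obtain ⟨f, hf⟩ := (S.disjointUnion T).cutArc_lift (Sum.inl u) (Sum.inr v) k
    ((hl (Sum.inl u)).trans (h.trans (hr (T.endArc v)).symm))
    ((hr (Sum.inl v)).trans (h'.trans (hl (S.endArc u)).symm))
  exact ⟨f, fun α => (hf _).trans (hl α), fun α => (hf _).trans (hr α)⟩

end merge

theorem graft_cases {S T : Type*} {a : S} {b : T} (x : Graft a b) :
    (∃ y h, x = Graft.left y h) ∨ ∃ y h, x = Graft.right y h := by
  obtain ⟨x | x, h⟩ := x
  · exact Or.inl ⟨x, by simpa using h, rfl⟩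
  · exact Or.inr ⟨x, by simpa using h, rfl⟩

/-! ### Canonical isomorphisms -/

/-- An isomorphism induces an isomorphism of cuts. -/
theorem exists_cut_iso (ρ : Iso S T) (a b : S.carrier) :
    ∃ θ : Iso (S.cut a b) (T.cut (ρ.toEquiv a) (ρ.toEquiv b)),
      ∀ α, θ.onArc (S.cutArc a b α) = T.cutArc (ρ.toEquiv a) (ρ.toEquiv b) (ρ.onArc α) := by
  obtain ⟨θ, -, h⟩ := exists_iso_of_arc (S := S.cut a b)
    (T := T.cut (ρ.toEquiv a) (ρ.toEquiv b)) (p := S.cutArc a b)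
    (q := fun α => T.cutArc (ρ.toEquiv a) (ρ.toEquiv b) (ρ.onArc α))
    (withoutCongr ρ.toEquiv a b) (S.cutArc_surjective a b)
    ((T.cutArc_surjective _ _).comp ρ.onArc_surjective)
    (S.cutArc_lift a b _
      (by rw [ρ.onArc_inl, ρ.onArc_endArc, cutArc_start_left])
      (by rw [ρ.onArc_inl, ρ.onArc_endArc, cutArc_start_right]))
    (by
      obtain ⟨g, hg⟩ := T.cutArc_lift (ρ.toEquiv a) (ρ.toEquiv b)
        (fun α => S.cutArc a b (ρ.symm.onArc α))
        (by rw [← ρ.onArc_inl, ← ρ.onArc_endArc, ρ.symm_onArc_onArc, ρ.symm_onArc_onArc,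
          cutArc_start_left])
        (by rw [← ρ.onArc_inl, ← ρ.onArc_endArc, ρ.symm_onArc_onArc, ρ.symm_onArc_onArc,
          cutArc_start_right])
      exact ⟨g, fun α => by rw [hg, ρ.symm_onArc_onArc]⟩)
    (fun x => ⟨Sum.inl x.1, S.cutArc_of_ne a b x,
      T.cutArc_of_ne _ _ (withoutCongr ρ.toEquiv a b x)⟩)
    (fun x => ⟨S.endArc x.1, (S.endArc_cut a b x).symm, by
      rw [ρ.onArc_endArc]
      exact (T.endArc_cut _ _ (withoutCongr ρ.toEquiv a b x)).symm⟩)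
  exact ⟨θ, h⟩

/-- The cut does not depend on the order of the two elements. -/
theorem exists_cut_swap_iso (S : MultCyc.{u}) (a b : S.carrier) :
    ∃ θ : Iso (S.cut b a) (S.cut a b), ∀ α, θ.onArc (S.cutArc b a α) = S.cutArc a b α := by
  let e : Without b a ≃ Without a b := Equiv.subtypeEquivRight fun x => and_comm
  obtain ⟨θ, -, h⟩ := exists_iso_of_arc (S := S.cut b a) (T := S.cut a b) (p := S.cutArc b a)
    (q := S.cutArc a b) e (S.cutArc_surjective b a) (S.cutArc_surjective a b)
    (S.cutArc_lift b a _ (S.cutArc_start_right a b) (S.cutArc_start_left a b))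
    (S.cutArc_lift a b _ (S.cutArc_start_right b a) (S.cutArc_start_left b a))
    (fun x => ⟨Sum.inl x.1, S.cutArc_of_ne b a x, S.cutArc_of_ne a b (e x)⟩)
    (fun x => ⟨S.endArc x.1, (S.endArc_cut b a x).symm, (S.endArc_cut a b (e x)).symm⟩)
  exact ⟨θ, h⟩

/-- A map on the arcs that is compatible with two cuts factors through the double cut. -/
theorem cutArc_cutArc_lift (S : MultCyc.{u}) {a b c d : S.carrier} (hac : a ≠ c) (had : a ≠ d)
    (hbc : b ≠ c) (hbd : b ≠ d) {Z : Type*} (h : S.Arc → Z)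
    (h1 : h (Sum.inl a) = h (S.endArc b)) (h2 : h (Sum.inl b) = h (S.endArc a))
    (h3 : h (Sum.inl c) = h (S.endArc d)) (h4 : h (Sum.inl d) = h (S.endArc c)) :
    ∃ f : ((S.cut c d).cut ⟨a, hac, had⟩ ⟨b, hbc, hbd⟩).Arc → Z,
      ∀ α, f ((S.cut c d).cutArc ⟨a, hac, had⟩ ⟨b, hbc, hbd⟩ (S.cutArc c d α)) = h α := by
  obtain ⟨k, hk⟩ := S.cutArc_lift c d h h3 h4
  obtain ⟨f, hf⟩ := (S.cut c d).cutArc_lift ⟨a, hac, had⟩ ⟨b, hbc, hbd⟩ k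
    ((congrArg k (cutArc_of_ne S c d ⟨a, hac, had⟩)).symm.trans ((hk _).trans (h1.trans
      ((hk _).symm.trans (congrArg k (endArc_cut S c d ⟨b, hbc, hbd⟩)).symm))))
    ((congrArg k (cutArc_of_ne S c d ⟨b, hbc, hbd⟩)).symm.trans ((hk _).trans (h2.trans
      ((hk _).symm.trans (congrArg k (endArc_cut S c d ⟨a, hac, had⟩)).symm))))
  exact ⟨f, fun α => by rw [hf, hk]⟩

/-- The identifications of arcs in a double cut. -/
theorem cutArc_cutArc_start (S : MultCyc.{u}) {a b c d : S.carrier} (hac : a ≠ c) (had : a ≠ d)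
    (hbc : b ≠ c) (hbd : b ≠ d) :
    let q := fun α => (S.cut c d).cutArc ⟨a, hac, had⟩ ⟨b, hbc, hbd⟩ (S.cutArc c d α)
    q (Sum.inl a) = q (S.endArc b) ∧ q (Sum.inl b) = q (S.endArc a) ∧
      q (Sum.inl c) = q (S.endArc d) ∧ q (Sum.inl d) = q (S.endArc c) := by
  refine ⟨?_, ?_, ?_, ?_⟩
  · simp only
    rw [cutArc_of_ne S c d ⟨a, hac, had⟩, ← endArc_cut S c d ⟨b, hbc, hbd⟩]
    exact cutArc_start_left _ _ _
  · simp only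
    rw [cutArc_of_ne S c d ⟨b, hbc, hbd⟩, ← endArc_cut S c d ⟨a, hac, had⟩]
    exact cutArc_start_right _ _ _
  · simp only [cutArc_start_left S c d]
  · simp only [cutArc_start_right S c d]

/-- Two cuts commute. -/
theorem exists_cut_cut_iso (S : MultCyc.{u}) {a b c d : S.carrier} (hac : a ≠ c) (had : a ≠ d)
    (hbc : b ≠ c) (hbd : b ≠ d) :
    ∃ θ : Iso ((S.cut c d).cut ⟨a, hac, had⟩ ⟨b, hbc, hbd⟩)
      ((S.cut a b).cut ⟨c, hac.symm, hbc.symm⟩ ⟨d, had.symm, hbd.symm⟩),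
      ∀ α, θ.onArc ((S.cut c d).cutArc ⟨a, hac, had⟩ ⟨b, hbc, hbd⟩ (S.cutArc c d α)) =
        (S.cut a b).cutArc ⟨c, hac.symm, hbc.symm⟩ ⟨d, had.symm, hbd.symm⟩ (S.cutArc a b α) := by
  let e : Without (⟨a, hac, had⟩ : Without c d) ⟨b, hbc, hbd⟩ ≃
      Without (⟨c, hac.symm, hbc.symm⟩ : Without a b) ⟨d, had.symm, hbd.symm⟩ :=
    { toFun := fun x => ⟨⟨x.1.1, fun h => x.2.1 (Subtype.ext h), fun h => x.2.2 (Subtype.ext h)⟩,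
        fun h => x.1.2.1 (congrArg Subtype.val h), fun h => x.1.2.2 (congrArg Subtype.val h)⟩
      invFun := fun x => ⟨⟨x.1.1, fun h => x.2.1 (Subtype.ext h), fun h => x.2.2 (Subtype.ext h)⟩,
        fun h => x.1.2.1 (congrArg Subtype.val h), fun h => x.1.2.2 (congrArg Subtype.val h)⟩
      left_inv := fun _ => rfl
      right_inv := fun _ => rfl }
  obtain ⟨p1, p2, p3, p4⟩ := S.cutArc_cutArc_start hac had hbc hbd
  obtain ⟨q1, q2, q3, q4⟩ := S.cutArc_cutArc_start hac.symm hbc.symm had.symm hbd.symm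
  -- Both double cuts present their arcs as the quotient of the arcs of `S` by the same four
  -- relations, imposed in a different order.
  obtain ⟨θ, -, h⟩ := exists_iso_of_arc (S := (S.cut c d).cut ⟨a, hac, had⟩ ⟨b, hbc, hbd⟩)
    (T := (S.cut a b).cut ⟨c, hac.symm, hbc.symm⟩ ⟨d, had.symm, hbd.symm⟩)
    (p := fun α => (S.cut c d).cutArc ⟨a, hac, had⟩ ⟨b, hbc, hbd⟩ (S.cutArc c d α))
    (q := fun α => (S.cut a b).cutArc ⟨c, hac.symm, hbc.symm⟩ ⟨d, had.symm, hbd.symm⟩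
      (S.cutArc a b α))
    e (((S.cut c d).cutArc_surjective _ _).comp (S.cutArc_surjective _ _))
    (((S.cut a b).cutArc_surjective _ _).comp (S.cutArc_surjective _ _))
    (S.cutArc_cutArc_lift hac had hbc hbd _ q3 q4 q1 q2)
    (S.cutArc_cutArc_lift hac.symm hbc.symm had.symm hbd.symm _ p3 p4 p1 p2)
    (fun x => ⟨Sum.inl x.1.1,
      (congrArg _ (cutArc_of_ne S c d x.1)).trans (cutArc_of_ne (S.cut c d) _ _ x),
      (congrArg _ (cutArc_of_ne S a b (e x).1)).trans (cutArc_of_ne (S.cut a b) _ _ (e x))⟩)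
    (fun x => ⟨S.endArc x.1.1,
      (congrArg _ (endArc_cut S c d x.1).symm).trans (endArc_cut (S.cut c d) _ _ x).symm,
      (congrArg _ (endArc_cut S a b (e x).1).symm).trans (endArc_cut (S.cut a b) _ _ (e x)).symm⟩)
  exact ⟨θ, h⟩

/-- A merging at `a` and `b` after a cut of the first set is a cut after a merging. -/
theorem exists_merge_cut_iso (S T : MultCyc.{u}) {a c d : S.carrier} (b : T.carrier) (hac : a ≠ c)
    (had : a ≠ d) :
    ∃ θ : Iso ((S.cut c d).merge T ⟨a, hac, had⟩ b)
      ((S.merge T a b).cut (Graft.left c hac.symm) (Graft.left d had.symm)),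
    (∀ α, θ.onArc ((S.cut c d).mergeArcLeft T ⟨a, hac, had⟩ b (S.cutArc c d α)) =
      (S.merge T a b).cutArc (Graft.left c hac.symm) (Graft.left d had.symm)
        (S.mergeArcLeft T a b α)) ∧
    (∀ α, θ.onArc ((S.cut c d).mergeArcRight T ⟨a, hac, had⟩ b α) =
      (S.merge T a b).cutArc (Graft.left c hac.symm) (Graft.left d had.symm)
        (S.mergeArcRight T a b α)) := by
  let e := graftWithout a c d b hac had
  let pl := fun α => (S.cut c d).mergeArcLeft T ⟨a, hac, had⟩ b (S.cutArc c d α)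
  let pr := fun α => (S.cut c d).mergeArcRight T ⟨a, hac, had⟩ b α
  let ql := fun α => (S.merge T a b).cutArc (Graft.left c hac.symm) (Graft.left d had.symm)
        (S.mergeArcLeft T a b α)
  let qr := fun α => (S.merge T a b).cutArc (Graft.left c hac.symm) (Graft.left d had.symm)
        (S.mergeArcRight T a b α)
  have ps : Function.Surjective (Sum.elim pl pr) := by
    intro α
    obtain ⟨β | β, rfl⟩ := mergeArc_surjective _ _ _ _ α
    · obtain ⟨γ, rfl⟩ := S.cutArc_surjective _ _ β
      exact ⟨Sum.inl γ, rfl⟩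
    · exact ⟨Sum.inr β, rfl⟩
  have qs : Function.Surjective (Sum.elim ql qr) := by
    intro α
    obtain ⟨β, rfl⟩ := cutArc_surjective _ _ _ α
    obtain ⟨γ | γ, rfl⟩ := mergeArc_surjective _ _ _ _ β
    · exact ⟨Sum.inl γ, rfl⟩
    · exact ⟨Sum.inr γ, rfl⟩
  -- On both sides the arcs of `S` and `T` satisfy the same four relations, two for the pair `a`,
  -- `b` and two for the pair `c`, `d`; so each parametrization factors through the other.
  have p1 : pl (Sum.inl a) = pr (T.endArc b) := by
    simp only [pl, pr]
    rw [cutArc_of_ne S c d ⟨a, hac, had⟩]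
    exact mergeArcLeft_start _ _ _ _
  have p2 : pr (Sum.inl b) = pl (S.endArc a) := by
    simp only [pl, pr]
    rw [← endArc_cut S c d ⟨a, hac, had⟩]
    exact mergeArcRight_start _ _ _ _
  have p3 : pl (Sum.inl c) = pl (S.endArc d) := by
    simp only [pl, cutArc_start_left]
  have p4 : pl (Sum.inl d) = pl (S.endArc c) := by
    simp only [pl, cutArc_start_right]
  have q1 : ql (Sum.inl a) = qr (T.endArc b) := by
    simp only [ql, qr, mergeArcLeft_start]
  have q2 : qr (Sum.inl b) = ql (S.endArc a) := by
    simp only [ql, qr, mergeArcRight_start]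
  have q3 : ql (Sum.inl c) = ql (S.endArc d) := by
    simp only [ql]
    rw [mergeArcLeft_of_ne _ _ _ _ c hac.symm, ← endArc_merge_left _ _ _ _ d had.symm]
    exact cutArc_start_left _ _ _
  have q4 : ql (Sum.inl d) = ql (S.endArc c) := by
    simp only [ql]
    rw [mergeArcLeft_of_ne _ _ _ _ d had.symm, ← endArc_merge_left _ _ _ _ c hac.symm]
    exact cutArc_start_right _ _ _
  have hf : ∃ f : ((S.cut c d).merge T ⟨a, hac, had⟩ b).Arc → _,
      ∀ α, f (Sum.elim pl pr α) = Sum.elim ql qr α := by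
    obtain ⟨k, hk⟩ := S.cutArc_lift c d ql q3 q4
    obtain ⟨f, hl, hr⟩ := (S.cut c d).mergeArc_lift T ⟨a, hac, had⟩ b k qr
      ((congrArg k (cutArc_of_ne S c d ⟨a, hac, had⟩)).symm.trans ((hk _).trans q1))
      (q2.trans ((hk _).symm.trans (congrArg k (endArc_cut S c d ⟨a, hac, had⟩)).symm))
    exact ⟨f, Sum.rec (fun α => (hl _).trans (hk _)) hr⟩
  have hg : ∃ g : ((S.merge T a b).cut (Graft.left c hac.symm) (Graft.left d had.symm)).Arc → _,
      ∀ α, g (Sum.elim ql qr α) = Sum.elim pl pr α := by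
    obtain ⟨k, hl, hr⟩ := S.mergeArc_lift T a b pl pr p1 p2
    obtain ⟨g, hg⟩ := (S.merge T a b).cutArc_lift (Graft.left c hac.symm) (Graft.left d had.symm) k
      ((congrArg k (mergeArcLeft_of_ne S T a b c hac.symm)).symm.trans ((hl _).trans (p3.trans
        ((hl _).symm.trans (congrArg k (endArc_merge_left S T a b d had.symm)).symm))))
      ((congrArg k (mergeArcLeft_of_ne S T a b d had.symm)).symm.trans ((hl _).trans (p4.trans
        ((hl _).symm.trans (congrArg k (endArc_merge_left S T a b c hac.symm)).symm))))
    exact ⟨g, Sum.rec (fun α => (hg _).trans (hl _)) fun α => (hg _).trans (hr _)⟩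
  have hs : ∀ x, ∃ α, Sum.elim pl pr α = Sum.inl x ∧ Sum.elim ql qr α = Sum.inl (e x) := by
    intro x
    rcases graft_cases x with ⟨y, h, rfl⟩ | ⟨y, h, rfl⟩
    · exact ⟨Sum.inl (Sum.inl y.1),
        (congrArg _ (cutArc_of_ne S c d y)).trans
          (mergeArcLeft_of_ne (S.cut c d) T ⟨a, hac, had⟩ b y h),
        (congrArg _ (mergeArcLeft_of_ne S T a b y.1 fun hy => h (Subtype.ext hy))).trans
          (cutArc_of_ne (S.merge T a b) (Graft.left c hac.symm) (Graft.left d had.symm)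
            (e (Graft.left y h)))⟩
    · exact ⟨Sum.inr (Sum.inl y), mergeArcRight_of_ne (S.cut c d) T ⟨a, hac, had⟩ b y h,
        (congrArg _ (mergeArcRight_of_ne S T a b y h)).trans
          (cutArc_of_ne (S.merge T a b) (Graft.left c hac.symm) (Graft.left d had.symm)
            (e (Graft.right y h)))⟩
  have he : ∀ x, ∃ α, Sum.elim pl pr α = ((S.cut c d).merge T ⟨a, hac, had⟩ b).endArc x ∧
      Sum.elim ql qr α = ((S.merge T a b).cut (Graft.left c hac.symm)
        (Graft.left d had.symm)).endArc (e x) := by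
    intro x
    rcases graft_cases x with ⟨y, h, rfl⟩ | ⟨y, h, rfl⟩
    · exact ⟨Sum.inl (S.endArc y.1),
        (congrArg _ (endArc_cut S c d y).symm).trans
          (endArc_merge_left (S.cut c d) T ⟨a, hac, had⟩ b y h).symm,
        (congrArg _ (endArc_merge_left S T a b y.1 fun hy => h (Subtype.ext hy)).symm).trans
          (endArc_cut (S.merge T a b) (Graft.left c hac.symm) (Graft.left d had.symm)
            (e (Graft.left y h))).symm⟩
    · exact ⟨Sum.inr (T.endArc y),
        (endArc_merge_right (S.cut c d) T ⟨a, hac, had⟩ b y h).symm,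
        (congrArg _ (endArc_merge_right S T a b y h).symm).trans
          (endArc_cut (S.merge T a b) (Graft.left c hac.symm) (Graft.left d had.symm)
            (e (Graft.right y h))).symm⟩
  obtain ⟨θ, -, h⟩ := exists_iso_of_arc (S := (S.cut c d).merge T ⟨a, hac, had⟩ b)
    (T := (S.merge T a b).cut (Graft.left c hac.symm) (Graft.left d had.symm))
    (p := Sum.elim pl pr) (q := Sum.elim ql qr) e ps qs hf hg hs he
  exact ⟨θ, fun α => h (Sum.inl α), fun α => h (Sum.inr α)⟩

/-- The symmetry of the merging. -/
theorem exists_merge_swap_iso (S T : MultCyc.{u}) (a : S.carrier) (b : T.carrier) :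
    ∃ θ : Iso (T.merge S b a) (S.merge T a b),
      (∀ α, θ.onArc (T.mergeArcRight S b a α) = S.mergeArcLeft T a b α) ∧
      (∀ α, θ.onArc (T.mergeArcLeft S b a α) = S.mergeArcRight T a b α) := by
  let e := graftSwap a b
  obtain ⟨θ, -, h⟩ := exists_iso_of_arc (S := T.merge S b a) (T := S.merge T a b) e
    (mergeArc_surjective T S b a) (q := Sum.elim (S.mergeArcRight T a b) (S.mergeArcLeft T a b))
    (by
      intro α
      obtain ⟨β | β, rfl⟩ := mergeArc_surjective S T a b α
      · exact ⟨Sum.inr β, rfl⟩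
      · exact ⟨Sum.inl β, rfl⟩)
    (by
      obtain ⟨f, hl, hr⟩ := T.mergeArc_lift S b a (S.mergeArcRight T a b) (S.mergeArcLeft T a b)
        (S.mergeArcRight_start T a b) (S.mergeArcLeft_start T a b)
      exact ⟨f, Sum.rec hl hr⟩)
    (by
      obtain ⟨f, hl, hr⟩ := S.mergeArc_lift T a b (T.mergeArcRight S b a) (T.mergeArcLeft S b a)
        (T.mergeArcRight_start S b a) (T.mergeArcLeft_start S b a)
      exact ⟨f, Sum.rec hr hl⟩)
    (by
      rintro x
      rcases graft_cases x with ⟨y, h, rfl⟩ | ⟨y, h, rfl⟩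
      · exact ⟨Sum.inl (Sum.inl y), mergeArcLeft_of_ne _ _ _ _ _ h,
          mergeArcRight_of_ne _ _ _ _ _ h⟩
      · exact ⟨Sum.inr (Sum.inl y), mergeArcRight_of_ne _ _ _ _ _ h,
          mergeArcLeft_of_ne _ _ _ _ _ h⟩)
    (by
      rintro x
      rcases graft_cases x with ⟨y, h, rfl⟩ | ⟨y, h, rfl⟩
      · exact ⟨Sum.inl (T.endArc y), (endArc_merge_left _ _ _ _ _ h).symm,
          (endArc_merge_right _ _ _ _ _ h).symm⟩
      · exact ⟨Sum.inr (S.endArc y), (endArc_merge_right _ _ _ _ _ h).symm,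
          (endArc_merge_left _ _ _ _ _ h).symm⟩)
  exact ⟨θ, fun α => h (Sum.inr α), fun α => h (Sum.inl α)⟩

/-- Isomorphisms induce an isomorphism of disjoint unions. -/
def unionIso {S T S' T' : MultCyc.{u}} (ρ : Iso S S') (τ : Iso T T') :
    Iso (S.disjointUnion T) (S'.disjointUnion T') where
  toEquiv := Equiv.sumCongr ρ.toEquiv τ.toEquiv
  indexEquiv := Equiv.sumCongr ρ.indexEquiv τ.indexEquiv
  part_apply := Sum.rec (fun x => congrArg Sum.inl (ρ.part_apply x))
    fun x => congrArg Sum.inr (τ.part_apply x)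
  next_apply := Sum.rec (fun x => congrArg Sum.inl (ρ.next_apply x))
    fun x => congrArg Sum.inr (τ.next_apply x)

/-- Isomorphisms induce an isomorphism of mergings. -/
theorem exists_merge_iso {S T S' T' : MultCyc.{u}} (ρ : Iso S S') (τ : Iso T T') (a : S.carrier)
    (b : T.carrier) :
    ∃ θ : Iso (S.merge T a b) (S'.merge T' (ρ.toEquiv a) (τ.toEquiv b)),
      (∀ α, θ.onArc (S.mergeArcLeft T a b α) =
        S'.mergeArcLeft T' (ρ.toEquiv a) (τ.toEquiv b) (ρ.onArc α)) ∧
      (∀ α, θ.onArc (S.mergeArcRight T a b α) =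
        S'.mergeArcRight T' (ρ.toEquiv a) (τ.toEquiv b) (τ.onArc α)) := by
  -- A merging is a cut of a disjoint union.
  obtain ⟨θ, h⟩ := exists_cut_iso (unionIso ρ τ) (Sum.inl a) (Sum.inr b)
  refine ⟨θ, fun α => (h (unionArcLeft S T α)).trans ?_,
    fun α => (h (unionArcRight S T α)).trans ?_⟩ <;> rcases α with x | i <;> rfl

end MultCyc

/-! ### Recovering a permutation from its first return -/

namespace GluePerm

/-- Permutations are conjugate if the first returns to the complement of two points are, and the
ways in which the two points are reached agree. -/
theorem conj_of_firstReturn {α β : Type*} (φ : Equiv.Perm α) (φ' : Equiv.Perm β) (ρ : α ≃ β)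
    {u v : α} {u' v' : β} (hu' : ρ u = u') (hv' : ρ v = v') (huv : u ≠ v)
    (hr : ∀ (x : {x : α // x ≠ u ∧ x ≠ v}) (y : {x : β // x ≠ u' ∧ x ≠ v'}), ρ x.1 = y.1 →
      ρ (firstReturn φ u v x).1 = (firstReturn φ' u' v' y).1)
    (hu : ∀ x, x ≠ u → x ≠ v → (φ x = u ↔ φ' (ρ x) = u'))
    (hv : ∀ x, x ≠ u → x ≠ v → (φ x = v ↔ φ' (ρ x) = v'))
    (h1 : φ u = v ↔ φ' u' = v') (h2 : φ v = u ↔ φ' v' = u') (x : α) : ρ (φ x) = φ' (ρ x) := by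
  subst hu' hv'
  have iu : ∀ x, ρ x = ρ u ↔ x = u := fun x => ρ.injective.eq_iff
  have iv : ∀ x, ρ x = ρ v ↔ x = v := fun x => ρ.injective.eq_iff
  -- Here `r` is the first return of `x`; the possible paths to it under `φ` and to its image under
  -- `φ'` are listed side by side.
  have hret : ∀ x, x ≠ u → x ≠ v → ∃ r,
      ((φ x ≠ u ∧ φ x ≠ v ∧ r = φ x) ∨ (φ x = u ∧ φ u ≠ u ∧ φ u ≠ v ∧ r = φ u) ∨
      (φ x = v ∧ φ v ≠ u ∧ φ v ≠ v ∧ r = φ v) ∨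
      (φ x = u ∧ φ u = v ∧ φ v ≠ u ∧ φ v ≠ v ∧ r = φ v) ∨
      (φ x = v ∧ φ v = u ∧ φ u ≠ u ∧ φ u ≠ v ∧ r = φ u)) ∧
      ((φ' (ρ x) ≠ ρ u ∧ φ' (ρ x) ≠ ρ v ∧ ρ r = φ' (ρ x)) ∨
      (φ' (ρ x) = ρ u ∧ φ' (ρ u) ≠ ρ u ∧ φ' (ρ u) ≠ ρ v ∧ ρ r = φ' (ρ u)) ∨
      (φ' (ρ x) = ρ v ∧ φ' (ρ v) ≠ ρ u ∧ φ' (ρ v) ≠ ρ v ∧ ρ r = φ' (ρ v)) ∨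
      (φ' (ρ x) = ρ u ∧ φ' (ρ u) = ρ v ∧ φ' (ρ v) ≠ ρ u ∧ φ' (ρ v) ≠ ρ v ∧ ρ r = φ' (ρ v)) ∨
      (φ' (ρ x) = ρ v ∧ φ' (ρ v) = ρ u ∧ φ' (ρ u) ≠ ρ u ∧ φ' (ρ u) ≠ ρ v ∧ ρ r = φ' (ρ u))) := by
    intro x hxu hxv
    let X : {x : α // x ≠ u ∧ x ≠ v} := ⟨x, hxu, hxv⟩
    let Y : {x : β // x ≠ ρ u ∧ x ≠ ρ v} := ⟨ρ x, by rwa [ne_eq, iu], by rwa [ne_eq, iv]⟩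
    refine ⟨(firstReturn φ u v X).1, firstReturn_apply φ u v X, ?_⟩
    rw [hr X Y rfl]
    exact firstReturn_apply φ' (ρ u) (ρ v) Y
  have hX : ∀ x, x ≠ u → x ≠ v → ρ (φ x) = φ' (ρ x) := by
    intro x hxu hxv
    obtain ⟨r, h, h'⟩ := hret x hxu hxv
    have := hu x hxu hxv
    have := hv x hxu hxv
    grind
  have inj := φ'.injective
  have hpre : ∀ y, ∃ z, φ z = y := φ.surjective
  have hpre' : ∀ y, ∃ z, φ' (ρ z) = y := (φ'.surjective.comp ρ.surjective)
  -- The value at `u`, unless it is `v`, is read off from what precedes `u`: itself; a surviving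
  -- point, whose path returns after `u`; or `v`, in which case the predecessor of `v` survives and
  -- its path returns after `v` and `u`.
  by_cases hxu : x = u
  · subst hxu
    by_cases hc : φ x = v
    · rw [hc, h1.1 hc]
    obtain ⟨z, hz⟩ := hpre x
    by_cases hzx : z = x
    · subst hzx
      rw [hz]
      obtain ⟨z', hz'⟩ := hpre' (ρ z)
      by_cases h3 : z' = z
      · rw [h3] at hz'; exact hz'.symm
      by_cases h4 : z' = v
      · rw [h4] at hz'
        exact absurd (φ.injective ((h2.2 hz').trans hz.symm)).symm huv
      · exact absurd (φ.injective (((hu z' h3 h4).2 hz').trans hz.symm)) h3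
    · by_cases hzv : z = v
      · subst hzv
        obtain ⟨w, hw⟩ := hpre z
        have hwx : w ≠ x := fun h => hc (h ▸ hw)
        have hwz : w ≠ z := fun h => huv (hz.symm.trans (h ▸ hw))
        obtain ⟨r, h, h'⟩ := hret w hwx hwz
        have := hX w hwx hwz
        grind
      · obtain ⟨r, h, h'⟩ := hret z hzx hzv
        have := hX z hzx hzv
        grind
  by_cases hxv : x = v
  · subst hxv
    by_cases hc : φ x = u
    · rw [hc, h2.1 hc]
    obtain ⟨z, hz⟩ := hpre x
    by_cases hzx : z = x
    · subst hzx
      rw [hz]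
      obtain ⟨z', hz'⟩ := hpre' (ρ z)
      by_cases h3 : z' = z
      · rw [h3] at hz'; exact hz'.symm
      by_cases h4 : z' = u
      · rw [h4] at hz'
        exact absurd (φ.injective ((h1.2 hz').trans hz.symm)) huv
      · exact absurd (φ.injective (((hv z' h4 h3).2 hz').trans hz.symm)) h3
    · by_cases hzv : z = u
      · subst hzv
        obtain ⟨w, hw⟩ := hpre z
        have hwx : w ≠ x := fun h => hc (h ▸ hw)
        have hwz : w ≠ z := fun h => huv (hz.symm.trans (h ▸ hw)).symm
        obtain ⟨r, h, h'⟩ := hret w hwz hwx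
        have := hX w hwz hwx
        grind
      · obtain ⟨r, h, h'⟩ := hret z hzv hzx
        have := hX z hzv hzx
        grind
  exact hX x hxu hxv

/-- Under either alternative the orbit of `u` stays in `{u, v}`. -/
theorem not_sameCycle_of_closed {α : Type*} [Finite α] {φ : Equiv.Perm α} {u v x : α}
    (hx : x ≠ u ∧ x ≠ v) (h : φ u = u ∨ (φ u = v ∧ φ v = u)) : ¬ φ.SameCycle u x := by
  intro hs
  obtain ⟨n, hn⟩ := hs.exists_nat_pow_eq
  have : ∀ n : ℕ, (φ ^ n) u = u ∨ ((φ ^ n) u = v ∧ φ v = u) := by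
    intro n
    induction n with
    | zero => exact Or.inl rfl
    | succ n ih =>
      rw [pow_succ', Equiv.Perm.mul_apply]
      rcases ih with ih | ⟨ih, ih'⟩
      · rw [ih]; exact h
      · rw [ih]; exact Or.inl ih'
  rcases this n with h' | ⟨h', -⟩
  · exact hx.1 (hn.symm.trans h')
  · exact hx.2 (hn.symm.trans h')

end GluePerm

/-! ### Recovering a multicyclically ordered set from a cut -/

namespace MultCyc

section

variable (S : MultCyc.{u}) {u v : S.carrier}

theorem cutArc_eq_of_glue {x : S.carrier} {w : S.carrier} (hw : w = u ∨ w = v)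
    (h : GluePerm.glue S.next u v x = w) :
    S.cutArc u v (Sum.inl w) = S.cutArc u v (Sum.inl x) := by
  subst h
  rw [cutArc_glue_inv S u v hw]
  simp

/-- The cycle of `u` contains the surviving point `x`, so going back from `u` one meets a surviving
point at once or after passing `v`; the arc of `u` begins there, hence this point is `x`. -/
theorem glue_of_cutArc_left (huv : u ≠ v) {x : Without u v}
    (h : S.cutArc u v (Sum.inl u) = Sum.inl x) :
    GluePerm.glue S.next u v x.1 = u ∨
      (GluePerm.glue S.next u v v = u ∧ GluePerm.glue S.next u v x.1 = v) := by
  set φ := GluePerm.glue S.next u v with hφ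
  have hsc : φ.SameCycle u x.1 := by
    rw [hφ, ← arcPart_cutArc_inl_eq_iff, h, cutArc_of_ne S u v x]
  have hn1 : φ u ≠ u := fun h' => GluePerm.not_sameCycle_of_closed x.2 (Or.inl h') hsc
  have hn2 : ¬ (φ u = v ∧ φ v = u) :=
    fun h' => GluePerm.not_sameCycle_of_closed x.2 (Or.inr h') hsc
  have key : ∀ y, y ≠ u → y ≠ v → S.cutArc u v (Sum.inl u) = S.cutArc u v (Sum.inl y) →
      y = x.1 := by
    intro y hyu hyv hy
    rw [h, cutArc_of_ne S u v ⟨y, hyu, hyv⟩] at hy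
    exact congrArg Subtype.val (Sum.inl_injective hy).symm
  obtain ⟨y, hy⟩ := φ.surjective u
  have e1 := S.cutArc_eq_of_glue (Or.inl rfl) hy
  have hyu : y ≠ u := fun h' => hn1 (by rw [← h', hy, h'])
  by_cases hyv : y = v
  · rw [hyv] at hy e1
    obtain ⟨z, hz⟩ := φ.surjective v
    have e2 := S.cutArc_eq_of_glue (Or.inr rfl) hz
    have hzu : z ≠ u := fun h' => hn2 ⟨h' ▸ hz, hy⟩
    have hzv : z ≠ v := fun h' => huv (hy.symm.trans (h' ▸ hz))
    rw [← key z hzu hzv (e1.trans e2)]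
    exact Or.inr ⟨hy, hz⟩
  · rw [← key y hyu hyv e1]
    exact Or.inl hy

theorem glue_of_cutArc_right (huv : u ≠ v) {x : Without u v}
    (h : S.cutArc u v (Sum.inl v) = Sum.inl x) :
    GluePerm.glue S.next u v x.1 = v ∨
      (GluePerm.glue S.next u v u = v ∧ GluePerm.glue S.next u v x.1 = u) := by
  obtain ⟨θ, hθ⟩ := S.exists_cut_swap_iso v u
  have hx := S.cutArc_of_ne u v x
  have h' := S.glue_of_cutArc_left huv.symm (x := ⟨x.1, x.2.2, x.2.1⟩) (by
    rw [← hθ, h, ← hx, hθ]; exact S.cutArc_of_ne v u ⟨x.1, x.2.2, x.2.1⟩)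
  rwa [GluePerm.glue_comm] at h'

end

/-- If two elements of `S` whose circles have been glued at `u` and `v` can be recovered from the
arcs of the cut that contain them, then so can `S`. -/
theorem exists_iso_of_cut_iso {S S' : MultCyc.{u}} {u v : S.carrier} {u' v' : S'.carrier}
    (huv : u ≠ v) (huv' : u' ≠ v') (τ : Iso (S.cut u v) (S'.cut u' v'))
    (hu : τ.onArc (S.cutArc u v (Sum.inl u)) = S'.cutArc u' v' (Sum.inl u'))
    (hv : τ.onArc (S.cutArc u v (Sum.inl v)) = S'.cutArc u' v' (Sum.inl v'))
    (h : S.cutArc u v (Sum.inl u) ≠ S.cutArc u v (Sum.inl v) ∨ (S.next u = u ∧ S'.next u' = u')) :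
    ∃ ρ : Iso S S', ρ.toEquiv u = u' ∧ ρ.toEquiv v = v' ∧
      ∀ α, τ.onArc (S.cutArc u v α) = S'.cutArc u' v' (ρ.onArc α) := by
  -- The required bijection is `τ` on surviving elements, extended by `u ↦ u'` and `v ↦ v'`. Its
  -- compatibility with successors is proved for the glued permutations.
  let te : Without u v ≃ Without u' v' := τ.toEquiv
  obtain ⟨e, eu, ev, ex⟩ := exists_equiv_extending huv huv' te
  set φ := GluePerm.glue S.next u v with hφ
  set φ' := GluePerm.glue S'.next u' v' with hφ'
  have hval : ∀ (x : S.carrier) (hx : x ≠ u ∧ x ≠ v), (te ⟨x, hx⟩).1 = e x :=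
    fun x hx => (ex ⟨x, hx⟩).symm
  have tinl : ∀ z : Without u v, τ.onArc (Sum.inl z) = Sum.inl (te z) := fun z => rfl
  have tiff : ∀ (α : (S.cut u v).Arc) (z : Without u v),
      α = Sum.inl z ↔ τ.onArc α = Sum.inl (te z) := fun α z =>
    (τ.onArc_injective.eq_iff (b := Sum.inl z)).symm
  have hr : ∀ (x : Without u v) (y : Without u' v'), e x.1 = y.1 →
      e (GluePerm.firstReturn φ u v x).1 = (GluePerm.firstReturn φ' u' v' y).1 := by
    intro x y hxy
    have hy : te x = y := Subtype.ext ((hval x.1 x.2).trans hxy)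
    have := congrArg Subtype.val (τ.next_apply x)
    rw [ex]
    subst hy
    exact this.symm
  -- Only the order of `u` and `v` on a common arc could be ambiguous. If `u` is fixed by `next`,
  -- then `v` follows `u` after gluing, so `v` cannot stand between `x` and `u`.
  have hleft : ∀ {S : MultCyc.{u}} {u v : S.carrier}, u ≠ v →
      (S.cutArc u v (Sum.inl u) ≠ S.cutArc u v (Sum.inl v) ∨ S.next u = u) →
      ∀ x : Without u v, GluePerm.glue S.next u v x.1 = u ↔
        S.cutArc u v (Sum.inl u) = Sum.inl x := by
    intro S u v huv h x
    refine ⟨fun hx => (S.cutArc_eq_of_glue (Or.inl rfl) hx).trans (S.cutArc_of_ne u v x),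
      fun hx => ?_⟩
    rcases S.glue_of_cutArc_left huv hx with h1 | ⟨h1, h2⟩
    · exact h1
    rcases h with h | h
    · exact absurd (S.cutArc_eq_of_glue (Or.inl rfl) h1) h
    · exact absurd ((GluePerm.glue S.next u v).injective
        (h2.trans (GluePerm.glue_apply_left _ h).symm)) x.2.1
  have hright : ∀ {S : MultCyc.{u}} {u v : S.carrier}, u ≠ v →
      (S.cutArc u v (Sum.inl u) ≠ S.cutArc u v (Sum.inl v)) →
      ∀ x : Without u v, GluePerm.glue S.next u v x.1 = v ↔
        S.cutArc u v (Sum.inl v) = Sum.inl x := by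
    intro S u v huv h x
    refine ⟨fun hx => (S.cutArc_eq_of_glue (Or.inr rfl) hx).trans (S.cutArc_of_ne u v x),
      fun hx => ?_⟩
    rcases S.glue_of_cutArc_right huv hx with h1 | ⟨h1, h2⟩
    · exact h1
    · exact absurd (S.cutArc_eq_of_glue (Or.inr rfl) h1).symm h
  have h' : S'.cutArc u' v' (Sum.inl u') ≠ S'.cutArc u' v' (Sum.inl v') ∨
      (S.next u = u ∧ S'.next u' = u') := by
    rw [← hu, ← hv, τ.onArc_injective.ne_iff]; exact h
  have hcu : ∀ x, x ≠ u → x ≠ v → (φ x = u ↔ φ' (e x) = u') := by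
    intro x hxu hxv
    rw [← hval x ⟨hxu, hxv⟩, hleft huv (h.imp_right And.left) ⟨x, hxu, hxv⟩, tiff, hu]
    exact (hleft huv' (h'.imp_right And.right) _).symm
  have hconj : ∀ x, e (φ x) = φ' (e x) := by
    by_cases hne : S.cutArc u v (Sum.inl u) = S.cutArc u v (Sum.inl v)
    · have hne' : S'.cutArc u' v' (Sum.inl u') = S'.cutArc u' v' (Sum.inl v') := by
        rw [← hu, ← hv, hne]
      obtain ⟨h1, h2⟩ := h.resolve_left (not_not.2 hne)
      have f1 : φ u = v := GluePerm.glue_apply_left _ h1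
      have f2 : φ' u' = v' := GluePerm.glue_apply_left _ h2
      -- With `u` and `v` on one arc, it remains to detect whether they fill a whole circle: this
      -- happens exactly when their arc begins at no surviving element.
      have circ : ∀ {S : MultCyc.{u}} {u v : S.carrier}, u ≠ v → S.next u = u →
          (GluePerm.glue S.next u v v = u ↔ ∀ x, S.cutArc u v (Sum.inl u) ≠ Sum.inl x) := by
        intro S u v huv h
        have f := GluePerm.glue_apply_left S.next (v := v) h
        constructor
        · intro hv x hx
          have := (hleft huv (Or.inr h) x).2 hx
          exact x.2.2 ((GluePerm.glue S.next u v).injective (this.trans hv.symm))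
        · intro hx
          obtain ⟨y, hy⟩ := (GluePerm.glue S.next u v).surjective u
          by_cases hyu : y = u
          · rw [hyu, f] at hy; exact absurd hy.symm huv
          by_cases hyv : y = v
          · rwa [hyv] at hy
          · exact absurd ((hleft huv (Or.inr h) ⟨y, hyu, hyv⟩).1 hy) (hx _)
      refine GluePerm.conj_of_firstReturn φ φ' e eu ev huv hr hcu ?_ (iff_of_true f1 f2) ?_
      · intro x hxu hxv
        refine iff_of_false (fun hx => hxu (φ.injective (hx.trans f1.symm))) fun hx => hxu ?_
        exact e.injective ((φ'.injective (hx.trans f2.symm)).trans eu.symm)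
      · rw [circ huv h1, circ huv' h2, ← hu]
        constructor
        · intro hx x
          obtain ⟨y, rfl⟩ := te.surjective x
          exact fun hy => hx y ((tiff _ y).2 hy)
        · intro hx x
          exact fun hy => hx _ ((tiff _ x).1 hy)
    · have hne' : S'.cutArc u' v' (Sum.inl u') ≠ S'.cutArc u' v' (Sum.inl v') := by
        rwa [← hu, ← hv, τ.onArc_injective.ne_iff]
      refine GluePerm.conj_of_firstReturn φ φ' e eu ev huv hr hcu ?_ ?_ ?_
      · intro x hxu hxv
        rw [← hval x ⟨hxu, hxv⟩, hright huv hne ⟨x, hxu, hxv⟩, tiff, hv]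
        exact (hright huv' hne' _).symm
      · exact iff_of_false (fun hx => hne (S.cutArc_eq_of_glue (Or.inr rfl) hx).symm)
          fun hx => hne' (S'.cutArc_eq_of_glue (Or.inr rfl) hx).symm
      · exact iff_of_false (fun hx => hne (S.cutArc_eq_of_glue (Or.inl rfl) hx))
          fun hx => hne' (S'.cutArc_eq_of_glue (Or.inl rfl) hx)
  -- Gluing twice at the same points is the identity, so conjugacy of the glued permutations passes
  -- to the original ones.
  have hnext : ∀ x, S'.next (e x) = e (S.next x) := by
    intro x
    rw [← GluePerm.glue_glue S.next u v, ← GluePerm.glue_glue S'.next u' v', ← hφ, ← hφ']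
    have i : ∀ a b, e a = e b ↔ a = b := fun a b => e.injective.eq_iff
    have c := hconj x
    rcases GluePerm.glue_apply φ u v x with ⟨a, b⟩ | ⟨a, b⟩ | ⟨a, a', b⟩
    · rw [b, ev, GluePerm.glue_apply_left]; rw [← c, a, eu]
    · rw [b, eu, GluePerm.glue_apply_right]; rw [← c, a, ev]
    · rw [b, c, GluePerm.glue_apply_of_ne]
      · rw [← c, ← eu, ne_eq, i]; exact a
      · rw [← c, ← ev, ne_eq, i]; exact a'
  -- An empty part of a cut is either an old empty part or a circle that carried only removed
  -- points. The latter are arcs of `u` or `v`, which `τ` matches, so `τ` also matches the old empty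
  -- parts.
  have tcirc : ∀ {S S' : MultCyc.{u}} {u v : S.carrier} {u' v' : S'.carrier}
      (τ : Iso (S.cut u v) (S'.cut u' v')),
      τ.onArc (S.cutArc u v (Sum.inl u)) = S'.cutArc u' v' (Sum.inl u') →
      τ.onArc (S.cutArc u v (Sum.inl v)) = S'.cutArc u' v' (Sum.inl v') →
      ∀ i : S.EmptyPart, ∃ j : S'.EmptyPart,
        τ.onArc (S.cutArc u v (Sum.inr i)) = S'.cutArc u' v' (Sum.inr j) := by
    intro S S' u v u' v' τ hu hv i
    have hno : ∀ x, S.cutArc u v (Sum.inr i) ≠ S.cutArc u v (Sum.inl x) := fun x hx =>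
      arcPart_cutArc_inl_ne_inr S u v x i (congrArg _ hx.symm)
    obtain ⟨α, hα⟩ := S'.cutArc_surjective u' v' (τ.onArc (S.cutArc u v (Sum.inr i)))
    rcases α with x | j
    · by_cases hxu : x = u'
      · rw [hxu, ← hu] at hα
        exact absurd (τ.onArc_injective hα).symm (hno u)
      by_cases hxv : x = v'
      · rw [hxv, ← hv] at hα
        exact absurd (τ.onArc_injective hα).symm (hno v)
      rw [cutArc_of_ne S' u' v' ⟨x, hxu, hxv⟩] at hα
      cases hα
    · exact ⟨j, hα.symm⟩
  choose j hj using tcirc τ hu hv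
  choose i hi using tcirc τ.symm (by rw [← hu, τ.symm_onArc_onArc])
    (by rw [← hv, τ.symm_onArc_onArc])
  have hij : ∀ k, j (i k) = k := fun k => arcPart_cutArc_inr_injective S' u' v' (congrArg _ (by
    rw [← hj, ← hi, τ.onArc_symm_onArc]))
  have hji : ∀ k, i (j k) = k := fun k => arcPart_cutArc_inr_injective S u v (congrArg _ (by
    rw [← hi, ← hj, τ.symm_onArc_onArc]))
  obtain ⟨ρ, hρ, hρ'⟩ := exists_iso_of_arc (S := S) (T := S') (p := fun α : S.Arc => α)
    (q := Sum.map e j) e (fun α => ⟨α, rfl⟩)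
    (Function.Surjective.sumMap e.surjective fun k => ⟨i k, hij k⟩)
    ⟨_, fun _ => rfl⟩ ⟨Sum.map e.symm i, by rintro (x | k) <;> simp [hji]⟩
    (fun x => ⟨_, rfl, rfl⟩) (fun x => ⟨_, rfl, congrArg Sum.inl (by
      rw [Equiv.Perm.eq_inv_iff_eq, hnext]; simp)⟩)
  refine ⟨ρ, by rw [hρ, eu], by rw [hρ, ev], ?_⟩
  rintro (x | k)
  · rw [hρ']
    by_cases hxu : x = u
    · rw [hxu, hu, Sum.map_inl, eu]
    by_cases hxv : x = v
    · rw [hxv, hv, Sum.map_inl, ev]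
    rw [cutArc_of_ne S u v ⟨x, hxu, hxv⟩, Sum.map_inl, ← hval x ⟨hxu, hxv⟩,
      cutArc_of_ne S' u' v']
    exact tinl _
  · rw [hρ', Sum.map_inr, hj]

end MultCyc

/-! ### Undoing a cut -/

namespace MultCyc

/-- The multicyclically ordered set whose parts are the cycles of a permutation, and additional
empty parts. -/
def ofPerm {α ι : Type u} [Finite α] [Finite ι] [Nonempty α] (σ : Equiv.Perm α) : MultCyc.{u} where
  carrier := α
  index := ι ⊕ GluePerm.Cycles σ
  part x := Sum.inr (Quotient.mk _ x)
  next := σ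
  finite_carrier := inferInstance
  finite_index := inferInstance
  nonempty_index := ⟨Sum.inr (Quotient.mk _ (Classical.arbitrary α))⟩
  part_eq_iff x y := by rw [Sum.inr.injEq, GluePerm.mk_eq_iff]

theorem ofPerm_arc_cases {α ι : Type u} [Finite α] [Finite ι] [Nonempty α] (σ : Equiv.Perm α)
    (a : (ofPerm (ι := ι) σ).Arc) :
    (∃ x : α, a = Sum.inl x) ∨ ∃ i : ι, ∃ h, a = Sum.inr ⟨Sum.inl i, h⟩ := by
  rcases a with x | ⟨i | q, h⟩
  · exact Or.inl ⟨x, rfl⟩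
  · exact Or.inr ⟨i, h, rfl⟩
  · induction q using Quotient.inductionOn with | _ x => ?_
    exact (h x rfl).elim

open scoped Classical in
/-- The permutation of `S` and two additional elements obtained by inserting the first of these into
the arc `γ`, and the second one into the arc `δ`, behind the first one if `γ = δ`. -/
noncomputable def insertPerm (S : MultCyc.{u}) (γ δ : S.Arc) :
    Equiv.Perm (Option (Option S.carrier)) :=
  S.next.optionCongr.optionCongr *
    (match γ with
      | Sum.inl x => Equiv.swap (some (some x)) none
      | Sum.inr _ => 1) *
    (match δ with
      | Sum.inl x => Equiv.swap (some (some x)) (some none)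
      -- An empty circle that receives one additional element becomes a fixed point; one that
      -- receives both becomes a two-cycle.
      | Sum.inr i => if γ = Sum.inr i then Equiv.swap none (some none) else 1)

/-- The arc of `S` beginning at an element of `S`, or containing an additional element. -/
def insertStart (S : MultCyc.{u}) (γ δ : S.Arc) : Option (Option S.carrier) → S.Arc
  | none => γ
  | some none => δ
  | some (some x) => Sum.inl x

/-- The arc of `S` ending at an element of `S`, or containing an additional element. -/
def insertEnd (S : MultCyc.{u}) (γ δ : S.Arc) : Option (Option S.carrier) → S.Arc
  | none => γ
  | some none => δ
  | some (some x) => S.endArc x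

/-- The inserted points subdivide arcs without changing which old arc one is on: each step of the
permutation follows a single arc of `S`. In `exists_uncut` this yields the gluing relations. -/
theorem insertEnd_insertPerm (S : MultCyc.{u}) (γ δ : S.Arc) (z : Option (Option S.carrier)) :
    S.insertEnd γ δ (S.insertPerm γ δ z) = S.insertStart γ δ z := by
  rcases γ with x | i <;> rcases δ with y | j
  · by_cases hxy : x = y
    · subst hxy
      rcases z with _ | _ | z
      · simp [insertPerm, insertEnd, insertStart, endArc, Equiv.swap_apply_def]
      · simp [insertPerm, insertEnd, insertStart]
      · by_cases hz : z = x <;>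
          simp [insertPerm, insertEnd, insertStart, endArc, Equiv.swap_apply_def, hz]
    · rcases z with _ | _ | z
      · simp [insertPerm, insertEnd, insertStart, endArc, Equiv.swap_apply_def]
      · simp [insertPerm, insertEnd, insertStart, endArc, Equiv.swap_apply_def, Ne.symm hxy]
      · by_cases hz : z = x
        · simp [insertPerm, insertEnd, insertStart, Equiv.swap_apply_def, hz, hxy]
        by_cases hz' : z = y <;>
          simp [insertPerm, insertEnd, insertStart, endArc, Equiv.swap_apply_def, hz, hz']
  · rcases z with _ | _ | z
    · simp [insertPerm, insertEnd, insertStart, endArc]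
    · simp [insertPerm, insertEnd, insertStart, Equiv.swap_apply_def]
    · by_cases hz : z = x <;>
        simp [insertPerm, insertEnd, insertStart, endArc, Equiv.swap_apply_def, hz]
  · rcases z with _ | _ | z
    · simp [insertPerm, insertEnd, insertStart, Equiv.swap_apply_def]
    · simp [insertPerm, insertEnd, insertStart, endArc]
    · by_cases hz : z = y <;>
        simp [insertPerm, insertEnd, insertStart, endArc, Equiv.swap_apply_def, hz]
  · by_cases hij : i = j
    · subst hij
      rcases z with _ | _ | z <;>
        simp [insertPerm, insertEnd, insertStart, endArc, Equiv.swap_apply_def]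
    · rcases z with _ | _ | z <;>
        simp [insertPerm, insertEnd, insertStart, endArc, hij]

theorem insertPerm_of_left (S : MultCyc.{u}) (x : S.carrier) (δ : S.Arc) :
    S.insertPerm (Sum.inl x) δ (some (some x)) = none ∨
      (S.insertPerm (Sum.inl x) δ (some (some x)) = some none ∧
        S.insertPerm (Sum.inl x) δ (some none) = none) := by
  rcases δ with y | j
  · by_cases hxy : x = y <;> simp [insertPerm, Equiv.swap_apply_def, hxy]
  · simp [insertPerm]

theorem insertPerm_of_right (S : MultCyc.{u}) (γ : S.Arc) (x : S.carrier) :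
    S.insertPerm γ (Sum.inl x) (some (some x)) = some none := by
  rcases γ with y | j <;> simp [insertPerm, Equiv.swap_apply_def]

theorem insertPerm_of_circle (S : MultCyc.{u}) (i : S.EmptyPart) :
    S.insertPerm (Sum.inr i) (Sum.inr i) none = some none := by
  simp [insertPerm]

/-- Every multicyclically ordered set is a cut, with the arcs at the two points prescribed. -/
theorem exists_uncut (S : MultCyc.{u}) (γ δ : S.Arc) :
    ∃ (T : MultCyc.{u}) (c d : T.carrier) (κ : Iso (T.cut c d) S), c ≠ d ∧
      κ.onArc (T.cutArc c d (Sum.inl c)) = γ ∧ κ.onArc (T.cutArc c d (Sum.inl d)) = δ := by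
  classical
  -- Only the empty parts that receive no point stay empty; the others become cycles of the inserted
  -- points.
  let ι : Type u := {i : S.EmptyPart // Sum.inr i ≠ γ ∧ Sum.inr i ≠ δ}
  let c : Option (Option S.carrier) := none
  let d : Option (Option S.carrier) := some none
  set φ := S.insertPerm γ δ with hφ
  -- Gluing is an involution, so the glued permutation of this `T` at `c`, `d` is `φ`, and removing
  -- the two points leaves the cyclic orders of `S`.
  let T : MultCyc.{u} := ofPerm (ι := ι) (GluePerm.glue φ c d)
  have hT : GluePerm.glue T.next c d = φ := GluePerm.glue_glue _ _ _
  let p : T.Arc → S.Arc := fun a => match a with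
    | Sum.inl x => S.insertStart γ δ x
    | Sum.inr ⟨Sum.inl i, _⟩ => Sum.inr i.1
    | Sum.inr ⟨Sum.inr q, h⟩ => (Quotient.inductionOn (motive := fun q => (∀ x, T.part x ≠ Sum.inr q) →
        False) q (fun x h => h x rfl) h).elim
  have pinl : ∀ x : Option (Option S.carrier), p (Sum.inl x) = S.insertStart γ δ x := fun x => rfl
  have pend : ∀ y, S.insertStart γ δ (φ⁻¹ y) = S.insertEnd γ δ y := fun y => by
    rw [← insertEnd_insertPerm, ← hφ]; simp
  have endc : T.endArc c = Sum.inl (φ⁻¹ d) := by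
    have := GluePerm.glue_inv_right T.next c d
    rw [hT] at this
    exact congrArg Sum.inl this.symm
  have endd : T.endArc d = Sum.inl (φ⁻¹ c) := by
    have := GluePerm.glue_inv_left T.next c d
    rw [hT] at this
    exact congrArg Sum.inl this.symm
  have endx : ∀ x : Option (Option S.carrier), x ≠ c → x ≠ d → T.endArc x = Sum.inl (φ⁻¹ x) := by
    intro x hc hd
    have := GluePerm.glue_inv_of_ne T.next (u := c) (v := d) hc hd
    rw [hT] at this
    exact congrArg Sum.inl this.symm
  have back : ∀ {x w : Option (Option S.carrier)}, (w = c ∨ w = d) → φ x = w →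
      T.cutArc c d (Sum.inl w) = T.cutArc c d (Sum.inl x) := by
    intro x w hw h
    refine T.cutArc_eq_of_glue hw ?_
    rw [hT]; exact h
  have hps : Function.Surjective p := by
    rintro (x | i)
    · exact ⟨Sum.inl (some (some x)), rfl⟩
    · by_cases h1 : Sum.inr i = γ
      · exact ⟨Sum.inl c, h1.symm⟩
      by_cases h2 : Sum.inr i = δ
      · exact ⟨Sum.inl d, h2.symm⟩
      exact ⟨Sum.inr ⟨Sum.inl ⟨i, h1, h2⟩, fun x hx => by cases hx⟩, rfl⟩
  have hf := T.cutArc_lift c d p (by rw [endd, pinl, pinl, pend]; rfl)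
    (by rw [endc, pinl, pinl, pend]; rfl)
  let g : S.Arc → (T.cut c d).Arc := fun a => match a with
    | Sum.inl x => T.cutArc c d (Sum.inl (some (some x)))
    | Sum.inr i => if h1 : Sum.inr i = γ then T.cutArc c d (Sum.inl c) else
        if h2 : Sum.inr i = δ then T.cutArc c d (Sum.inl d) else
        T.cutArc c d (Sum.inr ⟨Sum.inl ⟨i, h1, h2⟩, fun x hx => by cases hx⟩)
  have gγ : g γ = T.cutArc c d (Sum.inl c) := by
    rcases γ with x | i
    · rcases S.insertPerm_of_left x δ with h | ⟨h, h'⟩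
      · exact (back (Or.inl rfl) h).symm
      · exact ((back (Or.inl rfl) h').trans (back (Or.inr rfl) h)).symm
    · simp only [g, dif_pos]
  have gδ : g δ = T.cutArc c d (Sum.inl d) := by
    rcases δ with x | i
    · exact (back (Or.inr rfl) (S.insertPerm_of_right γ x)).symm
    · by_cases h : Sum.inr i = γ
      · subst h
        rw [gγ]
        exact (back (Or.inr rfl) (S.insertPerm_of_circle i)).symm
      · simp only [g, dif_neg h, dif_pos]
  have hg : ∃ g : S.Arc → (T.cut c d).Arc, ∀ a, g (p a) = T.cutArc c d a := by
    refine ⟨g, fun a => ?_⟩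
    rcases ofPerm_arc_cases _ a with ⟨x, rfl⟩ | ⟨i, hi, rfl⟩
    · rcases x with _ | _ | x
      · exact gγ
      · exact gδ
      · rfl
    · obtain ⟨i, h1, h2⟩ := i
      simp only [g, p, dif_neg h1, dif_neg h2]
  let e : Without c d ≃ S.carrier := withoutOption S.carrier
  obtain ⟨κ, -, hκ⟩ := exists_iso_of_arc (S := T.cut c d) (T := S) (p := T.cutArc c d) (q := p) e
    (T.cutArc_surjective c d) hps hf hg
    (by
      intro x
      obtain ⟨y, rfl⟩ := e.symm.surjective x
      exact ⟨Sum.inl (some (some y)), T.cutArc_of_ne c d (e.symm y), rfl⟩)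
    (by
      intro x
      obtain ⟨y, rfl⟩ := e.symm.surjective x
      exact ⟨T.endArc (some (some y)), (T.endArc_cut c d (e.symm y)).symm,
        (congrArg p (endx _ (e.symm y).2.1 (e.symm y).2.2)).trans (pend _)⟩)
  exact ⟨T, c, d, κ, (Option.some_ne_none none).symm, hκ _, hκ _⟩

/-! ### Splitting off a part -/

/-- A part of a multicyclically ordered set, as a cyclically ordered set. -/
def partSet (S : MultCyc.{u}) (i : S.index) : CycSet.{u} where
  val :=
    { carrier := {x : S.carrier // S.part x = i}
      index := PUnit
      part := fun _ => PUnit.unit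
      next := S.next.subtypePerm fun x => by rw [S.part_next]
      finite_carrier := inferInstance
      finite_index := inferInstance
      nonempty_index := inferInstance
      part_eq_iff := fun x y => by
        refine iff_of_true rfl ?_
        rw [Equiv.Perm.sameCycle_subtypePerm, ← S.part_eq_iff, x.2, y.2] }
  property := show Subsingleton PUnit from inferInstance

/-- A multicyclically ordered set with exactly two parts is the disjoint union of these. -/
theorem exists_union_iso (S : MultCyc.{u}) {i j : S.index} (hij : i ≠ j)
    (h : ∀ k, k = i ∨ k = j) :
    ∃ ρ : Iso ((S.partSet i).1.disjointUnion (S.partSet j).1) S,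
      (∀ x, ρ.toEquiv (Sum.inl x) = x.1) ∧ ∀ x, ρ.toEquiv (Sum.inr x) = x.1 := by
  let f : {x : S.carrier // S.part x = i} ⊕ {x : S.carrier // S.part x = j} → S.carrier :=
    Sum.elim Subtype.val Subtype.val
  have hf : Function.Bijective f := by
    constructor
    · rintro (⟨x, hx⟩ | ⟨x, hx⟩) (⟨y, hy⟩ | ⟨y, hy⟩) hxy <;> change x = y at hxy <;> subst hxy
      · rfl
      · exact (hij (hx.symm.trans hy)).elim
      · exact (hij (hy.symm.trans hx)).elim
      · rfl
    · intro x
      rcases h (S.part x) with hx | hx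
      · exact ⟨Sum.inl ⟨x, hx⟩, rfl⟩
      · exact ⟨Sum.inr ⟨x, hx⟩, rfl⟩
  let k : PUnit.{u + 1} ⊕ PUnit.{u + 1} → S.index := Sum.elim (fun _ => i) fun _ => j
  have hk : Function.Bijective k := by
    constructor
    · rintro (x | x) (y | y) hxy
      · rfl
      · exact (hij hxy).elim
      · exact (hij hxy.symm).elim
      · rfl
    · intro x
      rcases h x with hx | hx
      · exact ⟨Sum.inl PUnit.unit, hx.symm⟩
      · exact ⟨Sum.inr PUnit.unit, hx.symm⟩
  exact ⟨{ toEquiv := Equiv.ofBijective f hf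
           indexEquiv := Equiv.ofBijective k hk
           part_apply := Sum.rec (fun x => x.2) fun x => x.2
           next_apply := Sum.rec (fun x => rfl) fun x => rfl }, fun _ => rfl, fun _ => rfl⟩

end MultCyc

namespace MultCyc

/-! ### Parts and cuts -/

theorem part_eq_of_arcPart_cutArc_ne (S : MultCyc.{u}) {u v : S.carrier}
    (h : (S.cut u v).arcPart (S.cutArc u v (Sum.inl u)) ≠
      (S.cut u v).arcPart (S.cutArc u v (Sum.inl v))) : S.part u = S.part v := by
  rw [ne_eq, arcPart_cutArc_inl_eq_iff] at h
  rw [S.part_eq_iff]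
  by_contra h'
  exact h (GluePerm.sameCycle_glue h')

theorem arcPart_cutArc_ne_of_part_eq (S : MultCyc.{u}) {u v : S.carrier} (huv : u ≠ v)
    (h : S.part u = S.part v) : (S.cut u v).arcPart (S.cutArc u v (Sum.inl u)) ≠
      (S.cut u v).arcPart (S.cutArc u v (Sum.inl v)) := by
  rw [ne_eq, arcPart_cutArc_inl_eq_iff]
  exact GluePerm.not_sameCycle_glue huv ((S.part_eq_iff _ _).1 h)

/-- Arcs of the same part lie in the same part after a cut, or in one of the parts that contain the
two points that have been removed. -/
theorem arcPart_cutArc_cases (S : MultCyc.{u}) (u v : S.carrier) {α β : S.Arc}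
    (h : S.arcPart α = S.arcPart β) :
    (S.cut u v).arcPart (S.cutArc u v α) = (S.cut u v).arcPart (S.cutArc u v β) ∨
    (((S.cut u v).arcPart (S.cutArc u v α) = (S.cut u v).arcPart (S.cutArc u v (Sum.inl u)) ∨
      (S.cut u v).arcPart (S.cutArc u v α) = (S.cut u v).arcPart (S.cutArc u v (Sum.inl v))) ∧
    ((S.cut u v).arcPart (S.cutArc u v β) = (S.cut u v).arcPart (S.cutArc u v (Sum.inl u)) ∨
      (S.cut u v).arcPart (S.cutArc u v β) = (S.cut u v).arcPart (S.cutArc u v (Sum.inl v)))) := by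
  rcases α with x | i <;> rcases β with y | j
  · have hs := (S.part_eq_iff x y).1 h
    rw [← GluePerm.glue_glue S.next u v] at hs
    simp only [arcPart_cutArc_inl_eq_iff]
    rcases GluePerm.sameCycle_glue_cases hs with h1 | ⟨h1, h2⟩
    · exact Or.inl h1
    · exact Or.inr ⟨h1.imp (fun h => h.symm) fun h => h.symm,
        h2.imp (fun h => h.symm) fun h => h.symm⟩
  · exact (j.2 x h).elim
  · exact (i.2 y h.symm).elim
  · rw [show i = j from Subtype.ext h]
    exact Or.inl rfl

/-- Two removed points on one arc of the cut are adjacent on the glued circle. If one is followed by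
the other there, undoing the gluing makes the former a part by itself. -/
theorem next_eq_self_of_cutArc_eq (S : MultCyc.{u}) {u v : S.carrier} (huv : u ≠ v)
    (h : S.cutArc u v (Sum.inl u) = S.cutArc u v (Sum.inl v)) : S.next u = u ∨ S.next v = v := by
  set φ := GluePerm.glue S.next u v with hφ
  have key : φ u = v ∨ φ v = u → S.next u = u ∨ S.next v = v := by
    rw [← GluePerm.glue_glue S.next u v, ← hφ]
    exact Or.imp (GluePerm.glue_apply_right φ) (GluePerm.glue_apply_left φ)
  apply key
  obtain ⟨y, hy⟩ := φ.surjective u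
  by_cases hyv : y = v
  · rw [hyv] at hy; exact Or.inr hy
  by_cases hyu : y = u
  · rw [hyu] at hy
    have hs := (arcPart_cutArc_inl_eq_iff S u v u v).1 (congrArg _ h)
    exact absurd (hs.eq_of_left hy) huv
  have h1 := (S.cutArc_eq_of_glue (Or.inl rfl) hy).trans (S.cutArc_of_ne u v ⟨y, hyu, hyv⟩)
  rcases S.glue_of_cutArc_right huv (h.symm.trans h1) with h2 | ⟨h2, -⟩
  · exact absurd (hy.symm.trans h2) huv
  · exact Or.inl h2

/-- In `g + 1 = b + 2G`, undoing a cut within one part lowers `b` and keeps `G`. Undoing a cut that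
joined two parts raises `b` and uses up a handle; the bound `Nat.card S.index ≤ g` says that `G ≥
1`. -/
theorem Geometric.uncut {S T : MultCyc.{u}} {g : ℕ} {c d : T.carrier} (hS : S.Geometric (g + 1))
    (κ : Iso (T.cut c d) S) (hcd : c ≠ d) (h : T.part c = T.part d ∨ Nat.card S.index ≤ g) :
    T.Geometric g := by
  obtain ⟨G, hG⟩ := hS
  have e := Nat.card_congr κ.indexEquiv
  by_cases hp : T.part c = T.part d
  · rw [card_index_cut_of_eq T hcd hp] at e
    exact ⟨G, by omega⟩
  · have h1 := card_index_cut_of_ne T hp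
    have h2 := h.resolve_left hp
    exact ⟨G - 1, by omega⟩

theorem Iso.trans_symm_self {S T : MultCyc.{u}} (ρ : Iso S T) : ρ.trans ρ.symm = Iso.refl S :=
  Iso.ext_onArc fun α => by rw [Iso.onArc_trans, ρ.symm_onArc_onArc, Iso.onArc_refl]

end MultCyc

/-! ### Elements obtained by iterated contractions -/

namespace NsModularOperad

open MultCyc

variable {P : NsModularOperad.{u, v}}

theorem map_symm_map {S T : MultCyc.{u}} {g : ℕ} (ρ : Iso S T) (x : P.obj S g) :
    P.map ρ.symm (P.map ρ x) = x := by
  rw [← P.map_trans, Iso.trans_symm_self, P.map_refl]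

/-- The elements obtained from a family `ς` by iterated contractions and isomorphisms. -/
def Reach (ς : ∀ C : CycSet.{u}, P.obj C.1 0) : ∀ (g : ℕ) (S : MultCyc.{u}), P.obj S g → Prop
  | 0, S, x => ∃ hS : S.IsCyc, x = ς ⟨S, hS⟩
  | g + 1, S, x => ∃ (S' : MultCyc.{u}) (a b : S'.carrier) (hab : a ≠ b) (ρ : Iso (S'.cut a b) S)
      (y : P.obj S' g), Reach ς g S' y ∧ x = P.map ρ (P.contr a b hab y)

section Reach

variable {ς : ∀ C : CycSet.{u}, P.obj C.1 0}

theorem Reach.map (hς : (forget.obj P).IsInternal ς) {g : ℕ} {S T : MultCyc.{u}} {x : P.obj S g}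
    (h : Reach ς g S x) (ρ : Iso S T) : Reach ς g T (P.map ρ x) := by
  cases g with
  | zero =>
    obtain ⟨hS, rfl⟩ := h
    have hT : T.IsCyc := @Function.Injective.subsingleton _ _ _ ρ.indexEquiv.symm.injective hS
    exact ⟨hT, hς.map (C := ⟨S, hS⟩) (D := ⟨T, hT⟩) ρ⟩
  | succ g =>
    obtain ⟨S', a, b, hab, τ, y, hy, rfl⟩ := h
    exact ⟨S', a, b, hab, τ.trans ρ, y, hy, (P.map_trans _ _ _).symm⟩

theorem Reach.contr {g : ℕ} {S : MultCyc.{u}} {x : P.obj S g} (h : Reach ς g S x) {a b : S.carrier}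
    (hab : a ≠ b) : Reach ς (g + 1) (S.cut a b) (P.contr a b hab x) :=
  ⟨S, a, b, hab, Iso.refl _, x, h, (P.map_refl _).symm⟩

/-- As in the symmetric case, the contractions of the first factor are pulled out of the composition
one by one. -/
theorem Reach.comp_of_zero (hς : (forget.obj P).IsInternal ς) {h : ℕ} {T : MultCyc.{u}}
    {y : P.obj T h}
    (h0 : ∀ (C : CycSet.{u}) (a : C.1.carrier) (b : T.carrier) (k : ℕ) (hk : 0 + h = k),
      Reach ς k (C.1.merge T a b) (P.comp a b hk (ς C) y))
    {g k : ℕ} {S : MultCyc.{u}} {x : P.obj S g} (hx : Reach ς g S x) (a : S.carrier)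
    (b : T.carrier) (hk : g + h = k) : Reach ς k (S.merge T a b) (P.comp a b hk x y) := by
  induction g generalizing S k with
  | zero =>
    obtain ⟨hS, rfl⟩ := hx
    exact h0 ⟨S, hS⟩ a b k hk
  | succ g ih =>
    obtain ⟨S', c, d, hcd, ρ, x, hx, rfl⟩ := hx
    obtain rfl : k = g + h + 1 := by omega
    obtain ⟨⟨a, hac, had⟩, rfl⟩ := ρ.toEquiv.surjective a
    obtain ⟨θ, hl, hr⟩ := exists_merge_iso ρ (Iso.refl T) ⟨a, hac, had⟩ b
    have e := P.map_comp hk ρ (Iso.refl T) ⟨a, hac, had⟩ b (P.contr c d hcd x) y θ hl hr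
    rw [P.map_refl] at e
    have : Reach ς (g + h + 1) _ (P.comp (S := S'.cut c d) ⟨a, hac, had⟩ b hk
        (P.contr c d hcd x) y) := by
      obtain ⟨θ', hl', hr'⟩ := exists_merge_cut_iso S' T b hac had
      have e' := P.comp_contr rfl hk a c d b hac had hcd x y θ' hl' hr'
      rw [← map_symm_map θ' (P.comp _ _ _ _ _), e']
      exact ((ih hx a rfl).contr _).map hς _
    have h2 := this.map hς θ
    rw [e] at h2
    exact h2

theorem Reach.comp (hς : (forget.obj P).IsInternal ς) {g h k : ℕ} {S T : MultCyc.{u}}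
    {x : P.obj S g} {y : P.obj T h} (hx : Reach ς g S x) (hy : Reach ς h T y) (a : S.carrier)
    (b : T.carrier) (hk : g + h = k) : Reach ς k (S.merge T a b) (P.comp a b hk x y) := by
  refine Reach.comp_of_zero hς (fun C a b k hk => ?_) hx a b hk
  obtain ⟨θ, hl, hr⟩ := exists_merge_swap_iso C.1 T a b
  have hk' := (add_comm _ _).trans hk
  rw [← P.comp_symm a b hk hk' _ _ θ hl hr]
  refine Reach.map hς ?_ θ
  refine Reach.comp_of_zero hς (fun D a b k hk => ?_) hy b a hk'
  obtain rfl := hk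
  exact ⟨D.2.merge C.2 a b, hς.comp a b⟩

/-- In genus zero a geometric set has exactly one part. In higher genus a cut is undone: at a single
arc if there is a handle, and otherwise at arcs in two different parts, which then exist. -/
theorem exists_reach (hς : (forget.obj P).IsInternal ς) {g : ℕ} {S : MultCyc.{u}}
    (hS : S.Geometric g) : ∃ x, Reach ς g S x := by
  induction g generalizing S with
  | zero =>
    obtain ⟨G, hG⟩ := hS
    have h0 : 0 < Nat.card S.index := Nat.card_pos
    have h1 : S.IsCyc := (Nat.card_eq_one_iff_unique.1 (by omega : Nat.card S.index = 1)).1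
    exact ⟨ς ⟨S, h1⟩, h1, rfl⟩
  | succ g ih =>
    have key : ∀ γ δ : S.Arc, (S.arcPart γ ≠ S.arcPart δ ∨ Nat.card S.index ≤ g) →
        ∃ x, Reach ς (g + 1) S x := by
      intro γ δ h
      obtain ⟨T, c, d, κ, hcd, rfl, rfl⟩ := S.exists_uncut γ δ
      rw [κ.arcPart_onArc, κ.arcPart_onArc, κ.indexEquiv.injective.ne_iff] at h
      obtain ⟨z, hz⟩ := ih (hS.uncut κ hcd (h.imp_left (part_eq_of_arcPart_cutArc_ne T)))
      exact ⟨_, (hz.contr hcd).map hς κ⟩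
    obtain ⟨G, hG⟩ := hS
    by_cases h : Nat.card S.index ≤ g
    · obtain ⟨γ, -⟩ := S.arcPart_surjective (Classical.arbitrary _)
      exact key γ γ (Or.inr h)
    · have : 1 < Nat.card S.index := by omega
      obtain ⟨i, j, hij⟩ := Finite.one_lt_card_iff_nontrivial.1 this
      obtain ⟨γ, rfl⟩ := S.arcPart_surjective i
      obtain ⟨δ, rfl⟩ := S.arcPart_surjective j
      exact key γ δ (Or.inl hij)

/-- Contractions of reachable elements agree if the two points come from the same arcs. -/
theorem Reach.contr_unique (hς : (forget.obj P).IsInternal ς) {g : ℕ}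
    (hg : ∀ (S : MultCyc.{u}) (x y : P.obj S g), Reach ς g S x → Reach ς g S y → x = y)
    {R S S' : MultCyc.{u}} {a b : S.carrier} {a' b' : S'.carrier} (hab : a ≠ b) (hab' : a' ≠ b')
    (ρ : Iso (S.cut a b) R) (ρ' : Iso (S'.cut a' b') R) {x : P.obj S g} {x' : P.obj S' g}
    (hx : Reach ς g S x) (hx' : Reach ς g S' x')
    (ha : ρ.onArc (S.cutArc a b (Sum.inl a)) = ρ'.onArc (S'.cutArc a' b' (Sum.inl a')))
    (hb : ρ.onArc (S.cutArc a b (Sum.inl b)) = ρ'.onArc (S'.cutArc a' b' (Sum.inl b')))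
    (h : ρ.onArc (S.cutArc a b (Sum.inl a)) ≠ ρ.onArc (S.cutArc a b (Sum.inl b)) ∨
      (S.next a = a ∧ S'.next a' = a')) :
    P.map ρ (P.contr a b hab x) = P.map ρ' (P.contr a' b' hab' x') := by
  rw [ρ.onArc_injective.ne_iff] at h
  obtain ⟨σ, rfl, rfl, hσ⟩ := exists_iso_of_cut_iso hab hab' (ρ.trans ρ'.symm)
    (by rw [Iso.onArc_trans, ha, ρ'.symm_onArc_onArc])
    (by rw [Iso.onArc_trans, hb, ρ'.symm_onArc_onArc]) h
  obtain ⟨θ, hθ⟩ := exists_cut_iso σ a b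
  have e := P.map_contr σ a b hab x θ hθ
  -- By uniqueness in genus `g` the isomorphism `σ`, which matches the removed points, carries `x`
  -- to `x'`.
  rw [hg S' _ _ (hx.map hς σ) hx'] at e
  rw [← e, ← P.map_trans]
  congr 1
  refine Iso.ext_onArc fun α => ?_
  obtain ⟨β, rfl⟩ := S.cutArc_surjective a b α
  rw [Iso.onArc_trans, hθ, ← hσ, Iso.onArc_trans, ρ'.onArc_symm_onArc]

/-- The element `x` is, up to an isomorphism, a contraction of a reachable element, and the two
points of the contraction come from the arcs `α` and `β`. -/
def ReachAt (ς : ∀ C : CycSet.{u}, P.obj C.1 0) (g : ℕ) (S : MultCyc.{u}) (α β : S.Arc)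
    (x : P.obj S (g + 1)) : Prop :=
  ∃ (S' : MultCyc.{u}) (a b : S'.carrier) (hab : a ≠ b) (ρ : Iso (S'.cut a b) S) (y : P.obj S' g),
    Reach ς g S' y ∧ x = P.map ρ (P.contr a b hab y) ∧
      ρ.onArc (S'.cutArc a b (Sum.inl a)) = α ∧ ρ.onArc (S'.cutArc a b (Sum.inl b)) = β

theorem exists_contr_swap {R S : MultCyc.{u}} {a b : S.carrier} (hab : a ≠ b)
    (ρ : Iso (S.cut a b) R) : ∃ ρ' : Iso (S.cut b a) R,
      (∀ α, ρ'.onArc (S.cutArc b a α) = ρ.onArc (S.cutArc a b α)) ∧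
      ∀ (g : ℕ) (x : P.obj S g), P.map ρ (P.contr a b hab x) = P.map ρ' (P.contr b a hab.symm x) := by
  obtain ⟨θ, hθ⟩ := S.exists_cut_swap_iso a b
  exact ⟨θ.trans ρ, fun α => by rw [Iso.onArc_trans, hθ], fun g x => by
    rw [P.map_trans, P.contr_symm a b hab x θ hθ]⟩

theorem ReachAt.symm {g : ℕ} {S : MultCyc.{u}} {α β : S.Arc} {x : P.obj S (g + 1)}
    (h : ReachAt ς g S α β x) : ReachAt ς g S β α x := by
  obtain ⟨S', a, b, hab, ρ, y, hy, rfl, rfl, rfl⟩ := h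
  obtain ⟨ρ', h1, h2⟩ := exists_contr_swap (P := P) hab ρ
  exact ⟨S', b, a, hab.symm, ρ', y, hy, h2 g y, h1 _, h1 _⟩

/-- Distinct arcs determine the uncut set with its two points. On a common arc the order of the
points would be left open. -/
theorem ReachAt.unique (hς : (forget.obj P).IsInternal ς) {g : ℕ}
    (hg : ∀ (S : MultCyc.{u}) (x y : P.obj S g), Reach ς g S x → Reach ς g S y → x = y)
    {S : MultCyc.{u}} {α β : S.Arc} (hαβ : α ≠ β) {x y : P.obj S (g + 1)}
    (hx : ReachAt ς g S α β x) (hy : ReachAt ς g S α β y) : x = y := by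
  obtain ⟨S', a, b, hab, ρ, x, hx, rfl, rfl, rfl⟩ := hx
  obtain ⟨S'', a', b', hab', ρ', y, hy, rfl, h1, h2⟩ := hy
  exact Reach.contr_unique hς hg hab hab' ρ ρ' hx hy h1.symm h2.symm (Or.inl hαβ)

/-- The points of a contraction can be replaced by points on other arcs, if the genus is positive. -/
theorem Reach.reachAt_of_succ (hς : (forget.obj P).IsInternal ς) {g : ℕ}
    (hg : ∀ (S : MultCyc.{u}) (x y : P.obj S (g + 1)),
      Reach ς (g + 1) S x → Reach ς (g + 1) S y → x = y)
    {R S : MultCyc.{u}} {a b : S.carrier} (hab : a ≠ b) (ρ : Iso (S.cut a b) R)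
    {y : P.obj S (g + 1)} (hy : Reach ς (g + 1) S y) (ε ζ : S.Arc)
    (h : S.arcPart ε ≠ S.arcPart ζ ∨ Nat.card S.index ≤ g) :
    ReachAt ς (g + 1) R (ρ.onArc (S.cutArc a b ε)) (ρ.onArc (S.cutArc a b ζ))
      (P.map ρ (P.contr a b hab y)) := by
  obtain ⟨T, c, d, κ, hcd, rfl, rfl⟩ := S.exists_uncut ε ζ
  rw [κ.arcPart_onArc, κ.arcPart_onArc, κ.indexEquiv.injective.ne_iff] at h
  obtain ⟨z, hz⟩ := exists_reach hς
    ((P.geometric y).uncut κ hcd (h.imp_left (part_eq_of_arcPart_cutArc_ne T)))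
  -- By uniqueness in this genus, `y` is itself a contraction, at points `c`, `d` inserted into `ε`
  -- and `ζ`. Commuting it with the contraction at `a`, `b` makes the one at `c`, `d` the last.
  obtain rfl := hg S _ _ ((hz.contr hcd).map hς κ) hy
  obtain ⟨⟨a, hac, had⟩, rfl⟩ := κ.toEquiv.surjective a
  obtain ⟨⟨b, hbc, hbd⟩, rfl⟩ := κ.toEquiv.surjective b
  have hab' : a ≠ b := fun e => hab (by subst e; rfl)
  obtain ⟨θ, hθ⟩ := T.exists_cut_cut_iso hac.symm hbc.symm had.symm hbd.symm
  obtain ⟨θ', hθ'⟩ := exists_cut_iso κ ⟨a, hac, had⟩ ⟨b, hbc, hbd⟩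
  refine ⟨T.cut a b, ⟨c, hac.symm, hbc.symm⟩, ⟨d, had.symm, hbd.symm⟩,
    fun e => hcd (congrArg Subtype.val e), θ.trans (θ'.trans ρ), P.contr a b hab' z,
    hz.contr hab', ?_, ?_, ?_⟩
  · rw [P.map_trans, P.map_trans]
    rw [P.contr_contr c d a b hcd hac.symm hbc.symm had.symm hbd.symm hab' z θ hθ]
    rw [P.map_contr κ ⟨a, hac, had⟩ ⟨b, hbc, hbd⟩ _ (P.contr c d hcd z) θ' hθ']
  · rw [Iso.onArc_trans, Iso.onArc_trans, ← hθ', ← hθ]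
    exact congrArg (fun α => ρ.onArc (θ'.onArc (θ.onArc (cutArc _ _ _ α))))
      (T.cutArc_of_ne a b ⟨c, hac.symm, hbc.symm⟩).symm
  · rw [Iso.onArc_trans, Iso.onArc_trans, ← hθ', ← hθ]
    exact congrArg (fun α => ρ.onArc (θ'.onArc (θ.onArc (cutArc _ _ _ α))))
      (T.cutArc_of_ne a b ⟨d, had.symm, hbd.symm⟩).symm

end Reach

end NsModularOperad

/-! ### Changing the arcs of a contraction, and uniqueness -/

namespace NsModularOperad

open MultCyc

variable {P : NsModularOperad.{u, v}} {ς : ∀ C : CycSet.{u}, P.obj C.1 0}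

/-- In genus zero, a contraction of a composition can be replaced by another one. -/
theorem Reach.reachAt_of_union (hς : (forget.obj P).IsInternal ς) {R S : MultCyc.{u}}
    {a b : S.carrier} (hab : a ≠ b) (ρ : Iso (S.cut a b) R) (hS : S.IsCyc) (C D : CycSet.{u})
    {a₁ c : C.1.carrier} {b₁ d : D.1.carrier} (hac : a₁ ≠ c) (hbd : b₁ ≠ d)
    (κ : Iso (C.1.merge D.1 c d) S) (ha : κ.toEquiv (Graft.left a₁ hac) = a)
    (hb : κ.toEquiv (Graft.right b₁ hbd) = b) :
    ReachAt ς 0 R (ρ.onArc (S.cutArc a b (κ.onArc (C.1.mergeArcLeft D.1 c d (Sum.inl c)))))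
      (ρ.onArc (S.cutArc a b (κ.onArc (C.1.mergeArcRight D.1 c d (Sum.inl d)))))
      (P.map ρ (P.contr a b hab (ς ⟨S, hS⟩))) := by
  subst ha hb
  let T := C.1.disjointUnion D.1
  have h1 : (Sum.inl a₁ : C.1.carrier ⊕ D.1.carrier) ≠ Sum.inl c := fun h => hac (Sum.inl_injective h)
  have h2 : (Sum.inl a₁ : C.1.carrier ⊕ D.1.carrier) ≠ Sum.inr d := Sum.inl_ne_inr
  have h3 : (Sum.inr b₁ : C.1.carrier ⊕ D.1.carrier) ≠ Sum.inl c := Sum.inr_ne_inl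
  have h4 : (Sum.inr b₁ : C.1.carrier ⊕ D.1.carrier) ≠ Sum.inr d := fun h => hbd (Sum.inr_injective h)
  obtain ⟨θ, hθ⟩ := exists_cut_cut_iso T (a := Sum.inl c) (b := Sum.inr d) (c := Sum.inl a₁)
    (d := Sum.inr b₁) h1.symm h3.symm h2.symm h4.symm
  obtain ⟨θ', hθ'⟩ := exists_cut_iso κ (Graft.left a₁ hac) (Graft.right b₁ hbd)
  -- The exchange axiom: composing at `c`, `d` and contracting at `a₁`, `b₁` equals composing at
  -- `a₁`, `b₁` and contracting at `c`, `d`.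
  have e1 := P.contr_comp (zero_add 0) c a₁ d b₁ hac.symm hbd.symm (ς C) (ς D) θ
    (fun α => hθ (unionArcLeft C.1 D.1 α)) (fun α => hθ (unionArcRight C.1 D.1 α))
  have e2 := P.map_contr κ (Graft.left a₁ hac) (Graft.right b₁ hbd)
    (fun h => Sum.inl_ne_inr (congrArg Subtype.val h)) (P.comp c d (zero_add 0) (ς C) (ς D)) θ' hθ'
  have e3 : P.comp c d (zero_add 0) (ς C) (ς D) = ς (C.merge D c d) := hς.comp c d
  have e4 : P.map κ (ς (C.merge D c d)) = ς ⟨S, hS⟩ :=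
    hς.map (C := C.merge D c d) (D := ⟨S, hS⟩) κ
  refine ⟨C.1.merge D.1 a₁ b₁, Graft.left c hac.symm, Graft.right d hbd.symm,
    fun h => Sum.inl_ne_inr (congrArg Subtype.val h), θ.trans (θ'.trans ρ),
    P.comp a₁ b₁ (zero_add 0) (ς C) (ς D), ⟨C.2.merge D.2 a₁ b₁, hς.comp a₁ b₁⟩, ?_, ?_, ?_⟩
  · refine Eq.symm ((P.map_trans _ _ _).trans ((P.map_trans _ _ _).trans ?_))
    refine congrArg (P.map ρ) ((congrArg (P.map θ') e1).trans (e2.trans ?_))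
    exact congrArg (P.contr _ _ hab) ((congrArg (P.map κ) e3).trans e4)
  · refine (Iso.onArc_trans _ _ _).trans ((Iso.onArc_trans _ _ _).trans ?_)
    refine congrArg ρ.onArc ?_
    refine Eq.trans ?_ (hθ' _)
    refine congrArg θ'.onArc ?_
    refine Eq.trans ?_ (hθ (Sum.inl (Sum.inl c)))
    exact congrArg (fun α => θ.onArc (cutArc _ _ _ α))
      (T.cutArc_of_ne (Sum.inl a₁) (Sum.inr b₁) ⟨Sum.inl c, h1.symm, h3.symm⟩).symm
  · refine (Iso.onArc_trans _ _ _).trans ((Iso.onArc_trans _ _ _).trans ?_)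
    refine congrArg ρ.onArc ?_
    refine Eq.trans ?_ (hθ' _)
    refine congrArg θ'.onArc ?_
    refine Eq.trans ?_ (hθ (Sum.inl (Sum.inr d)))
    exact congrArg (fun α => θ.onArc (cutArc _ _ _ α))
      (T.cutArc_of_ne (Sum.inl a₁) (Sum.inr b₁) ⟨Sum.inr d, h2.symm, h4.symm⟩).symm

/-- The same for a multicyclically ordered set with two parts. -/
theorem Reach.reachAt_of_two_parts (hς : (forget.obj P).IsInternal ς) {R S T : MultCyc.{u}}
    {a b : S.carrier} (hab : a ≠ b) (ρ : Iso (S.cut a b) R) (hS : S.IsCyc)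
    {c d : T.carrier} (hcd : T.part c ≠ T.part d) (hT : ∀ k, k = T.part c ∨ k = T.part d)
    (κ : Iso (T.cut c d) S) {a₁ b₁ : Without c d} (ha : κ.toEquiv a₁ = a) (hb : κ.toEquiv b₁ = b)
    (hac : T.part a₁.1 = T.part c) (hbd : T.part b₁.1 = T.part d) :
    ReachAt ς 0 R (ρ.onArc (S.cutArc a b (κ.onArc (T.cutArc c d (Sum.inl c)))))
      (ρ.onArc (S.cutArc a b (κ.onArc (T.cutArc c d (Sum.inl d)))))
      (P.map ρ (P.contr a b hab (ς ⟨S, hS⟩))) := by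
  obtain ⟨σ, hl, hr⟩ := T.exists_union_iso hcd hT
  let C := T.partSet (T.part c)
  let D := T.partSet (T.part d)
  let c' : C.1.carrier := ⟨c, rfl⟩
  let d' : D.1.carrier := ⟨d, rfl⟩
  let a' : C.1.carrier := ⟨a₁.1, hac⟩
  let b' : D.1.carrier := ⟨b₁.1, hbd⟩
  have hac' : a' ≠ c' := fun h => a₁.2.1 (congrArg Subtype.val h)
  have hbd' : b' ≠ d' := fun h => b₁.2.2 (congrArg Subtype.val h)
  obtain ⟨θ, hθ⟩ : ∃ θ : Iso (C.1.merge D.1 c' d') (T.cut c d), ∀ α,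
      θ.onArc ((C.1.disjointUnion D.1).cutArc (Sum.inl c') (Sum.inr d') α) =
        T.cutArc c d (σ.onArc α) := by
    have := exists_cut_iso σ (Sum.inl c') (Sum.inr d')
    rw [hl, hr] at this
    exact this
  have key := Reach.reachAt_of_union (P := P) hς hab ρ hS C D hac' hbd' (θ.trans κ)
    (by
      rw [← ha]
      refine congrArg κ.toEquiv (Sum.inl_injective (β := (T.cut c d).EmptyPart) ?_)
      have h := (hθ (Sum.inl (Sum.inl a'))).trans
        ((congrArg (fun z => T.cutArc c d (Sum.inl z)) (hl a')).trans (T.cutArc_of_ne c d a₁))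
      exact (congrArg θ.onArc (C.1.mergeArcLeft_of_ne D.1 c' d' a' hac').symm).trans h)
    (by
      rw [← hb]
      refine congrArg κ.toEquiv (Sum.inl_injective (β := (T.cut c d).EmptyPart) ?_)
      have h := (hθ (Sum.inl (Sum.inr b'))).trans
        ((congrArg (fun z => T.cutArc c d (Sum.inl z)) (hr b')).trans (T.cutArc_of_ne c d b₁))
      exact (congrArg θ.onArc (C.1.mergeArcRight_of_ne D.1 c' d' b' hbd').symm).trans h)
  rw [Iso.onArc_trans, Iso.onArc_trans] at key
  have e1 : θ.onArc (C.1.mergeArcLeft D.1 c' d' (Sum.inl c')) = T.cutArc c d (Sum.inl c) :=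
    (hθ (Sum.inl (Sum.inl c'))).trans
      (congrArg (fun z => T.cutArc c d (Sum.inl z)) (hl c'))
  have e2 : θ.onArc (C.1.mergeArcRight D.1 c' d' (Sum.inl d')) = T.cutArc c d (Sum.inl d) :=
    (hθ (Sum.inl (Sum.inr d'))).trans
      (congrArg (fun z => T.cutArc c d (Sum.inl z)) (hr d'))
  rwa [e1, e2] at key

/-- The points of a contraction can be replaced by points on arcs of the two parts, if the genus
is zero. -/
theorem Reach.reachAt_of_zero (hς : (forget.obj P).IsInternal ς) {R S : MultCyc.{u}}
    {a b : S.carrier} (hab : a ≠ b) (ρ : Iso (S.cut a b) R) (hS : S.IsCyc) (ε ζ : S.Arc)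
    (h : (S.cut a b).arcPart (S.cutArc a b ε) ≠ (S.cut a b).arcPart (S.cutArc a b ζ)) :
    ReachAt ς 0 R (ρ.onArc (S.cutArc a b ε)) (ρ.onArc (S.cutArc a b ζ))
      (P.map ρ (P.contr a b hab (ς ⟨S, hS⟩))) := by
  obtain ⟨T, c, d, κ, hcd, rfl, rfl⟩ := S.exists_uncut ε ζ
  have hS1 : Nat.card S.index = 1 := Nat.card_eq_one_iff_unique.2 ⟨hS, inferInstance⟩
  have e := Nat.card_congr κ.indexEquiv
  have h0 : 0 < Nat.card T.index := Nat.card_pos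
  -- A cut within one part would leave at least two parts, but `S` has only one. Hence `T` has two
  -- parts, which are joined at `c` and `d`.
  have hp : T.part c ≠ T.part d := by
    intro hp
    rw [card_index_cut_of_eq T hcd hp] at e
    omega
  have hT : ∀ k, k = T.part c ∨ k = T.part d := by
    have h2 : Nat.card T.index = 2 := by rw [← card_index_cut_of_ne T hp, e, hS1]
    obtain ⟨y, hy, huniq⟩ := (Nat.card_eq_two_iff' (T.part c)).1 h2
    intro k
    by_cases hk : k = T.part c
    · exact Or.inl hk
    · exact Or.inr ((huniq k hk).trans (huniq _ hp.symm).symm)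
  obtain ⟨⟨a₁, hac, had⟩, rfl⟩ := κ.toEquiv.surjective a
  obtain ⟨⟨b₁, hbc, hbd⟩, rfl⟩ := κ.toEquiv.surjective b
  have hab₁ : a₁ ≠ b₁ := fun e => hab (by subst e; rfl)
  -- Performing the cuts in the other order, the separation of `ε` and `ζ` forces `c` and `d` into
  -- one part of the cut at `a₁`, `b₁`. A cut within a single part never joins parts, so `a₁` and
  -- `b₁` lie in different ones.
  have hpab : T.part a₁ ≠ T.part b₁ := by
    intro hpab
    obtain ⟨θ, hθ⟩ := T.exists_cut_cut_iso hac.symm hbc.symm had.symm hbd.symm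
    obtain ⟨θ', hθ'⟩ := exists_cut_iso κ ⟨a₁, hac, had⟩ ⟨b₁, hbc, hbd⟩
    rw [← hθ', ← hθ', θ'.arcPart_onArc, θ'.arcPart_onArc, θ'.indexEquiv.injective.ne_iff,
      ← hθ, ← hθ, θ.arcPart_onArc, θ.arcPart_onArc, θ.indexEquiv.injective.ne_iff] at h
    have h1 := T.cutArc_of_ne a₁ b₁ ⟨c, hac.symm, hbc.symm⟩
    have h2 := T.cutArc_of_ne a₁ b₁ ⟨d, had.symm, hbd.symm⟩
    have h3 := part_eq_of_arcPart_cutArc_ne (T.cut a₁ b₁) (u := ⟨c, hac.symm, hbc.symm⟩)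
      (v := ⟨d, had.symm, hbd.symm⟩) fun e => h
        ((congrArg (fun α => arcPart _ (cutArc _ _ _ α)) h1).trans
          (e.trans (congrArg (fun α => arcPart _ (cutArc _ _ _ α)) h2).symm))
    have h4 := (GluePerm.mk_eq_iff _ _ _).1 (Sum.inr_injective h3)
    have h5 := (T.part_eq_iff _ _).1 hpab
    have h6 : ¬ T.next.SameCycle c d := fun h => hp ((T.part_eq_iff _ _).2 h)
    rcases GluePerm.sameCycle_glue_cases h4 with h7 | ⟨h7, h8⟩
    · exact h6 h7
    · have h7' : T.next.SameCycle a₁ c := h7.elim id h5.trans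
      have h8' : T.next.SameCycle a₁ d := h8.elim id h5.trans
      exact h6 (h7'.symm.trans h8')
  rcases hT (T.part a₁) with ha | ha
  · have hb : T.part b₁ = T.part d := (hT (T.part b₁)).resolve_left fun hb => hpab (ha.trans hb.symm)
    exact Reach.reachAt_of_two_parts hς hab ρ hS hp hT κ rfl rfl ha hb
  · have hb : T.part b₁ = T.part c :=
      (hT (T.part b₁)).resolve_right fun hb => hpab (ha.trans hb.symm)
    obtain ⟨ρ', h1, h2⟩ := exists_contr_swap (P := P) hab ρ
    rw [← h1, ← h1, h2]
    exact Reach.reachAt_of_two_parts hς hab.symm ρ' hS hp hT κ rfl rfl hb ha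

/-- Replacing the points of a contraction if the surface has a handle. -/
theorem Reach.reachAt_of_card_le (hς : (forget.obj P).IsInternal ς) {g : ℕ}
    (hg : ∀ (S : MultCyc.{u}) (x y : P.obj S (g + 1)),
      Reach ς (g + 1) S x → Reach ς (g + 1) S y → x = y)
    {R S : MultCyc.{u}} {a b : S.carrier} (hab : a ≠ b) (ρ : Iso (S.cut a b) R)
    {y : P.obj S (g + 1)} (hy : Reach ς (g + 1) S y) (hR : Nat.card R.index ≤ g + 1) (ε ζ : R.Arc)
    (hε : ε = ρ.onArc (S.cutArc a b (Sum.inl a)) ∨ ε = ρ.onArc (S.cutArc a b (Sum.inl b))) :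
    ReachAt ς (g + 1) R ε ζ (P.map ρ (P.contr a b hab y)) := by
  obtain ⟨ζ', rfl⟩ := (ρ.onArc_surjective.comp (S.cutArc_surjective a b)) ζ
  have key : ∃ ε' : S.Arc, ε = ρ.onArc (S.cutArc a b ε') ∧
      (S.arcPart ε' ≠ S.arcPart ζ' ∨ Nat.card S.index ≤ g) := by
    by_cases hS : Nat.card S.index ≤ g
    · rcases hε with rfl | rfl
      · exact ⟨_, rfl, Or.inr hS⟩
      · exact ⟨_, rfl, Or.inr hS⟩
    -- Otherwise the cut adds a part, and the bound on `R` gives the excluded bound on `S`.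
    have hp : S.part a ≠ S.part b := by
      intro hp
      have e := Nat.card_congr ρ.indexEquiv
      rw [card_index_cut_of_eq S hab hp] at e
      obtain ⟨G, hG⟩ := P.geometric y
      omega
    rcases hε with rfl | rfl
    -- The arc of the cut through `a` has two representatives in `S`: the arc leaving `a` and the
    -- arc arriving at `b`. They lie in different parts, so one of them avoids the part of `ζ'`.
    · by_cases hz : S.part a = S.arcPart ζ'
      · refine ⟨S.endArc b, by rw [cutArc_start_left], Or.inl ?_⟩
        rw [arcPart_endArc, ← hz]
        exact hp.symm
      · exact ⟨Sum.inl a, rfl, Or.inl hz⟩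
    · by_cases hz : S.part b = S.arcPart ζ'
      · refine ⟨S.endArc a, by rw [cutArc_start_right], Or.inl ?_⟩
        rw [arcPart_endArc, ← hz]
        exact hp
      · exact ⟨Sum.inl b, rfl, Or.inl hz⟩
  obtain ⟨ε', rfl, h⟩ := key
  exact Reach.reachAt_of_succ hς hg hab ρ hy ε' ζ' h

/-- Replacing the points of a contraction by points on different parts. -/
theorem Reach.reachAt_of_arcPart_ne (hς : (forget.obj P).IsInternal ς) {g : ℕ}
    (hg : ∀ (S : MultCyc.{u}) (x y : P.obj S (g + 1)),
      Reach ς (g + 1) S x → Reach ς (g + 1) S y → x = y)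
    {R S : MultCyc.{u}} {a b : S.carrier} (hab : a ≠ b) (ρ : Iso (S.cut a b) R)
    {y : P.obj S (g + 1)} (hy : Reach ς (g + 1) S y) (ε ζ : R.Arc)
    (h : R.arcPart ε ≠ R.arcPart ζ)
    (h' : ¬ ((R.arcPart ε = R.arcPart (ρ.onArc (S.cutArc a b (Sum.inl a))) ∨
        R.arcPart ε = R.arcPart (ρ.onArc (S.cutArc a b (Sum.inl b)))) ∧
      (R.arcPart ζ = R.arcPart (ρ.onArc (S.cutArc a b (Sum.inl a))) ∨
        R.arcPart ζ = R.arcPart (ρ.onArc (S.cutArc a b (Sum.inl b)))))) :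
    ReachAt ς (g + 1) R ε ζ (P.map ρ (P.contr a b hab y)) := by
  obtain ⟨ε', rfl⟩ := (ρ.onArc_surjective.comp (S.cutArc_surjective a b)) ε
  obtain ⟨ζ', rfl⟩ := (ρ.onArc_surjective.comp (S.cutArc_surjective a b)) ζ
  simp only [Function.comp, ρ.arcPart_onArc, ρ.indexEquiv.injective.eq_iff, ne_eq] at h h'
  refine Reach.reachAt_of_succ hς hg hab ρ hy ε' ζ' (Or.inl fun hp => ?_)
  exact (S.arcPart_cutArc_cases a b hp).elim h h'

/-- A reachable element is determined by its arity and its genus. -/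
theorem Reach.unique (hς : (forget.obj P).IsInternal ς) {g : ℕ} {R : MultCyc.{u}}
    {x y : P.obj R g} (hx : Reach ς g R x) (hy : Reach ς g R y) : x = y := by
  induction g generalizing R with
  | zero =>
    obtain ⟨_, rfl⟩ := hx
    obtain ⟨_, rfl⟩ := hy
    rfl
  | succ g ih =>
    have hg : ∀ (S : MultCyc.{u}) (x y : P.obj S g), Reach ς g S x → Reach ς g S y → x = y :=
      fun _ _ _ => ih
    obtain ⟨S, a, b, hab, ρ, x, hx, rfl⟩ := hx
    obtain ⟨S', a', b', hab', ρ', x', hx', rfl⟩ := hy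
    set α := ρ.onArc (S.cutArc a b (Sum.inl a)) with hα
    set β := ρ.onArc (S.cutArc a b (Sum.inl b)) with hβ
    set α' := ρ'.onArc (S'.cutArc a' b' (Sum.inl a')) with hα'
    set β' := ρ'.onArc (S'.cutArc a' b' (Sum.inl b')) with hβ'
    have at' : ReachAt ς g R α' β' (P.map ρ' (P.contr a' b' hab' x')) :=
      ⟨S', a', b', hab', ρ', x', hx', rfl, rfl, rfl⟩
    cases g with
    | zero =>
      obtain ⟨hS, rfl⟩ := hx
      -- A cyclically ordered set is cut into two parts, with one of the two arcs in each. The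
      -- points of the other contraction are therefore moved to `α'` and `β'`.
      have hp : R.arcPart α' ≠ R.arcPart β' := by
        rw [hα', hβ', ρ'.arcPart_onArc, ρ'.arcPart_onArc, ρ'.indexEquiv.injective.ne_iff]
        obtain ⟨hS', -⟩ := hx'
        exact S'.arcPart_cutArc_ne_of_part_eq hab' (@Subsingleton.elim _ hS' _ _)
      refine ReachAt.unique hς hg (fun h => hp (congrArg _ h)) ?_ at'
      obtain ⟨ε, hε⟩ := (ρ.onArc_surjective.comp (S.cutArc_surjective a b)) α'
      obtain ⟨ζ, hζ⟩ := (ρ.onArc_surjective.comp (S.cutArc_surjective a b)) β'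
      rw [← hε, ← hζ] at hp ⊢
      simp only [Function.comp, ρ.arcPart_onArc, ρ.indexEquiv.injective.ne_iff] at hp
      exact Reach.reachAt_of_zero hς hab ρ hS ε ζ hp
    | succ g =>
      obtain ⟨G, hG⟩ := P.geometric (P.map ρ (P.contr a b hab x))
      -- The genus of `R` is `g + 2`, so `g + 3 = b + 2G`: this bound means that there is a handle.
      by_cases hR : Nat.card R.index ≤ g + 1
      · by_cases hne : ∃ ε ζ, (ε = α ∨ ε = β) ∧ (ζ = α' ∨ ζ = β') ∧ ε ≠ ζ
        · obtain ⟨ε, ζ, hε, hζ, hεζ⟩ := hne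
          exact ReachAt.unique hς hg hεζ
            (Reach.reachAt_of_card_le hς hg hab ρ hx hR ε ζ hε)
            (Reach.reachAt_of_card_le hς hg hab' ρ' hx' hR ζ ε hζ).symm
        · push Not at hne
          have h1 : α = α' := hne _ _ (Or.inl rfl) (Or.inl rfl)
          have h2 : α = β' := hne _ _ (Or.inl rfl) (Or.inr rfl)
          have h3 : β = α' := hne _ _ (Or.inr rfl) (Or.inl rfl)
          -- All four arcs coincide. In each presentation one of the points is then alone in its
          -- part, and it is made the first one by symmetry of the contraction.
          have alone : ∀ {S : MultCyc.{u}} {a b : S.carrier} (hab : a ≠ b) (ρ : Iso (S.cut a b) R)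
              (x : P.obj S (g + 1)), ρ.onArc (S.cutArc a b (Sum.inl a)) = α →
              ρ.onArc (S.cutArc a b (Sum.inl b)) = α →
              ∃ (c d : S.carrier) (hcd : c ≠ d) (τ : Iso (S.cut c d) R), S.next c = c ∧
                τ.onArc (S.cutArc c d (Sum.inl c)) = α ∧ τ.onArc (S.cutArc c d (Sum.inl d)) = α ∧
                P.map ρ (P.contr a b hab x) = P.map τ (P.contr c d hcd x) := by
            intro S a b hab ρ x ha hb
            rcases S.next_eq_self_of_cutArc_eq hab (ρ.onArc_injective (ha.trans hb.symm)) with h | h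
            · exact ⟨a, b, hab, ρ, h, ha, hb, rfl⟩
            · obtain ⟨τ, h1, h2⟩ := exists_contr_swap (P := P) hab ρ
              exact ⟨b, a, hab.symm, τ, h, (h1 _).trans hb, (h1 _).trans ha, h2 _ x⟩
          obtain ⟨c, d, hcd, τ, hc, e1, e2, e3⟩ := alone hab ρ x rfl (h3.trans h1.symm)
          obtain ⟨c', d', hcd', τ', hc', e1', e2', e3'⟩ := alone hab' ρ' x' h1.symm h2.symm
          rw [e3, e3']
          exact Reach.contr_unique hς hg hcd hcd' τ τ' hx hx' (e1.trans e1'.symm)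
            (e2.trans e2'.symm) (Or.inr ⟨hc, hc'⟩)
      -- Without a handle `b = g + 3`, and a cut joining two parts could not end with so many.
      · have hsep : ∀ {S : MultCyc.{u}} {a b : S.carrier} (hab : a ≠ b) (ρ : Iso (S.cut a b) R)
            (x : P.obj S (g + 1)), R.arcPart (ρ.onArc (S.cutArc a b (Sum.inl a))) ≠
              R.arcPart (ρ.onArc (S.cutArc a b (Sum.inl b))) := by
          intro S a b hab ρ x
          rw [ρ.arcPart_onArc, ρ.arcPart_onArc, ρ.indexEquiv.injective.ne_iff]
          refine S.arcPart_cutArc_ne_of_part_eq hab ?_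
          by_contra hp
          have e := Nat.card_congr ρ.indexEquiv
          have e' := card_index_cut_of_ne S hp
          obtain ⟨G', hG'⟩ := P.geometric x
          omega
        have hs := hsep hab ρ x
        have hs' := hsep hab' ρ' x'
        rw [← hα, ← hβ] at hs
        rw [← hα', ← hβ'] at hs'
        -- There are `g + 3 ≥ 3` parts, hence a third one beside those of `α` and `β`.
        obtain ⟨k, hk, hk'⟩ : ∃ k, k ≠ R.arcPart α ∧ k ≠ R.arcPart β := by
          by_contra hk
          push Not at hk
          have hsurj : Function.Surjective fun t : Bool =>
              if t then R.arcPart α else R.arcPart β := by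
            intro i
            by_cases hi : i = R.arcPart α
            · exact ⟨true, hi.symm⟩
            · exact ⟨false, (hk i hi).symm⟩
          have := Nat.card_le_card_of_surjective _ hsurj
          rw [Nat.card_eq_fintype_card (α := Bool), Fintype.card_bool] at this
          omega
        obtain ⟨i, j, hij, h1, h2⟩ : ∃ i j, i ≠ j ∧
            ¬ ((i = R.arcPart α ∨ i = R.arcPart β) ∧ (j = R.arcPart α ∨ j = R.arcPart β)) ∧
            ¬ ((i = R.arcPart α' ∨ i = R.arcPart β') ∧
              (j = R.arcPart α' ∨ j = R.arcPart β')) := by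
          -- If the parts of `α` and `k` are those of `α'` and `β'`, then the part of `β` is not
          -- among the latter, and it replaces that of `α`.
          by_cases hc : (R.arcPart α = R.arcPart α' ∨ R.arcPart α = R.arcPart β') ∧
              (k = R.arcPart α' ∨ k = R.arcPart β')
          · exact ⟨R.arcPart β, k, hk'.symm, by tauto, by grind⟩
          · exact ⟨R.arcPart α, k, hk.symm, by tauto, hc⟩
        obtain ⟨ε, rfl⟩ := R.arcPart_surjective i
        obtain ⟨ζ, rfl⟩ := R.arcPart_surjective j
        exact ReachAt.unique hς hg (fun h => hij (congrArg _ h))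
          (Reach.reachAt_of_arcPart_ne hς hg hab ρ hx ε ζ hij h1)
          (Reach.reachAt_of_arcPart_ne hς hg hab' ρ' hx' ε ζ hij h2)

/-- The value at a geometric pair is its only reachable element. Reachable elements are closed under
isomorphisms, compositions and contractions, so uniqueness makes the family internal. -/
theorem existsUnique_isInternal (P : NsModularOperad.{u, v}) (ς : ∀ C : CycSet.{u}, P.obj C.1 0)
    (hς : (forget.obj P).IsInternal ς) :
    ∃! ϖ : ∀ (S : MultCyc.{u}) (g : ℕ), S.Geometric g → P.obj S g,
      P.IsInternal ϖ ∧ ∀ C : CycSet.{u}, ϖ C.1 0 C.2.geometric_zero = ς C := by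
  choose ϖ hϖ using fun (S : MultCyc.{u}) (g : ℕ) (h : S.Geometric g) => exists_reach hς h
  refine ⟨ϖ, ⟨⟨fun ρ hS hT => ?_, fun a b hk hS hT hST => ?_, fun a b hab hS hS' => ?_⟩,
    fun C => ?_⟩, ?_⟩
  · exact Reach.unique hς ((hϖ _ _ hS).map hς ρ) (hϖ _ _ hT)
  · exact Reach.unique hς ((hϖ _ _ hS).comp hς (hϖ _ _ hT) a b hk) (hϖ _ _ hST)
  · exact Reach.unique hς ((hϖ _ _ hS).contr hab) (hϖ _ _ hS')
  · exact Reach.unique hς (hϖ _ _ _) ⟨C.2, rfl⟩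
  · rintro ϖ' ⟨h, h0⟩
    -- Any other extension is compatible with contractions and isomorphisms, so it takes the value
    -- `x` wherever `x` is reachable.
    have key : ∀ (g : ℕ) (S : MultCyc.{u}) (x : P.obj S g) (hS : S.Geometric g),
        Reach ς g S x → ϖ' S g hS = x := by
      intro g
      induction g with
      | zero =>
        rintro S x hS ⟨hC, rfl⟩
        exact h0 ⟨S, hC⟩
      | succ g ih =>
        rintro S x hS ⟨S', a, b, hab, ρ, y, hy, rfl⟩
        have hS' := P.geometric y
        rw [← ih S' y hS' hy, h.contr a b hab hS' (hS'.cut hab), h.map ρ _ hS]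
    funext S g hS
    exact key g S _ hS (hϖ S g hS)

/-- A morphism from the one-point operad is an internal family indexed by the geometric pairs; at
all other pairs its components have empty source. -/
theorem isEnvelope_point : IsEnvelope forget.{u, v} NsCyclicOperad.point point := by
  refine ⟨NsCyclicOperad.Hom.mk (fun C _ => ⟨PUnit.unit, C.2.geometric_zero⟩) (fun _ _ => rfl)
    (fun _ _ _ _ => rfl), fun P f => ?_⟩
  let f' : NsCyclicOperad.Hom NsCyclicOperad.point P.genusZero := f
  obtain ⟨ϖ, ⟨hϖ, h0⟩, huniq⟩ := P.existsUnique_isInternal (fun C => f'.app C PUnit.unit)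
    ⟨fun ρ => (f'.app_map ρ PUnit.unit).symm,
      fun a b => (f'.app_comp a b PUnit.unit PUnit.unit).symm⟩
  refine ⟨Hom.mk (fun S g x => ϖ S g x.2) (fun ρ x => (hϖ.map ρ _ _).symm)
    (fun a b hk x y => (hϖ.comp a b hk _ _ _).symm)
    (fun a b hab x => (hϖ.contr a b hab _ _).symm), ?_, ?_⟩
  · refine NsCyclicOperad.Hom.ext ?_
    funext C x
    exact h0 C
  · intro F hF
    let F' : Hom point P := F
    have := huniq (fun S g hS => F'.app S g ⟨PUnit.unit, hS⟩)
      ⟨⟨fun ρ hS _ => (F'.app_map ρ ⟨PUnit.unit, hS⟩).symm,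
        fun a b hk hS hT _ => (F'.app_comp a b hk ⟨PUnit.unit, hS⟩ ⟨PUnit.unit, hT⟩).symm,
        fun a b hab hS _ => (F'.app_contr a b hab ⟨PUnit.unit, hS⟩).symm⟩, fun C => by
          subst hF; rfl⟩
    refine Hom.ext ?_
    funext S g x
    exact congrFun (congrFun (congrFun this S) g) x.2

end NsModularOperad

/-! ### Terminal operads -/

theorem CyclicOperad.nonempty_isTerminal_point :
    Nonempty (Limits.IsTerminal CyclicOperad.point.{u, v}) :=
  ⟨Limits.IsTerminal.ofUniqueHom
    (fun _ => CyclicOperad.Hom.mk (fun _ _ _ => PUnit.unit) (fun _ _ => rfl) fun _ _ _ _ => rfl)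
    fun _ _ => CyclicOperad.Hom.ext rfl⟩

theorem ModularOperad.nonempty_isTerminal_point :
    Nonempty (Limits.IsTerminal ModularOperad.point.{u, v}) :=
  ⟨Limits.IsTerminal.ofUniqueHom
    (fun _ => ModularOperad.Hom.mk (fun _ _ _ _ => PUnit.unit) (fun _ _ => rfl)
      (fun _ _ _ _ _ => rfl) fun _ _ _ _ => rfl)
    fun _ _ => ModularOperad.Hom.ext rfl⟩

theorem NsCyclicOperad.nonempty_isTerminal_point :
    Nonempty (Limits.IsTerminal NsCyclicOperad.point.{u, v}) :=
  ⟨Limits.IsTerminal.ofUniqueHom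
    (fun _ => NsCyclicOperad.Hom.mk (fun _ _ => PUnit.unit) (fun _ _ => rfl) fun _ _ _ _ => rfl)
    fun _ _ => NsCyclicOperad.Hom.ext rfl⟩

theorem NsModularOperad.nonempty_isTerminal_point :
    Nonempty (Limits.IsTerminal NsModularOperad.point.{u, v}) :=
  ⟨Limits.IsTerminal.ofUniqueHom
    (fun P => NsModularOperad.Hom.mk (fun _ _ x => ⟨PUnit.unit, P.geometric x⟩) (fun _ _ => rfl)
      (fun _ _ _ _ _ => rfl) fun _ _ _ _ => rfl)
    fun _ _ => NsModularOperad.Hom.ext rfl⟩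

theorem mainTheorem1 :
    -- the symmetric case
    (Nonempty (Limits.IsTerminal CyclicOperad.point.{u, v}) ∧
      Nonempty (Limits.IsTerminal ModularOperad.point.{u, v}) ∧
      IsEnvelope ModularOperad.forget.{u, v} CyclicOperad.point ModularOperad.point ∧
      (∀ Mod : CyclicOperad.{u, v} ⥤ ModularOperad.{u, v}, (Mod ⊣ ModularOperad.forget) →
        Nonempty (Mod.obj CyclicOperad.point ≅ ModularOperad.point)) ∧
      (∀ (P : ModularOperad.{u, v}) (ς : ∀ (S : Type u) [Finite S], P.obj S 0),
        (ModularOperad.forget.obj P).IsInternal ς →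
          ∃! ϖ : ∀ (S : Type u) [Finite S] (g : ℕ), P.obj S g,
            P.IsInternal ϖ ∧ ∀ (S : Type u) [Finite S], ϖ S 0 = ς S)) ∧
    -- the non-symmetric case
    (Nonempty (Limits.IsTerminal NsCyclicOperad.point.{u, v}) ∧
      Nonempty (Limits.IsTerminal NsModularOperad.point.{u, v}) ∧
      IsEnvelope NsModularOperad.forget.{u, v} NsCyclicOperad.point NsModularOperad.point ∧
      (∀ Mod : NsCyclicOperad.{u, v} ⥤ NsModularOperad.{u, v}, (Mod ⊣ NsModularOperad.forget) →
        Nonempty (Mod.obj NsCyclicOperad.point ≅ NsModularOperad.point)) ∧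
      (∀ (P : NsModularOperad.{u, v}) (ς : ∀ C : CycSet.{u}, P.obj C.1 0),
        (NsModularOperad.forget.obj P).IsInternal ς →
          ∃! ϖ : ∀ (S : MultCyc.{u}) (g : ℕ), S.Geometric g → P.obj S g,
            P.IsInternal ϖ ∧ ∀ C : CycSet.{u}, ϖ C.1 0 C.2.geometric_zero = ς C)) := by
  exact ⟨⟨CyclicOperad.nonempty_isTerminal_point, ModularOperad.nonempty_isTerminal_point,
      ModularOperad.isEnvelope_point, ModularOperad.isEnvelope_point.nonempty_iso,
      ModularOperad.existsUnique_isInternal⟩,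
    NsCyclicOperad.nonempty_isTerminal_point, NsModularOperad.nonempty_isTerminal_point,
    NsModularOperad.isEnvelope_point, NsModularOperad.isEnvelope_point.nonempty_iso,
    NsModularOperad.existsUnique_isInternal⟩
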